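/- Let $0\le\mu<1$. All powers and arguments are principal. For $\lambda\ge 0$ and $a\neq0$ with $|\arg a|<\pi/2$ put $X_k^{\pm}=(2k+1)\pi a\pm i\lambda a$, $X_k=X_k^+$, $F_\mu(z)=z^{\mu-1/2}K_{1/2-\mu}(z)$, where $K_\nu$ is the modified Bessel function of the second kind on $|\arg z|<\pi$, and $$S_\mu^-(a;\lambda)=\sum_{n=0}^\infty\frac{(-1)^ne^{-\lambda n}}{(n^2+a^2)^\mu}\ (\lambda>0),\qquad H_\mu^-(a;\lambda)=a^{1-2\mu}\int_0^1\frac{\sin(\lambda at)}{\sinh(\pi at)}\,\frac{dt}{(1-t^2)^{\mu}},$$ $$T_\mu(a;\lambda)=\frac{2^{1/2-\mu}\,\Gamma(1-\mu)}{\sqrt\pi}\,a^{1-2\mu}\sum_{k=0}^\infty i\left(e^{-\pi i\mu}F_\mu(X_k^+)-e^{\pi i\mu}F_\mu(X_k^-)\right).$$ 1. For $\lambda>0$, $a\ne0$ and $|\arg a|<\pi/2$, the series defining $S_\mu^-(a;\lambda)$, $\sum_k F_\mu(X_k^+)$ and $\sum_kF_\mu(X_k^-)$ converge absolutely, the integrand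 of $H_\mu^-$ is integrable on $(0,1)$, and $$S_\mu^-(a;\lambda)=\frac1{2a^{2\mu}}+H_\mu^-(a;\lambda)+T_\mu(a;\lambda).$$ 2. For $\lambda>0$, $a>0$ and $\theta_k=\arg F_\mu(X_k)$, $$T_\mu(a;\lambda)=\frac{2^{3/2-\mu}\sqrt\pi}{a^{2\mu-1}}\cdot\frac{\Gamma(1-\mu)}{\pi}\sum_{k=0}^\infty\sin(\pi\mu-\theta_k)\,\left|X_k^{\mu-1/2}K_{1/2-\mu}(X_k)\right|,$$ the series being absolutely convergent. Hence for $0<\mu<1$, where $\Gamma(1-\mu)/\pi=1/(\Gamma(\mu)\sin\pi\mu)$, $$S_\mu^-(a;\lambda)=\frac1{2a^{2\mu}}+H_\mu^-(a;\lambda)+\frac{2^{3/2-\mu}\sqrt\pi}{a^{2\mu-1}\Gamma(\mu)}\sum_{k=0}^\infty\frac{\sin(\pi\mu-\theta_k)}{\sin\pi\mu}\left|\frac{K_{1/2-\mu}(X_k)}{X_k^{1/2-\mu}}\right|.$$ 3. Let $\lambda>0$. Then $T_\mu(a;\lambda)=O(a^{1-2\mu}e^{-\pi a})$ as $a\to+\infty$.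 More generally, for every $\varphi<\pi/2$ there is a constant $C=C(\mu,\lambda,\varphi)$ such that $|T_\mu(a;\lambda)|\le C|a|^{1-2\mu}e^{-\pi\operatorname{Re}a+\lambda|\operatorname{Im}a|}$ whenever $|a|\ge1$ and $|\arg a|\le\varphi$. 4. (Olver's case $\lambda=0$.) $H_\mu^-(a;0)=0$ for $a\neq 0$, $|\arg a|<\pi/2$, and $\theta_k=0$ for all $k$ if $\lambda=0$ and $a>0$. If $0<\mu<1$, $a\ne0$ and $|\arg a|<\pi/2$, then $$T_\mu(a;0)=\frac{2^{3/2-\mu}\sqrt\pi}{a^{2\mu-1}\Gamma(\mu)}\sum_{k=0}^\infty\frac{K_{1/2-\mu}((2k+1)\pi a)}{((2k+1)\pi a)^{1/2-\mu}},$$ this series being absolutely convergent, and the partial sums of $\sum_{n\ge0}(-1)^n(n^2+a^2)^{-\mu}$ converge to $\dfrac1{2a^{2\mu}}+T_\mu(a;0)$. -/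

import Mathlib

open Filter Topology Asymptotics

noncomputable section

/-- The modified Bessel function of the first kind of real order `ν`, on the principal branch:
`I_ν(z) = (z/2)^ν ∑_{k ≥ 0} (z²/4)^k / (k! Γ(ν+k+1))`. Where `ν+k+1` is a pole of `Γ`, the term is
zero, as it should be, because there `Complex.Gamma` has the value `0`. -/
def besselI (ν : ℝ) (z : ℂ) : ℂ :=
  (z / 2) ^ (ν : ℂ) *
    ∑' k : ℕ, (z ^ 2 / 4) ^ k / ((k.factorial : ℂ) * Complex.Gamma ((ν : ℂ) + k + 1))

/-- The quotient `(π/2) (I_{-ν}(z) - I_ν(z)) / sin (πν)`. -/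
def besselKQuot (ν : ℝ) (z : ℂ) : ℂ :=
  (Real.pi / 2 : ℂ) * (besselI (-ν) z - besselI ν z) / Complex.sin (Real.pi * ν)

open Classical in
/-- The modified Bessel function of the second kind (Macdonald function) `K_ν(z)` of real order,
on the principal branch `|arg z| < π`: the quotient above if `ν` is not an integer, and its limit
as the order tends to `ν` if `ν` is an integer. -/
def besselK (ν : ℝ) (z : ℂ) : ℂ :=
  if ∃ n : ℤ, ν = n then limUnder (𝓝[≠] ν) (fun s : ℝ => besselKQuot s z)
  else besselKQuot ν z

/-- The `n`-th term `(-1)^n e^{-λn} / (n² + a²)^μ` of the alternating series. -/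
def mathieuTerm (μ lam : ℝ) (a : ℂ) (n : ℕ) : ℂ :=
  (-1) ^ n * Complex.exp (-(lam * n)) / ((n : ℂ) ^ 2 + a ^ 2) ^ (μ : ℂ)

/-- The alternating series `S_μ^-(a;λ)`. -/
def mathieuS (μ lam : ℝ) (a : ℂ) : ℂ := ∑' n : ℕ, mathieuTerm μ lam a n

/-- The integrand `sin(λat) / sinh(πat) · (1 - t²)^{-μ}`. -/
def mathieuHIntegrand (μ lam : ℝ) (a : ℂ) (t : ℝ) : ℂ :=
  Complex.sin (lam * a * t) / Complex.sinh (Real.pi * a * t) * (((1 - t ^ 2) ^ (-μ) : ℝ) : ℂ)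

/-- `H_μ^-(a;λ)`. -/
def mathieuH (μ lam : ℝ) (a : ℂ) : ℂ :=
  a ^ (1 - 2 * μ : ℂ) * ∫ t in (0 : ℝ)..1, mathieuHIntegrand μ lam a t

/-- `X_k = (2k+1)πa + iλa`. -/
def mathieuX (lam : ℝ) (a : ℂ) (k : ℕ) : ℂ :=
  (2 * k + 1) * Real.pi * a + lam * Complex.I * a

/-- `F_μ(z) = z^{μ-1/2} K_{1/2-μ}(z)`. -/
def scaledK (μ : ℝ) (z : ℂ) : ℂ := z ^ (μ - 1 / 2 : ℂ) * besselK (1 / 2 - μ) z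

/-- The contribution `T_μ(a;λ)` of the two paths beyond the branch points `± ia`. The second path
involves `(2k+1)πa - iλa`, which is the conjugate of `X_k` when `a > 0`. -/
def mathieuT (μ lam : ℝ) (a : ℂ) : ℂ :=
  ((2 ^ (1 / 2 - μ) * Real.Gamma (1 - μ) / √Real.pi : ℝ) : ℂ) * a ^ (1 - 2 * μ : ℂ) *
    ∑' k : ℕ, Complex.I *
      (Complex.exp (-(Real.pi * Complex.I * μ)) * scaledK μ (mathieuX lam a k) -
        Complex.exp (Real.pi * Complex.I * μ) * scaledK μ (mathieuX (-lam) a k))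

/-- `θ_k = arg (X_k^{μ-1/2} K_{1/2-μ}(X_k))`. -/
def mathieuTheta (μ lam : ℝ) (a : ℂ) (k : ℕ) : ℝ :=
  Complex.arg (scaledK μ (mathieuX lam a k))

/-- The right-hand side of Olver's expansion of `∑ (-1)^n / (n² + a²)^μ`, without its first term
`1/(2a^{2μ})`. -/
def olverSeries (μ : ℝ) (a : ℂ) : ℂ :=
  ((2 ^ (3 / 2 - μ) * √Real.pi : ℝ) : ℂ) / (a ^ (2 * μ - 1 : ℂ) * (Real.Gamma μ : ℂ)) *
    ∑' k : ℕ, besselK (1 / 2 - μ) ((2 * k + 1) * Real.pi * a) /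
      ((2 * k + 1) * Real.pi * a) ^ (1 / 2 - μ : ℂ)

end

/-! The conditions on `a` say `Re a > 0`. The terms of the series are the values at the integers `n
≥ 0` of `f(x) = e^{-πix} e^{-λ|x|} (x² + a²)^{-μ}` (`mathieuFun`), and `f(-n) = f(n)`. Hence `2S -
a^{-2μ}` is the sum of `f` over `ℤ`, and Poisson summation turns it into the sum of the Fourier
transforms of `f` at the integers. Splitting the Fourier integral at `0` gives the Laplace
transforms of `(x² + a²)^{-μ}` at `λ ∓ (2n+1)πi`; the frequencies `n` and `-n-1` contribute equally,
which cancels the factor `2` (`mathieuS_eq`).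

Each Laplace transform is evaluated by moving the contour (`integral_exp_neg_mul_cpow_eq`). For `s`
in the open fourth quadrant, `[0,∞)` is deformed into the segment from `0` to the branch point `ia`
followed by the horizontal ray from `ia`. On the segment `x² + a² = a²(1 - t²)`. The ray, after a
rotation, gives a Macdonald function at `ias`, which is `X_k` for `s = λ - (2k+1)πi`; the phase `i
e^{-πiμ}` comes from the powers. Complex conjugation treats the first quadrant. Adding the two
transforms and summing over `k`, the segments produce a sine times the geometric series of `1/sinh`,
that is `H`, and the rays produce `T`. Cauchy's theorem is used as a homotopy statement, which is
Fubini for a mixed derivative over a strip (`integral_Ioi_sub_eq_of_homotopy`).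

The contour yields `K` as a Laplace integral, whereas `besselK` is defined by power series. The
bridge is `scaledK_eq`. The functions `z^{-ν} I_ν`, `z^{-ν} I_{-ν}` and the Laplace integral solve
one second-order equation, so the third is a combination of the first two with coefficients read off
from Wronskians. These are constant and are computed as `z → 0+`. The integer order `ν = 0` (`μ =
1/2`) follows by continuity in the order.

The Laplace integral also gives the geometric decay in `k` and hence the bounds for `T`, and its
conjugation symmetry gives the modulus-phase form for `a > 0`. For `λ = 0` the alternating series
converges by summation by parts, and its sum is found from Abel's theorem by letting `λ → 0+` in the
exact formula. -/

/-! ### The entire function underlying `I_ν`. -/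

/-- The entire function `∑ yᵏ / (k! Γ(ν+k+1))`. -/
noncomputable def besselE (ν : ℝ) (y : ℂ) : ℂ :=
  ∑' k : ℕ, y ^ k / ((k.factorial : ℂ) * Complex.Gamma ((ν : ℂ) + k + 1))

/-- `Γ` is increasing on `[2, ∞)` with `Γ(2) = 1`, so only finitely many `k` can violate the bound
`1`, and their values are simply added. Poles are harmless, since the inverse of the default value
`0` is `0`. -/
lemma exists_norm_inv_Gamma_le (ν : ℝ) :
    ∃ B : ℝ, 0 ≤ B ∧ ∀ k : ℕ, ‖(Complex.Gamma ((ν : ℂ) + k + 1))⁻¹‖ ≤ B := by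
  have hev : ∀ᶠ k : ℕ in atTop, ‖(Complex.Gamma ((ν : ℂ) + k + 1))⁻¹‖ ≤ 1 := by
    have h1 : ∀ᶠ k : ℕ in atTop, 1 - ν ≤ (k : ℝ) :=
      tendsto_natCast_atTop_atTop.eventually_ge_atTop _
    filter_upwards [h1] with k hk
    have h2 : (1 : ℝ) ≤ Real.Gamma (ν + k + 1) := by
      have := Real.Gamma_strictMonoOn_Ici.monotoneOn (Set.mem_Ici.2 le_rfl)
        (Set.mem_Ici.2 (show 2 ≤ ν + k + 1 by linarith)) (by linarith)
      rwa [Real.Gamma_two] at this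
    have h3 : Complex.Gamma ((ν : ℂ) + k + 1) = (Real.Gamma (ν + k + 1) : ℂ) := by
      rw [← Complex.Gamma_ofReal]; push_cast; rfl
    rw [h3, norm_inv, Complex.norm_real, Real.norm_of_nonneg (by linarith)]
    exact inv_le_one_of_one_le₀ h2
  obtain ⟨N, hN⟩ := eventually_atTop.1 hev
  refine ⟨1 + ∑ k ∈ Finset.range N, ‖(Complex.Gamma ((ν : ℂ) + k + 1))⁻¹‖, by positivity, ?_⟩
  intro k
  by_cases hk : N ≤ k
  · have : 0 ≤ ∑ k ∈ Finset.range N, ‖(Complex.Gamma ((ν : ℂ) + k + 1))⁻¹‖ := by positivity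
    linarith [hN k hk]
  · have := Finset.single_le_sum (f := fun k : ℕ => ‖(Complex.Gamma ((ν : ℂ) + k + 1))⁻¹‖)
      (fun i _ => norm_nonneg _) (Finset.mem_range.2 (not_le.1 hk))
    linarith

lemma summable_besselE (ν : ℝ) (y : ℂ) :
    Summable fun k : ℕ => y ^ k / ((k.factorial : ℂ) * Complex.Gamma ((ν : ℂ) + k + 1)) := by
  obtain ⟨B, hB0, hB⟩ := exists_norm_inv_Gamma_le ν
  refine Summable.of_norm_bounded ((Real.summable_pow_div_factorial ‖y‖).mul_right B) fun k => ?_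
  rw [div_mul_eq_div_div, div_eq_mul_inv, norm_mul, norm_div, norm_pow]
  simp only [Complex.norm_natCast]
  gcongr
  exact hB k

/-- Termwise differentiation, with a majorant uniform on the ball of radius `|y| + 1`. The factor
`k` cancels against `k!`, and the index shift raises the order by one. -/
lemma hasDerivAt_besselE (ν : ℝ) (y : ℂ) :
    HasDerivAt (besselE ν) (besselE (ν + 1) y) y := by
  obtain ⟨B, hB0, hB⟩ := exists_norm_inv_Gamma_le ν
  set g' : ℕ → ℂ → ℂ := fun k w =>
    (k * w ^ (k - 1)) / ((k.factorial : ℂ) * Complex.Gamma ((ν : ℂ) + k + 1)) with hg'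
  have hstep : ∀ k w, g' (k + 1) w =
      w ^ k / ((k.factorial : ℂ) * Complex.Gamma (((ν + 1 : ℝ) : ℂ) + k + 1)) := by
    intro k w
    simp only [hg', Nat.factorial_succ, Nat.add_sub_cancel]
    push_cast
    have : (k : ℂ) + 1 ≠ 0 := by exact_mod_cast Nat.succ_ne_zero k
    rw [mul_assoc, mul_div_mul_left _ _ this]
    congr 3
    ring
  set R := ‖y‖ + 1
  set u : ℕ → ℝ := fun k => (k * R ^ (k - 1)) / k.factorial * B
  have hu : Summable u := by
    rw [← summable_nat_add_iff 1]
    refine ((Real.summable_pow_div_factorial R).mul_right B).congr fun k => ?_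
    simp only [u, Nat.factorial_succ, Nat.add_sub_cancel]
    push_cast
    rw [mul_div_mul_left _ _ (by positivity)]
  have h := hasDerivAt_tsum_of_isPreconnected (𝕜 := ℂ) (u := u)
    (g := fun (k : ℕ) w => w ^ k / ((k.factorial : ℂ) * Complex.Gamma ((ν : ℂ) + k + 1)))
    (g' := g') (t := Metric.ball 0 R) (y₀ := y) (y := y) hu Metric.isOpen_ball
    (convex_ball 0 R).isPreconnected
    (fun k w _ => (hasDerivAt_pow k w).div_const _)
    (fun k w hw => by
      have hw' : ‖w‖ ≤ R := by simpa using (Metric.mem_ball.1 hw).le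
      simp only [hg', u]
      rw [div_mul_eq_div_div, div_eq_mul_inv, norm_mul, norm_div, norm_mul, norm_pow]
      simp only [Complex.norm_natCast]
      gcongr
      exact hB k)
    (by simp [R]) (summable_besselE ν y) (by simp [R])
  have hs : Summable fun k => g' k y := by
    rw [← summable_nat_add_iff 1]
    exact (summable_besselE (ν + 1) y).congr fun k => (hstep k y).symm
  rw [hs.tsum_eq_zero_add] at h
  simp only [hstep] at h
  change HasDerivAt (fun z => ∑' k : ℕ, z ^ k / ((k.factorial : ℂ) *
    Complex.Gamma ((ν : ℂ) + k + 1))) (∑' k : ℕ, y ^ k / ((k.factorial : ℂ) *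
    Complex.Gamma (((ν + 1 : ℝ) : ℂ) + k + 1))) y
  simpa [hg'] using h

/-- The source is `1/Γ(ν+k) = (ν+k)/Γ(ν+k+1)`, valid at the poles as well. The part with `ν`
reproduces the series, and the part with `k` shifts it. Together with the derivative this is
Bessel's equation. -/
lemma besselE_recurrence (ν : ℝ) (y : ℂ) :
    besselE (ν - 1) y = ν * besselE ν y + y * besselE (ν + 1) y := by
  have hs := summable_besselE (ν + 1) y
  have h0 := summable_besselE ν y
  have hk : ∀ k : ℕ, y ^ k / ((k.factorial : ℂ) * Complex.Gamma (((ν - 1 : ℝ) : ℂ) + k + 1)) =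
      ν * (y ^ k / ((k.factorial : ℂ) * Complex.Gamma ((ν : ℂ) + k + 1))) +
      k * (y ^ k / ((k.factorial : ℂ) * Complex.Gamma ((ν : ℂ) + k + 1))) := by
    intro k
    have := Complex.one_div_Gamma_eq_self_mul_one_div_Gamma_add_one ((ν : ℂ) + k)
    have e : (((ν - 1 : ℝ) : ℂ) + k + 1) = (ν : ℂ) + k := by push_cast; ring
    rw [e]
    simp only [div_mul_eq_div_div]
    simp only [div_eq_mul_inv _ (Complex.Gamma _), this]
    ring
  have hstep : ∀ k : ℕ, ((k + 1 : ℕ) : ℂ) * (y ^ (k + 1) / (((k + 1).factorial : ℂ) *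
      Complex.Gamma ((ν : ℂ) + (k + 1 : ℕ) + 1))) =
      y * (y ^ k / ((k.factorial : ℂ) * Complex.Gamma (((ν + 1 : ℝ) : ℂ) + k + 1))) := by
    intro k
    have h1 : (k : ℂ) + 1 ≠ 0 := by exact_mod_cast Nat.succ_ne_zero k
    have e : (((ν + 1 : ℝ) : ℂ) + k + 1) = (ν : ℂ) + (k + 1 : ℕ) + 1 := by push_cast; ring
    rw [e, Nat.factorial_succ]
    generalize Complex.Gamma ((ν : ℂ) + (k + 1 : ℕ) + 1) = G
    push_cast
    rw [← mul_div_assoc, mul_assoc, mul_div_mul_left _ _ h1, pow_succ]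
    ring
  have hs' : Summable fun k : ℕ =>
      (k : ℂ) * (y ^ k / ((k.factorial : ℂ) * Complex.Gamma ((ν : ℂ) + k + 1))) := by
    rw [← summable_nat_add_iff 1]
    exact (hs.mul_left y).congr fun k => (hstep k).symm
  unfold besselE
  rw [tsum_congr hk, (h0.mul_left _).tsum_add hs', tsum_mul_left, hs'.tsum_eq_zero_add,
    tsum_congr hstep, tsum_mul_left]
  simp

lemma besselE_zero (ν : ℝ) : besselE ν 0 = (Complex.Gamma ((ν : ℂ) + 1))⁻¹ := by
  unfold besselE
  rw [tsum_eq_single 0 (fun k hk => by simp [hk])]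
  simp

lemma continuous_besselE (ν : ℝ) : Continuous (besselE ν) :=
  continuous_iff_continuousAt.2 fun y => (hasDerivAt_besselE ν y).continuousAt

/-! ### The Laplace integral: bounds, derivative, contiguous relations. -/

open MeasureTheory in
/-- The Laplace integral `∫₀^∞ e^{-s} s^α (2z+s)^β ds`. -/
noncomputable def laplaceU (α β : ℝ) (z : ℂ) : ℂ :=
  ∫ s in Set.Ioi (0 : ℝ), ((Real.exp (-s) * s ^ α : ℝ) : ℂ) * (2 * z + s) ^ (β : ℂ)

lemma two_mul_add_mem_slitPlane {z : ℂ} (hz : z ∈ Complex.slitPlane) {s : ℝ} (hs : 0 ≤ s) :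
    2 * z + s ∈ Complex.slitPlane := by
  rw [Complex.mem_slitPlane_iff] at hz ⊢
  rcases hz with h | h
  · left; simp; linarith
  · right; simpa using h

/-- A lower bound, up to a factor two, for the distance from `z` to the negative real axis. -/
def slitDist (z : ℂ) : ℝ := max |z.im| z.re

lemma slitDist_pos {z : ℂ} (hz : z ∈ Complex.slitPlane) : 0 < slitDist z := by
  rw [Complex.mem_slitPlane_iff] at hz
  rcases hz with h | h
  · exact lt_max_of_lt_right h
  · exact lt_max_of_lt_left (abs_pos.2 h)

lemma mem_slitPlane_of_slitDist_pos {z : ℂ} (hz : 0 < slitDist z) : z ∈ Complex.slitPlane := by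
  rw [Complex.mem_slitPlane_iff]
  rcases lt_max_iff.1 hz with h | h
  · exact Or.inr (abs_pos.1 h)
  · exact Or.inl h

lemma continuous_slitDist : Continuous slitDist :=
  (Complex.continuous_im.abs).max Complex.continuous_re

lemma two_mul_slitDist_le (z : ℂ) {s : ℝ} (hs : 0 ≤ s) : 2 * slitDist z ≤ ‖2 * z + s‖ := by
  rw [slitDist, mul_max_of_nonneg _ _ (by norm_num : (0 : ℝ) ≤ 2)]
  refine max_le ?_ ?_
  · refine le_trans ?_ (Complex.abs_im_le_norm _)
    simp [abs_mul]
  · refine le_trans ?_ (Complex.re_le_norm _)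
    simpa using hs

lemma norm_cpow_le_of_le_of_nonpos {w : ℂ} {c β : ℝ} (hc : 0 < c) (hw : c ≤ ‖w‖) (hβ : β ≤ 0) :
    ‖w ^ (β : ℂ)‖ ≤ c ^ β := by
  rw [Complex.norm_cpow_real]
  exact Real.rpow_le_rpow_of_nonpos hc hw hβ

lemma integrableOn_exp_neg_mul_rpow {α : ℝ} (hα : -1 < α) :
    MeasureTheory.IntegrableOn (fun s : ℝ => Real.exp (-s) * s ^ α) (Set.Ioi 0) := by
  simpa using Real.GammaIntegral_convergent (s := α + 1) (by linarith)

lemma integral_exp_neg_mul_rpow_eq_Gamma (α : ℝ) (hα : -1 < α) :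
    ∫ s in Set.Ioi (0 : ℝ), Real.exp (-s) * s ^ α = Real.Gamma (α + 1) := by
  rw [Real.Gamma_eq_integral (by linarith)]; simp

lemma continuousOn_laplaceU_integrand (α β : ℝ) {z : ℂ} (hz : z ∈ Complex.slitPlane) :
    ContinuousOn (fun s : ℝ => ((Real.exp (-s) * s ^ α : ℝ) : ℂ) * (2 * z + s) ^ (β : ℂ))
      (Set.Ioi 0) := by
  intro s hs
  have hs' : (0 : ℝ) < s := hs
  refine ContinuousAt.continuousWithinAt ?_
  refine ContinuousAt.mul ?_ ?_
  · exact Complex.continuous_ofReal.continuousAt.comp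
      ((Real.continuous_exp.comp continuous_neg).continuousAt.mul
        (Real.continuousAt_rpow_const _ _ (Or.inl hs'.ne')))
  · exact ContinuousAt.cpow (by fun_prop) continuousAt_const (two_mul_add_mem_slitPlane hz hs'.le)

lemma aestronglyMeasurable_laplaceU (α β : ℝ) {z : ℂ} (hz : z ∈ Complex.slitPlane) :
    MeasureTheory.AEStronglyMeasurable
      (fun s : ℝ => ((Real.exp (-s) * s ^ α : ℝ) : ℂ) * (2 * z + s) ^ (β : ℂ))
      (MeasureTheory.volume.restrict (Set.Ioi 0)) :=
  (continuousOn_laplaceU_integrand α β hz).aestronglyMeasurable measurableSet_Ioi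

lemma norm_laplaceU_integrand_le {α β c s : ℝ} {z : ℂ} (hs : 0 < s) (hc : 0 < c) (hβ : β ≤ 0)
    (h : c ≤ ‖2 * z + s‖) :
    ‖((Real.exp (-s) * s ^ α : ℝ) : ℂ) * (2 * z + s) ^ (β : ℂ)‖ ≤
      Real.exp (-s) * s ^ α * c ^ β := by
  rw [norm_mul, Complex.norm_real, Real.norm_of_nonneg (by positivity)]
  gcongr
  exact norm_cpow_le_of_le_of_nonpos hc h hβ

lemma integrableOn_laplaceU {α β : ℝ} (hα : -1 < α) (hβ : β ≤ 0) {z : ℂ}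
    (hz : z ∈ Complex.slitPlane) :
    MeasureTheory.IntegrableOn
      (fun s : ℝ => ((Real.exp (-s) * s ^ α : ℝ) : ℂ) * (2 * z + s) ^ (β : ℂ)) (Set.Ioi 0) := by
  refine MeasureTheory.Integrable.mono'
    ((integrableOn_exp_neg_mul_rpow hα).mul_const ((2 * slitDist z) ^ β))
    (aestronglyMeasurable_laplaceU α β hz) ?_
  filter_upwards [MeasureTheory.ae_restrict_mem measurableSet_Ioi] with s hs
  exact norm_laplaceU_integrand_le hs (mul_pos two_pos (slitDist_pos hz)) hβ
    (two_mul_slitDist_le z (le_of_lt hs))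

/-- A bound for the Laplace integral from a lower bound for `|2z+s|`. -/
lemma norm_laplaceU_le {α β c : ℝ} (hα : -1 < α) (hβ : β ≤ 0) (hc : 0 < c) {z : ℂ}
    (h : ∀ s : ℝ, 0 < s → c ≤ ‖2 * z + s‖) :
    ‖laplaceU α β z‖ ≤ Real.Gamma (α + 1) * c ^ β := by
  rw [← integral_exp_neg_mul_rpow_eq_Gamma α hα, ← MeasureTheory.integral_mul_const]
  refine MeasureTheory.norm_integral_le_of_norm_le
    ((integrableOn_exp_neg_mul_rpow hα).mul_const _) ?_
  filter_upwards [MeasureTheory.ae_restrict_mem measurableSet_Ioi] with s hs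
  exact norm_laplaceU_integrand_le hs hc hβ (h s hs)

lemma hasDerivAt_laplaceU {α β : ℝ} (hα : -1 < α) (hβ : β ≤ 0) {z : ℂ}
    (hz : z ∈ Complex.slitPlane) :
    HasDerivAt (laplaceU α β) (2 * β * laplaceU α (β - 1) z) z := by
  have hd := slitDist_pos hz
  set c := slitDist z with hc
  -- On this neighbourhood `|2w + s| ≥ c` for all `s > 0`, so the derivative of the integrand has a
  -- majorant independent of `w`.
  set t : Set ℂ := {w | c / 2 < slitDist w} with ht
  have hto : IsOpen t := isOpen_lt continuous_const continuous_slitDist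
  have hzt : z ∈ t := half_lt_self hd
  have hslit : ∀ w ∈ t, w ∈ Complex.slitPlane := fun w hw =>
    mem_slitPlane_of_slitDist_pos (lt_trans (by linarith) hw)
  have key := hasDerivAt_integral_of_dominated_loc_of_deriv_le
    (μ := MeasureTheory.volume.restrict (Set.Ioi (0 : ℝ)))
    (F := fun (w : ℂ) (s : ℝ) => ((Real.exp (-s) * s ^ α : ℝ) : ℂ) * (2 * w + s) ^ (β : ℂ))
    (F' := fun (w : ℂ) (s : ℝ) => 2 * β *
      (((Real.exp (-s) * s ^ α : ℝ) : ℂ) * (2 * w + s) ^ ((β - 1 : ℝ) : ℂ)))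
    (x₀ := z) (s := t)
    (bound := fun s => ‖(2 * β : ℂ)‖ * (Real.exp (-s) * s ^ α * c ^ (β - 1)))
    (hto.mem_nhds hzt)
    (by
      filter_upwards [hto.mem_nhds hzt] with w hw
      exact aestronglyMeasurable_laplaceU α β (hslit w hw))
    (integrableOn_laplaceU hα hβ hz)
    ((aestronglyMeasurable_laplaceU α (β - 1) hz).const_mul _)
    (by
      filter_upwards [MeasureTheory.ae_restrict_mem measurableSet_Ioi] with s hs w hw
      rw [norm_mul]
      refine mul_le_mul_of_nonneg_left ?_ (norm_nonneg _)
      refine norm_laplaceU_integrand_le hs hd (by linarith) ?_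
      have h1 := two_mul_slitDist_le w (le_of_lt hs)
      have h2 : c / 2 < slitDist w := hw
      linarith)
    (((integrableOn_exp_neg_mul_rpow hα).mul_const _).const_mul _)
    (by
      filter_upwards [MeasureTheory.ae_restrict_mem measurableSet_Ioi] with s hs w hw
      have h1 := two_mul_add_mem_slitPlane (hslit w hw) (le_of_lt hs)
      have h2 : HasDerivAt (fun w : ℂ => 2 * w + s) 2 w := by
        simpa using ((hasDerivAt_id w).const_mul 2).add_const (s : ℂ)
      have h3 := ((h2.cpow_const (c := (β : ℂ)) h1).const_mul
        ((Real.exp (-s) * s ^ α : ℝ) : ℂ))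
      refine h3.congr_deriv ?_
      push_cast
      ring)
  have := key.2
  rw [MeasureTheory.integral_const_mul] at this
  exact this

/-- Write the extra factor `s` as `(2z + s) - 2z`. -/
lemma laplaceU_succ {α β : ℝ} (hα : -1 < α) (hβ : β ≤ -1) {z : ℂ}
    (hz : z ∈ Complex.slitPlane) :
    laplaceU (α + 1) β z = laplaceU α (β + 1) z - 2 * z * laplaceU α β z := by
  unfold laplaceU
  rw [← MeasureTheory.integral_const_mul, ← MeasureTheory.integral_sub
    (integrableOn_laplaceU hα (by linarith) hz)
    ((integrableOn_laplaceU hα (by linarith) hz).const_mul _)]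
  refine MeasureTheory.setIntegral_congr_fun measurableSet_Ioi fun s hs => ?_
  have hs' : (0 : ℝ) < s := hs
  have h1 : 2 * z + s ≠ 0 := Complex.slitPlane_ne_zero (two_mul_add_mem_slitPlane hz hs'.le)
  rw [Real.rpow_add_one hs'.ne']
  push_cast
  rw [Complex.cpow_add _ _ h1, Complex.cpow_one]
  ring

/-- Integrate the derivative of `e^{-s} s^{α+1} (2z+s)^β`. It vanishes at `0` because `α + 1 > 0`,
and at infinity by the exponential. -/
lemma laplaceU_byParts {α β : ℝ} (hα : -1 < α) (hβ : β ≤ 0) {z : ℂ}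
    (hz : z ∈ Complex.slitPlane) :
    laplaceU (α + 1) β z =
      (α + 1) * laplaceU α β z + β * laplaceU (α + 1) (β - 1) z := by
  set G : ℝ → ℂ := fun s => ((Real.exp (-s) * s ^ (α + 1) : ℝ) : ℂ) * (2 * z + s) ^ (β : ℂ)
  set G' : ℝ → ℂ := fun s =>
    (((α + 1 : ℂ) * (((Real.exp (-s) * s ^ α : ℝ) : ℂ) * (2 * z + s) ^ (β : ℂ)) +
    β * (((Real.exp (-s) * s ^ (α + 1) : ℝ) : ℂ) * (2 * z + s) ^ ((β - 1 : ℝ) : ℂ)))) -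
    ((Real.exp (-s) * s ^ (α + 1) : ℝ) : ℂ) * (2 * z + s) ^ (β : ℂ)
  have i1 := integrableOn_laplaceU hα hβ hz
  have i2 := integrableOn_laplaceU (α := α + 1) (β := β - 1) (by linarith) (by linarith) hz
  have i3 := integrableOn_laplaceU (α := α + 1) (β := β) (by linarith) (by linarith) hz
  have hcont : ContinuousWithinAt G (Set.Ici 0) 0 := by
    refine ContinuousAt.continuousWithinAt ?_
    refine ContinuousAt.mul ?_ ?_
    · exact Complex.continuous_ofReal.continuousAt.comp
        ((Real.continuous_exp.comp continuous_neg).continuousAt.mul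
          (Real.continuousAt_rpow_const _ _ (Or.inr (by linarith))))
    · exact ContinuousAt.cpow (by fun_prop) continuousAt_const (two_mul_add_mem_slitPlane hz le_rfl)
  have hder : ∀ s ∈ Set.Ioi (0 : ℝ), HasDerivAt G (G' s) s := by
    intro s hs
    have hs' : (0 : ℝ) < s := hs
    have h1 := two_mul_add_mem_slitPlane hz hs'.le
    have h2 : HasDerivAt (fun s : ℝ => 2 * z + (s : ℂ)) 1 s := by
      simpa using (Complex.ofRealCLM.hasDerivAt (x := s)).const_add (2 * z)
    have h3 : HasDerivAt (fun s : ℝ => (2 * z + (s : ℂ)) ^ (β : ℂ))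
        (β * (2 * z + s) ^ ((β : ℂ) - 1)) s := by
      have := HasDerivAt.comp_of_eq (h₂ := fun w : ℂ => w ^ (β : ℂ)) s
        ((hasDerivAt_id (2 * z + (s : ℂ))).cpow_const (c := (β : ℂ)) h1) h2 rfl
      simpa [Function.comp_def] using this
    have h4 : HasDerivAt (fun s : ℝ => Real.exp (-s) * s ^ (α + 1))
        (-Real.exp (-s) * s ^ (α + 1) + Real.exp (-s) * ((α + 1) * s ^ α)) s := by
      have e1 : HasDerivAt (fun s : ℝ => Real.exp (-s)) (-Real.exp (-s)) s := by
        simpa using (hasDerivAt_neg s).exp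
      have e2 := Real.hasDerivAt_rpow_const (x := s) (p := α + 1) (Or.inl hs'.ne')
      refine (e1.mul e2).congr_deriv ?_
      simp
    have h5 := h4.ofReal_comp.mul h3
    refine h5.congr_deriv ?_
    simp only [G']
    push_cast
    ring
  have hint : MeasureTheory.IntegrableOn G' (Set.Ioi 0) :=
    ((i1.const_mul (α + 1 : ℂ)).add (i2.const_mul (β : ℂ))).sub i3
  have hlim : Tendsto G atTop (𝓝 0) := by
    rw [tendsto_zero_iff_norm_tendsto_zero]
    have hb : Tendsto (fun s : ℝ => Real.exp (-s) * s ^ (α + 1) * (2 * slitDist z) ^ β) atTop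
        (𝓝 0) := by
      have := (tendsto_rpow_mul_exp_neg_mul_atTop_nhds_zero (α + 1) 1 one_pos).mul_const
        ((2 * slitDist z) ^ β)
      simpa [mul_comm] using this
    refine squeeze_zero' (Eventually.of_forall fun s => norm_nonneg _) ?_ hb
    filter_upwards [eventually_gt_atTop 0] with s hs
    exact norm_laplaceU_integrand_le hs (mul_pos two_pos (slitDist_pos hz)) hβ
      (two_mul_slitDist_le z hs.le)
  have h := MeasureTheory.integral_Ioi_of_hasDerivAt_of_tendsto hcont hder hint hlim
  have hG0 : G 0 = 0 := by
    simp only [G]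
    rw [Real.zero_rpow (by linarith)]
    simp
  rw [hG0, sub_zero] at h
  simp only [G'] at h
  have i12 := (i1.const_mul (α + 1 : ℂ)).add (i2.const_mul (β : ℂ))
  simp only [Pi.add_def] at i12
  rw [MeasureTheory.integral_sub i12 i3, MeasureTheory.integral_add (i1.const_mul (α + 1 : ℂ)) (i2.const_mul (β : ℂ)),
    MeasureTheory.integral_const_mul, MeasureTheory.integral_const_mul] at h
  unfold laplaceU
  linear_combination -h

/-! ### Powers of products, and Bessel's equation as a first-order system. -/

lemma Complex.mul_cpow_of_arg_add_mem {x y : ℂ} (hx : x ≠ 0) (hy : y ≠ 0)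
    (h : x.arg + y.arg ∈ Set.Ioc (-Real.pi) Real.pi) (c : ℂ) : (x * y) ^ c = x ^ c * y ^ c := by
  rw [Complex.cpow_def_of_ne_zero (mul_ne_zero hx hy), Complex.cpow_def_of_ne_zero hx,
    Complex.cpow_def_of_ne_zero hy, Complex.log_mul hx hy h, add_mul, Complex.exp_add]

lemma Complex.ofReal_mul_cpow {r : ℝ} (hr : 0 < r) {y : ℂ} (hy : y ≠ 0) (c : ℂ) :
    ((r : ℂ) * y) ^ c = (r : ℂ) ^ c * y ^ c := by
  refine Complex.mul_cpow_of_arg_add_mem (by exact_mod_cast hr.ne') hy ?_ c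
  rw [Complex.arg_ofReal_of_nonneg hr.le, zero_add]
  exact ⟨Complex.neg_pi_lt_arg y, Complex.arg_le_pi y⟩

/-- The pair `(u, w)` solves `u' = z^{-p} w`, `w' = z^p u` on the slit plane, that is,
`(z^p u')' = z^p u`. -/
def IsBesselPair (p : ℂ) (u w : ℂ → ℂ) : Prop :=
  ∀ z ∈ Complex.slitPlane, HasDerivAt u (z ^ (-p) * w z) z ∧ HasDerivAt w (z ^ p * u z) z

lemma ofReal_mem_slitPlane_of_pos {x : ℝ} (hx : 0 < x) : (x : ℂ) ∈ Complex.slitPlane := by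
  simpa using hx

/-- The Wronskian of two solutions is constant, so it equals its limit at zero. -/
lemma IsBesselPair.wronskian_eq {p : ℂ} {u w u' w' : ℂ → ℂ} (h : IsBesselPair p u w)
    (h' : IsBesselPair p u' w') {L : ℂ}
    (hL : Tendsto (fun x : ℝ => u x * w' x - u' x * w x) (𝓝[>] 0) (𝓝 L)) {z : ℂ}
    (hz : z ∈ Complex.slitPlane) : u z * w' z - u' z * w z = L := by
  have hd : ∀ z ∈ Complex.slitPlane, HasDerivAt (fun z => u z * w' z - u' z * w z) 0 z := by
    intro z hz
    refine (((h z hz).1.mul (h' z hz).2).sub ((h' z hz).1.mul (h z hz).2)).congr_deriv ?_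
    ring
  obtain ⟨C, hC⟩ := IsOpen.exists_is_const_of_deriv_eq_zero (𝕜 := ℂ) Complex.isOpen_slitPlane
    (Complex.starConvex_one_slitPlane.isPathConnected Complex.one_mem_slitPlane).isConnected.isPreconnected
    (fun z hz => (hd z hz).differentiableAt.differentiableWithinAt)
    (fun z hz => (hd z hz).deriv)
  have h1 : Tendsto (fun x : ℝ => u x * w' x - u' x * w x) (𝓝[>] 0) (𝓝 C) := by
    refine tendsto_const_nhds.congr' ?_
    filter_upwards [self_mem_nhdsWithin] with x hx
    exact (hC x (ofReal_mem_slitPlane_of_pos hx)).symm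
  rw [hC z hz]
  exact tendsto_nhds_unique h1 hL

lemma hasDerivAt_besselE_sq (ν : ℝ) (z : ℂ) :
    HasDerivAt (fun z => besselE ν (z ^ 2 / 4)) (z / 2 * besselE (ν + 1) (z ^ 2 / 4)) z := by
  have h1 : HasDerivAt (fun z : ℂ => z ^ 2 / 4) (z / 2) z := by
    refine ((hasDerivAt_pow 2 z).div_const 4).congr_deriv ?_
    push_cast; ring
  refine ((hasDerivAt_besselE ν (z ^ 2 / 4)).comp z h1).congr_deriv ?_
  ring

/-- Up to the constant `2^ν` this `u` is `z^{-ν} I_ν(z)`, and removing `z^ν` from Bessel's equation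
leaves `(z^{2ν+1} u')' = z^{2ν+1} u`. The second equation of the system is the recurrence at `ν +
1`. -/
lemma isBesselPair_besselE (ν : ℝ) :
    IsBesselPair (2 * ν + 1) (fun z => besselE ν (z ^ 2 / 4))
      (fun z => z ^ (2 * ν + 1 : ℂ) * (z / 2 * besselE (ν + 1) (z ^ 2 / 4))) := by
  intro z hz
  have hz0 := Complex.slitPlane_ne_zero hz
  constructor
  · refine (hasDerivAt_besselE_sq ν z).congr_deriv ?_
    rw [← mul_assoc (z ^ (-(2 * ν + 1 : ℂ))), ← Complex.cpow_add _ _ hz0, neg_add_cancel,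
      Complex.cpow_zero, one_mul]
  · have h1 := (((hasDerivAt_id z).div_const 2).mul (hasDerivAt_besselE_sq (ν + 1) z))
    have h2 := (hasDerivAt_id z).cpow_const (c := (2 * ν + 1 : ℂ)) hz
    refine (h2.mul h1).congr_deriv ?_
    have hr := besselE_recurrence (ν + 1) (z ^ 2 / 4)
    rw [add_sub_cancel_right] at hr
    simp only [id, Pi.mul_apply]
    rw [hr, Complex.cpow_add _ _ hz0, Complex.cpow_one, add_sub_cancel_right]
    push_cast
    ring

/-- The second solution is `z^{-ν} I_{-ν}(z)` up to a constant. The recurrence at `-ν` puts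
`z^{2ν+1} u'` in a form free of powers of `z`, which is what makes its limit at `0` visible. -/
lemma isBesselPair_besselE_neg (ν : ℝ) :
    IsBesselPair (2 * ν + 1) (fun z => z ^ (-2 * ν : ℂ) * besselE (-ν) (z ^ 2 / 4))
      (fun z => 2 * besselE (-ν - 1) (z ^ 2 / 4)) := by
  intro z hz
  have hz0 := Complex.slitPlane_ne_zero hz
  constructor
  · have h2 := (hasDerivAt_id z).cpow_const (c := (-2 * ν : ℂ)) hz
    refine (h2.mul (hasDerivAt_besselE_sq (-ν) z)).congr_deriv ?_
    simp only [besselE_recurrence (-ν) (z ^ 2 / 4)]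
    have e : z ^ (-2 * ν : ℂ) = z ^ (-(2 * ν + 1) : ℂ) * z := by
      rw [show (-2 * ν : ℂ) = -(2 * ν + 1) + 1 by ring, Complex.cpow_add _ _ hz0]
      simp
    simp only [id]
    rw [e, show (-2 * ν - 1 : ℂ) = -(2 * ν + 1) by ring]
    push_cast
    ring
  · refine ((hasDerivAt_besselE_sq (-ν - 1) z).const_mul 2).congr_deriv ?_
    rw [← mul_assoc (z ^ (2 * ν + 1 : ℂ)), ← Complex.cpow_add _ _ hz0]
    rw [show (2 * ν + 1 + -2 * ν : ℂ) = 1 by ring, Complex.cpow_one, sub_add_cancel]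
    ring

/-! ### The Laplace integral as a third solution. -/

/-- `z^{2μ-1} e^{-z} ∫₀^∞ e^{-s} s^{-μ} (2z+s)^{-μ} ds`, a multiple of `z^{μ-1/2} K_{1/2-μ}(z)`. -/
noncomputable def macdonaldU (μ : ℝ) (z : ℂ) : ℂ :=
  z ^ (2 * μ - 1 : ℂ) * Complex.exp (-z) * laplaceU (-μ) (-μ) z

lemma laplaceU_one_sub {μ : ℝ} (h0 : 0 ≤ μ) (h1 : μ < 1) {z : ℂ} (hz : z ∈ Complex.slitPlane) :
    laplaceU (-μ + 1) (-μ) z =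
      (1 - 2 * μ) * laplaceU (-μ) (-μ) z + 2 * μ * z * laplaceU (-μ) (-μ - 1) z := by
  have e1 := laplaceU_byParts (α := -μ) (β := -μ) (by linarith) (by linarith) hz
  have e2 := laplaceU_succ (α := -μ) (β := -μ - 1) (by linarith) (by linarith) hz
  rw [sub_add_cancel] at e2
  rw [e1, e2]
  push_cast
  ring

/-- Every integral that occurs reduces, by `laplaceU_succ` and `laplaceU_one_sub`, to those with
exponents `(-μ, -μ)` and `(-μ, -μ-1)`. The system is then an algebraic identity. -/
lemma isBesselPair_macdonaldU {μ : ℝ} (h0 : 0 ≤ μ) (h1 : μ < 1) :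
    IsBesselPair (2 * (1 / 2 - μ : ℝ) + 1) (macdonaldU μ)
      (fun z => -Complex.exp (-z) * (z * laplaceU (-μ) (-μ) z + laplaceU (-μ + 1) (-μ) z)) := by
  intro z hz
  have hz0 := Complex.slitPlane_ne_zero hz
  have hJ := hasDerivAt_laplaceU (α := -μ) (β := -μ) (by linarith) (by linarith) hz
  have hR := hasDerivAt_laplaceU (α := -μ + 1) (β := -μ) (by linarith) (by linarith) hz
  have he : HasDerivAt (fun z : ℂ => Complex.exp (-z)) (-Complex.exp (-z)) z := by
    simpa using (hasDerivAt_neg z).cexp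
  have e2 := laplaceU_succ (α := -μ) (β := -μ - 1) (by linarith) (by linarith) hz
  rw [sub_add_cancel] at e2
  have e3 := laplaceU_one_sub h0 h1 hz
  have ez : z ^ (2 * μ - 1 : ℂ) = z ^ (-(2 * ((1 / 2 - μ : ℝ) : ℂ) + 1)) * z := by
    rw [show (2 * μ - 1 : ℂ) = -(2 * ((1 / 2 - μ : ℝ) : ℂ) + 1) + 1 by push_cast; ring,
      Complex.cpow_add _ _ hz0, Complex.cpow_one]
  constructor
  · have h2 := (hasDerivAt_id z).cpow_const (c := (2 * μ - 1 : ℂ)) hz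
    refine ((h2.mul he).mul hJ).congr_deriv ?_
    simp only [id, Pi.mul_apply]
    rw [show (2 * μ - 1 - 1 : ℂ) = -(2 * ((1 / 2 - μ : ℝ) : ℂ) + 1) by push_cast; ring, ez, e3]
    push_cast
    ring
  · refine (he.neg.mul (((hasDerivAt_id z).mul hJ).add hR)).congr_deriv ?_
    unfold macdonaldU
    simp only [id, Pi.mul_apply, Pi.add_apply, Pi.neg_apply]
    rw [ez, Complex.cpow_neg]
    have hzp : z ^ (2 * ((1 / 2 - μ : ℝ) : ℂ) + 1) ≠ 0 := by simp [hz0]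
    generalize z ^ (2 * ((1 / 2 - μ : ℝ) : ℂ) + 1) = A at hzp
    rw [e2, e3]
    field_simp
    push_cast
    ring

/-! ### Limits of the solutions at the origin. -/

lemma tendsto_ofReal_cpow_nhdsGT_zero {r : ℝ} (hr : 0 < r) :
    Tendsto (fun x : ℝ => (x : ℂ) ^ (r : ℂ)) (𝓝[>] 0) (𝓝 0) := by
  rw [tendsto_zero_iff_norm_tendsto_zero]
  have h : Tendsto (fun x : ℝ => x ^ r) (𝓝[>] 0) (𝓝 0) := by
    have := (Real.continuousAt_rpow_const 0 r (Or.inr hr.le)).tendsto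
    rw [Real.zero_rpow hr.ne'] at this
    exact this.mono_left nhdsWithin_le_nhds
  refine h.congr' ?_
  filter_upwards [self_mem_nhdsWithin] with x hx
  rw [Complex.norm_cpow_real, Complex.norm_real, Real.norm_of_nonneg (le_of_lt hx)]

lemma norm_laplaceU_ofReal_le {μ : ℝ} (h0 : 0 ≤ μ) (h1 : μ < 1) {x : ℝ} (hx : 0 < x) :
    ‖laplaceU (-μ) (-μ) x‖ ≤ Real.Gamma (1 - μ) * x ^ (-μ) := by
  rw [show 1 - μ = -μ + 1 by ring]
  refine norm_laplaceU_le (by linarith) (by linarith) hx fun s hs => ?_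
  have : (2 * (x : ℂ) + s) = ((2 * x + s : ℝ) : ℂ) := by push_cast; ring
  rw [this, Complex.norm_real]
  exact le_trans (by linarith) (le_abs_self _)

lemma tendsto_cpow_mul_laplaceU {μ r : ℝ} (h0 : 0 ≤ μ) (h1 : μ < 1) (hr : μ < r) :
    Tendsto (fun x : ℝ => (x : ℂ) ^ (r : ℂ) * laplaceU (-μ) (-μ) x) (𝓝[>] 0) (𝓝 0) := by
  have h := (tendsto_ofReal_cpow_nhdsGT_zero (sub_pos.2 hr)).norm.const_mul (Real.Gamma (1 - μ))
  rw [norm_zero, mul_zero] at h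
  refine squeeze_zero_norm' ?_ h
  filter_upwards [self_mem_nhdsWithin] with x hx
  have hx' : (0 : ℝ) < x := hx
  rw [norm_mul, Complex.norm_cpow_real, Complex.norm_cpow_real, Complex.norm_real,
    Real.norm_of_nonneg hx'.le, Real.rpow_sub hx']
  calc x ^ r * ‖laplaceU (-μ) (-μ) x‖ ≤ x ^ r * (Real.Gamma (1 - μ) * x ^ (-μ)) := by
        gcongr; exact norm_laplaceU_ofReal_le h0 h1 hx'
    _ = _ := by rw [Real.rpow_neg hx'.le]; ring

/-- The integrand tends to `e^{-s} s^{1-2μ}` and is dominated by it, since `2x + s ≥ s` and the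
exponent `-μ` is nonpositive. -/
lemma tendsto_laplaceU_one_sub {μ : ℝ} (h0 : 0 ≤ μ) (h1 : μ < 1) :
    Tendsto (fun x : ℝ => laplaceU (-μ + 1) (-μ) x) (𝓝[>] 0) (𝓝 (Real.Gamma (2 - 2 * μ))) := by
  have hG : ((Real.Gamma (2 - 2 * μ) : ℝ) : ℂ) = ∫ s in Set.Ioi (0 : ℝ),
      ((Real.exp (-s) * s ^ (1 - 2 * μ) : ℝ) : ℂ) := by
    rw [show 2 - 2 * μ = (1 - 2 * μ) + 1 by ring, integral_complex_ofReal,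
      integral_exp_neg_mul_rpow_eq_Gamma _ (by linarith)]
  rw [hG]
  refine MeasureTheory.tendsto_integral_filter_of_dominated_convergence
    (fun s => Real.exp (-s) * s ^ (1 - 2 * μ)) ?_ ?_ (integrableOn_exp_neg_mul_rpow (by linarith)) ?_
  · filter_upwards [self_mem_nhdsWithin] with x hx
    exact aestronglyMeasurable_laplaceU _ _ (ofReal_mem_slitPlane_of_pos hx)
  · filter_upwards [self_mem_nhdsWithin] with x hx
    filter_upwards [MeasureTheory.ae_restrict_mem measurableSet_Ioi] with s hs
    have hs' : (0 : ℝ) < s := hs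
    have hx' : (0 : ℝ) < x := hx
    refine (norm_laplaceU_integrand_le (c := s) hs hs (by linarith) ?_).trans_eq ?_
    · have : (2 * (x : ℂ) + s) = ((2 * x + s : ℝ) : ℂ) := by push_cast; ring
      rw [this, Complex.norm_real]
      exact le_trans (by linarith) (le_abs_self _)
    · rw [mul_assoc, ← Real.rpow_add hs']; congr 2; ring
  · filter_upwards [MeasureTheory.ae_restrict_mem measurableSet_Ioi] with s hs
    have hs' : (0 : ℝ) < s := hs
    have hc : ContinuousAt (fun x : ℝ => ((Real.exp (-s) * s ^ (-μ + 1) : ℝ) : ℂ) *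
        (2 * (x : ℂ) + s) ^ ((-μ : ℝ) : ℂ)) 0 := by
      refine continuousAt_const.mul (ContinuousAt.cpow (by fun_prop) continuousAt_const ?_)
      simpa using hs'
    have := hc.tendsto.mono_left (nhdsWithin_le_nhds (s := Set.Ioi 0))
    convert this using 2
    simp only [Complex.ofReal_zero, mul_zero, zero_add]
    rw [← Complex.ofReal_cpow hs'.le, ← Complex.ofReal_mul, mul_assoc, ← Real.rpow_add hs']
    congr 3; ring

/-- Rewriting `x^{2μ} ∫₀^∞ e^{-s} s^{-μ} (2x+s)^{-μ-1} ds` by Fubini. -/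
lemma cpow_mul_laplaceU_eq {μ : ℝ} (h0 : 0 < μ) (h1 : μ < 1) {x : ℝ} (hx : 0 < x) :
    (x : ℂ) ^ ((2 * μ : ℝ) : ℂ) * laplaceU (-μ) (-μ - 1) x =
      ((Real.Gamma (1 - μ) / Real.Gamma (μ + 1) *
        ∫ y in Set.Ioi (0 : ℝ), y ^ μ * Real.exp (-(2 * y)) * (x + y) ^ (μ - 1) : ℝ) : ℂ) := by
  -- The factor `(2x+s)^{-μ-1}` is replaced by its Gamma integral over `r`. Integrating over `s`
  -- first leaves `(1+r)^{μ-1}`, and the substitution `y = xr` absorbs the factor `x^{2μ}`.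
  set f : ℝ → ℝ → ℝ := fun s r => Real.exp (-s) * s ^ (-μ) * (r ^ μ * Real.exp (-((2 * x + s) * r)))
  have hΓ : 0 < Real.Gamma (μ + 1) := Real.Gamma_pos_of_pos (by linarith)
  have hr : ∀ s : ℝ, 0 < s → ∫ r in Set.Ioi (0 : ℝ), f s r =
      Real.exp (-s) * s ^ (-μ) * ((2 * x + s) ^ (-μ - 1) * Real.Gamma (μ + 1)) := by
    intro s hs
    simp only [f]
    rw [MeasureTheory.integral_const_mul]
    have := Real.integral_rpow_mul_exp_neg_mul_Ioi (a := μ + 1) (r := 2 * x + s) (by linarith)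
      (by linarith)
    rw [add_sub_cancel_right] at this
    rw [this, one_div, Real.inv_rpow (by linarith), ← Real.rpow_neg (by linarith)]
    congr 3; ring
  have hs : ∀ r : ℝ, 0 < r → ∫ s in Set.Ioi (0 : ℝ), f s r =
      r ^ μ * Real.exp (-(2 * x * r)) * ((1 + r) ^ (μ - 1) * Real.Gamma (1 - μ)) := by
    intro r hr
    have e : ∀ s : ℝ, f s r = r ^ μ * Real.exp (-(2 * x * r)) *
        (s ^ (1 - μ - 1) * Real.exp (-((1 + r) * s))) := by
      intro s
      simp only [f]
      rw [show 1 - μ - 1 = -μ by ring, show -((2 * x + s) * r) = -(2 * x * r) + -(s * r) by ring,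
        show -((1 + r) * s) = -s + -(s * r) by ring, Real.exp_add, Real.exp_add]
      ring
    simp only [e]
    rw [MeasureTheory.integral_const_mul,
      Real.integral_rpow_mul_exp_neg_mul_Ioi (a := 1 - μ) (r := 1 + r) (by linarith) (by linarith),
      one_div, Real.inv_rpow (by linarith), ← Real.rpow_neg (by linarith), neg_sub]
  have hmeas : MeasureTheory.AEStronglyMeasurable (Function.uncurry f)
      ((MeasureTheory.volume.restrict (Set.Ioi 0)).prod
        (MeasureTheory.volume.restrict (Set.Ioi 0))) := by
    refine Measurable.aestronglyMeasurable ?_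
    simp only [f, Function.uncurry_def]
    fun_prop
  have hint : MeasureTheory.Integrable (Function.uncurry f)
      ((MeasureTheory.volume.restrict (Set.Ioi 0)).prod
        (MeasureTheory.volume.restrict (Set.Ioi 0))) := by
    rw [MeasureTheory.integrable_prod_iff hmeas]
    constructor
    · filter_upwards [MeasureTheory.ae_restrict_mem measurableSet_Ioi] with s hs'
      have hs0 : (0 : ℝ) < s := hs'
      -- The Bochner integral of a non-integrable function is `0` by convention, so the positive
      -- value just computed forces integrability.
      by_contra hcon
      have h2 := MeasureTheory.integral_undef hcon
      have h3 : (0 : ℝ) < Real.exp (-s) * s ^ (-μ) * ((2 * x + s) ^ (-μ - 1) *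
        Real.Gamma (μ + 1)) := by positivity
      rw [← hr s hs0] at h3
      exact h3.ne' h2
    · have hb : MeasureTheory.Integrable (fun s : ℝ => Real.exp (-s) * s ^ (-μ) *
          ((2 * x + s) ^ (-μ - 1) * Real.Gamma (μ + 1)))
          (MeasureTheory.volume.restrict (Set.Ioi 0)) := by
        refine MeasureTheory.Integrable.mono' ((integrableOn_exp_neg_mul_rpow
          (show -1 < -μ by linarith)).mul_const ((2 * x) ^ (-μ - 1) * Real.Gamma (μ + 1)))
          (Measurable.aestronglyMeasurable (by fun_prop)) ?_
        filter_upwards [MeasureTheory.ae_restrict_mem measurableSet_Ioi] with s hs'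
        have hs0 : (0 : ℝ) < s := hs'
        rw [Real.norm_of_nonneg (by positivity)]
        gcongr ?_ * (?_ * ?_)
        exact Real.rpow_le_rpow_of_nonpos (by linarith) (by linarith) (by linarith)
      refine hb.congr ?_
      filter_upwards [MeasureTheory.ae_restrict_mem measurableSet_Ioi] with s hs'
      rw [← hr s hs']
      refine MeasureTheory.setIntegral_congr_fun measurableSet_Ioi fun r hr' => ?_
      have h1 : (0 : ℝ) < s := hs'
      have h2 : (0 : ℝ) < r := hr'
      simp only [Function.uncurry_def, f]
      rw [Real.norm_of_nonneg (by positivity)]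
  have hswap := MeasureTheory.integral_integral_swap hint
  rw [MeasureTheory.setIntegral_congr_fun measurableSet_Ioi hr,
    MeasureTheory.setIntegral_congr_fun measurableSet_Ioi hs] at hswap
  have hsub := MeasureTheory.integral_comp_mul_left_Ioi
    (fun y : ℝ => y ^ μ * Real.exp (-(2 * y)) * (x + y) ^ (μ - 1)) 0 hx
  rw [mul_zero, smul_eq_mul] at hsub
  have hL : laplaceU (-μ) (-μ - 1) x =
      ((∫ s in Set.Ioi (0 : ℝ), Real.exp (-s) * s ^ (-μ) * (2 * x + s) ^ (-μ - 1) : ℝ) : ℂ) := by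
    rw [← integral_complex_ofReal]
    refine MeasureTheory.setIntegral_congr_fun measurableSet_Ioi fun s hs' => ?_
    have h1 : (0 : ℝ) < s := hs'
    rw [Complex.ofReal_mul (_ * _), Complex.ofReal_cpow (by positivity)]
    push_cast
    rfl
  rw [hL, ← Complex.ofReal_cpow hx.le, ← Complex.ofReal_mul]
  congr 1
  have hsub2 : ∫ r in Set.Ioi (0 : ℝ), (x * r) ^ μ * Real.exp (-(2 * (x * r))) *
      (x + x * r) ^ (μ - 1) = x ^ (2 * μ - 1) *
      ∫ r in Set.Ioi (0 : ℝ), r ^ μ * Real.exp (-(2 * x * r)) * (1 + r) ^ (μ - 1) := by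
    rw [← MeasureTheory.integral_const_mul]
    refine MeasureTheory.setIntegral_congr_fun measurableSet_Ioi fun r hr' => ?_
    have h2 : (0 : ℝ) < r := hr'
    rw [show x + x * r = x * (1 + r) by ring, Real.mul_rpow hx.le h2.le,
      Real.mul_rpow hx.le (by linarith), show 2 * μ - 1 = μ + (μ - 1) by ring,
      Real.rpow_add hx, show 2 * (x * r) = 2 * x * r by ring]
    ring
  rw [hsub2] at hsub
  simp only [← mul_assoc] at hswap
  rw [MeasureTheory.integral_mul_const, MeasureTheory.integral_mul_const] at hswap
  rw [Real.rpow_sub_one hx.ne'] at hsub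
  have hx2 : x ^ (2 * μ) *
      ∫ r in Set.Ioi (0 : ℝ), r ^ μ * Real.exp (-(2 * x * r)) * (1 + r) ^ (μ - 1) =
      ∫ y in Set.Ioi (0 : ℝ), y ^ μ * Real.exp (-(2 * y)) * (x + y) ^ (μ - 1) := by
    field_simp at hsub
    convert hsub using 1
  rw [← hx2, div_mul_eq_mul_div, eq_div_iff hΓ.ne', mul_assoc, hswap]
  ring

/-- As `x → 0` the original integrand approaches `e^{-s} s^{-2μ-1}`, which is not integrable at `0`.
In the form of `cpow_mul_laplaceU_eq` it is dominated by `y^{2μ-1} e^{-2y}`, which is integrable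
exactly because `μ > 0`. -/
lemma tendsto_cpow_mul_laplaceU_sub_one {μ : ℝ} (h0 : 0 < μ) (h1 : μ < 1) :
    Tendsto (fun x : ℝ => (x : ℂ) ^ ((2 * μ : ℝ) : ℂ) * laplaceU (-μ) (-μ - 1) x) (𝓝[>] 0)
      (𝓝 ((Real.Gamma (1 - μ) / Real.Gamma (μ + 1) *
        ((1 / 2) ^ (2 * μ) * Real.Gamma (2 * μ)) : ℝ) : ℂ)) := by
  have key : Tendsto (fun x : ℝ => ∫ y in Set.Ioi (0 : ℝ), y ^ μ * Real.exp (-(2 * y)) *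
      (x + y) ^ (μ - 1)) (𝓝[>] 0) (𝓝 ((1 / 2) ^ (2 * μ) * Real.Gamma (2 * μ))) := by
    rw [← Real.integral_rpow_mul_exp_neg_mul_Ioi (a := 2 * μ) (r := 2) (by linarith) two_pos]
    refine MeasureTheory.tendsto_integral_filter_of_dominated_convergence
      (fun y => y ^ (2 * μ - 1) * Real.exp (-(2 * y))) ?_ ?_ ?_ ?_
    · exact Eventually.of_forall fun x => Measurable.aestronglyMeasurable (by fun_prop)
    · filter_upwards [self_mem_nhdsWithin] with x hx
      filter_upwards [MeasureTheory.ae_restrict_mem measurableSet_Ioi] with y hy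
      have hx' : (0 : ℝ) < x := hx
      have hy' : (0 : ℝ) < y := hy
      rw [Real.norm_of_nonneg (by positivity), show 2 * μ - 1 = μ + (μ - 1) by ring,
        Real.rpow_add hy', mul_right_comm]
      gcongr ?_ * ?_ * ?_
      exact Real.rpow_le_rpow_of_nonpos hy' (by linarith) (by linarith)
    · by_contra hcon
      have h2 := MeasureTheory.integral_undef hcon
      have h3 : 0 < (1 / 2 : ℝ) ^ (2 * μ) * Real.Gamma (2 * μ) := by
        have := Real.Gamma_pos_of_pos (show 0 < 2 * μ by linarith)
        positivity
      rw [← Real.integral_rpow_mul_exp_neg_mul_Ioi (by linarith) two_pos] at h3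
      exact h3.ne' h2
    · filter_upwards [MeasureTheory.ae_restrict_mem measurableSet_Ioi] with y hy
      have hy' : (0 : ℝ) < y := hy
      have hc : ContinuousAt (fun x : ℝ => y ^ μ * Real.exp (-(2 * y)) * (x + y) ^ (μ - 1)) 0 :=
        continuousAt_const.mul (ContinuousAt.rpow_const (by fun_prop) (Or.inl (by simpa using hy'.ne')))
      have := hc.tendsto.mono_left (nhdsWithin_le_nhds (s := Set.Ioi 0))
      convert this using 2
      rw [zero_add, show 2 * μ - 1 = μ + (μ - 1) by ring, Real.rpow_add hy', mul_right_comm]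
  have := (key.const_mul (Real.Gamma (1 - μ) / Real.Gamma (μ + 1)))
  refine ((Complex.continuous_ofReal.tendsto _).comp this).congr' ?_
  filter_upwards [self_mem_nhdsWithin] with x hx
  exact (cpow_mul_laplaceU_eq h0 h1 hx).symm

lemma tendsto_besselE_sq (a : ℝ) :
    Tendsto (fun x : ℝ => besselE a ((x : ℂ) ^ 2 / 4)) (𝓝[>] 0)
      (𝓝 (Complex.Gamma ((a : ℂ) + 1))⁻¹) := by
  have h : Continuous fun x : ℝ => besselE a ((x : ℂ) ^ 2 / 4) :=
    (continuous_besselE a).comp (by fun_prop)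
  have := (h.tendsto 0).mono_left (nhdsWithin_le_nhds (s := Set.Ioi 0))
  simpa [besselE_zero] using this

lemma tendsto_ofReal_nhdsGT_zero : Tendsto (fun x : ℝ => (x : ℂ)) (𝓝[>] 0) (𝓝 0) :=
  (Complex.continuous_ofReal.tendsto' 0 0 Complex.ofReal_zero).mono_left nhdsWithin_le_nhds

lemma tendsto_exp_neg_nhdsGT_zero :
    Tendsto (fun x : ℝ => Complex.exp (-(x : ℂ))) (𝓝[>] 0) (𝓝 1) := by
  have : Continuous fun x : ℝ => Complex.exp (-(x : ℂ)) := by fun_prop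
  exact (this.tendsto' 0 1 (by simp)).mono_left nhdsWithin_le_nhds

/-! ### The three Wronskians. -/

lemma wronskian_besselE (ν : ℝ) {z : ℂ} (hz : z ∈ Complex.slitPlane) :
    besselE ν (z ^ 2 / 4) * (2 * besselE (-ν - 1) (z ^ 2 / 4)) -
      z ^ (-2 * ν : ℂ) * besselE (-ν) (z ^ 2 / 4) *
        (z ^ (2 * ν + 1 : ℂ) * (z / 2 * besselE (ν + 1) (z ^ 2 / 4))) =
      2 * (Complex.Gamma (ν + 1))⁻¹ * (Complex.Gamma (-ν))⁻¹ := by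
  refine (isBesselPair_besselE ν).wronskian_eq (isBesselPair_besselE_neg ν) ?_ hz
  have h1 := (tendsto_besselE_sq ν).mul ((tendsto_besselE_sq (-ν - 1)).const_mul 2)
  have h2 := ((((tendsto_ofReal_nhdsGT_zero.pow 2).const_mul (1 / 2)).mul
    (tendsto_besselE_sq (-ν))).mul (tendsto_besselE_sq (ν + 1)))
  have h3 := h1.sub h2
  refine (h3.congr' ?_).trans (le_of_eq ?_)
  · filter_upwards [self_mem_nhdsWithin] with x hx
    have hx0 : (x : ℂ) ≠ 0 := by exact_mod_cast (ne_of_gt hx)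
    have e : (x : ℂ) ^ (-2 * ν : ℂ) * (x : ℂ) ^ (2 * ν + 1 : ℂ) = x := by
      rw [← Complex.cpow_add _ _ hx0, show (-2 * ν + (2 * ν + 1) : ℂ) = 1 by ring,
        Complex.cpow_one]
    linear_combination (besselE (-ν) ((x : ℂ) ^ 2 / 4) * (x / 2) *
      besselE (ν + 1) ((x : ℂ) ^ 2 / 4)) * e
  · congr 1
    push_cast
    rw [sub_add_cancel]
    ring

/-- The integral with exponents `(-μ, -μ)` is `O(x^{-μ})`, so it disappears against `x` and `x²`.
Only the integral with the extra factor `s` survives. -/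
lemma wronskian_besselE_macdonaldU {μ : ℝ} (h0 : 0 ≤ μ) (h1 : μ < 1) {z : ℂ}
    (hz : z ∈ Complex.slitPlane) :
    besselE (1 / 2 - μ) (z ^ 2 / 4) *
        (-Complex.exp (-z) * (z * laplaceU (-μ) (-μ) z + laplaceU (-μ + 1) (-μ) z)) -
      macdonaldU μ z * (z ^ (2 * (1 / 2 - μ : ℝ) + 1 : ℂ) *
        (z / 2 * besselE (1 / 2 - μ + 1) (z ^ 2 / 4))) =
      -(Complex.Gamma ((1 / 2 - μ : ℝ) + 1))⁻¹ * Real.Gamma (2 - 2 * μ) := by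
  refine (isBesselPair_besselE (1 / 2 - μ)).wronskian_eq (isBesselPair_macdonaldU h0 h1) ?_ hz
  have hJ1 := tendsto_cpow_mul_laplaceU h0 h1 h1
  have hJ2 := tendsto_cpow_mul_laplaceU h0 h1 (show μ < 2 by linarith)
  have hR := tendsto_laplaceU_one_sub h0 h1
  have t1 := (tendsto_besselE_sq (1 / 2 - μ)).mul
    (tendsto_exp_neg_nhdsGT_zero.neg.mul (hJ1.add hR))
  have t2 := (tendsto_exp_neg_nhdsGT_zero.mul (hJ2.const_mul (1 / 2))).mul
    (tendsto_besselE_sq (1 / 2 - μ + 1))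
  refine ((t1.sub t2).congr' ?_).trans (le_of_eq ?_)
  · filter_upwards [self_mem_nhdsWithin] with x hx
    have hx0 : (x : ℂ) ≠ 0 := by exact_mod_cast (ne_of_gt hx)
    have e : (x : ℂ) ^ (2 * μ - 1 : ℂ) * (x : ℂ) ^ (2 * (1 / 2 - μ : ℝ) + 1 : ℂ) = x := by
      rw [← Complex.cpow_add _ _ hx0,
        show (2 * μ - 1 + (2 * (1 / 2 - μ : ℝ) + 1) : ℂ) = 1 by push_cast; ring, Complex.cpow_one]
    have e2 : (x : ℂ) ^ ((2 : ℝ) : ℂ) = x ^ 2 := by norm_num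
    rw [e2, Complex.ofReal_one, Complex.cpow_one]
    unfold macdonaldU
    linear_combination (Complex.exp (-x) * laplaceU (-μ) (-μ) x * (x / 2) *
      besselE (1 / 2 - μ + 1) ((x : ℂ) ^ 2 / 4)) * e
  · congr 1
    push_cast
    ring

/-- For `μ > 0` the first term tends to `0`, and Legendre duplication simplifies the limit of the
second. For `μ = 0` the roles are exchanged: the first term is identically `1` and the second is
absent. -/
lemma tendsto_macdonald_constant {μ : ℝ} (h0 : 0 ≤ μ) (h1 : μ < 1) :
    Tendsto (fun x : ℝ => (x : ℂ) ^ ((2 * μ : ℝ) : ℂ) * laplaceU (-μ) (-μ) x +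
      2 * μ * ((x : ℂ) ^ ((2 * μ : ℝ) : ℂ) * laplaceU (-μ) (-μ - 1) x)) (𝓝[>] 0)
      (𝓝 ((Real.Gamma (1 - μ) * Real.Gamma (μ + 1 / 2) / √Real.pi : ℝ) : ℂ)) := by
  rcases h0.eq_or_lt with h | h
  · subst h
    have e : ∀ x : ℝ, 0 < x → laplaceU (-0) (-0) x = 1 := by
      intro x hx
      unfold laplaceU
      have := integral_exp_neg_mul_rpow_eq_Gamma 0 (by norm_num)
      simp only [Real.rpow_zero, mul_one, zero_add, Real.Gamma_one] at this
      simp only [neg_zero, Complex.ofReal_zero, Complex.cpow_zero, mul_one, Real.rpow_zero]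
      rw [integral_complex_ofReal, this]
      simp
    refine tendsto_const_nhds.congr' ?_
    filter_upwards [self_mem_nhdsWithin] with x hx
    rw [e x hx]
    have hpi : √Real.pi ≠ 0 := by positivity
    simp only [sub_zero, Real.Gamma_one, zero_add, Real.Gamma_one_half_eq, one_mul]
    rw [div_self hpi]
    simp
  · have t1 := tendsto_cpow_mul_laplaceU h0 h1 (show μ < 2 * μ by linarith)
    have t2 := (tendsto_cpow_mul_laplaceU_sub_one h h1).const_mul (2 * μ : ℂ)
    refine (t1.add t2).trans (le_of_eq ?_)
    congr 1
    rw [zero_add]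
    norm_cast
    have d := Real.Gamma_mul_Gamma_add_half μ
    have hg := Real.Gamma_add_one h.ne'
    have p1 := Real.Gamma_pos_of_pos h
    have hpi : √Real.pi ≠ 0 := by positivity
    have hp : (2 : ℝ) ^ (1 - 2 * μ) = 2 * (1 / 2) ^ (2 * μ) := by
      rw [Real.rpow_sub two_pos, Real.rpow_one, one_div, Real.inv_rpow two_pos.le]
      rfl
    rw [hp] at d
    rw [hg]
    generalize Real.Gamma (μ + 1 / 2) = g at d ⊢
    field_simp
    linear_combination (-Real.Gamma (1 - μ)) * d

/-- Both products contain a term `(1-2μ) x^{2μ-1}` times the Laplace integral, which need not have a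
limit by itself. The recurrence for `besselE` and `laplaceU_one_sub` expose these terms and they
cancel, leaving the expression of `tendsto_macdonald_constant`. -/
lemma wronskian_besselE_neg_macdonaldU {μ : ℝ} (h0 : 0 ≤ μ) (h1 : μ < 1) {z : ℂ}
    (hz : z ∈ Complex.slitPlane) :
    z ^ (-2 * (1 / 2 - μ : ℝ) : ℂ) * besselE (-(1 / 2 - μ)) (z ^ 2 / 4) *
        (-Complex.exp (-z) * (z * laplaceU (-μ) (-μ) z + laplaceU (-μ + 1) (-μ) z)) -
      macdonaldU μ z * (2 * besselE (-(1 / 2 - μ) - 1) (z ^ 2 / 4)) =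
      -((Real.Gamma (1 - μ) / √Real.pi : ℝ) : ℂ) := by
  refine (isBesselPair_besselE_neg (1 / 2 - μ)).wronskian_eq (isBesselPair_macdonaldU h0 h1) ?_ hz
  have hJ := tendsto_cpow_mul_laplaceU h0 h1 (show μ < 2 * μ + 1 by linarith)
  have t1 := tendsto_exp_neg_nhdsGT_zero.neg.mul
    (((tendsto_besselE_sq (-(1 / 2 - μ))).mul (tendsto_macdonald_constant h0 h1)).add
    ((hJ.const_mul (1 / 2)).mul (tendsto_besselE_sq (-(1 / 2 - μ) + 1))))
  refine (t1.congr' ?_).trans (le_of_eq ?_)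
  · filter_upwards [self_mem_nhdsWithin] with x hx
    have hx0 : (x : ℂ) ≠ 0 := by exact_mod_cast (ne_of_gt hx)
    have e1 : (x : ℂ) ^ ((2 * μ : ℝ) : ℂ) = x ^ (2 * μ - 1 : ℂ) * x := by
      rw [show ((2 * μ : ℝ) : ℂ) = 2 * μ - 1 + 1 by push_cast; ring, Complex.cpow_add _ _ hx0,
        Complex.cpow_one]
    have e2 : (x : ℂ) ^ ((2 * μ + 1 : ℝ) : ℂ) = x ^ (2 * μ - 1 : ℂ) * (x * x) := by
      rw [show ((2 * μ + 1 : ℝ) : ℂ) = 2 * μ - 1 + 1 + 1 by push_cast; ring,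
        Complex.cpow_add _ _ hx0, Complex.cpow_add _ _ hx0, Complex.cpow_one, mul_assoc]
    have e3 : (-2 * (1 / 2 - μ : ℝ) : ℂ) = 2 * μ - 1 := by push_cast; ring
    rw [e1, e2, e3, besselE_recurrence, laplaceU_one_sub h0 h1 (ofReal_mem_slitPlane_of_pos hx)]
    unfold macdonaldU
    push_cast
    ring
  · congr 1
    have hG : 0 < Real.Gamma (μ + 1 / 2) := Real.Gamma_pos_of_pos (by linarith)
    have : ((-(1 / 2 - μ) : ℝ) : ℂ) + 1 = ((μ + 1 / 2 : ℝ) : ℂ) := by push_cast; ring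
    rw [this, Complex.Gamma_ofReal]
    rw [mul_zero, zero_mul, add_zero, ← Complex.ofReal_inv, ← Complex.ofReal_mul]
    rw [neg_mul, one_mul]
    congr 2
    field_simp

/-! ### Identification of the Laplace integral with `K`. -/

/-- The constant in `z^{μ-1/2} K_{1/2-μ}(z) = c · macdonaldU μ z`. -/
noncomputable def macdonaldConst (μ : ℝ) : ℝ := √Real.pi * 2 ^ (μ - 1 / 2) / Real.Gamma (1 - μ)

/-- The three Wronskians express the Laplace solution through `I_ν` and `I_{-ν}` with `ν = 1/2 - μ`,
and the coefficients turn out to be opposite up to the powers of `2`, as in the definition of `K_ν`.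
The condition `μ ≠ 1/2` makes `sin πν` nonzero. -/
lemma cpow_mul_besselKQuot {μ : ℝ} (h0 : 0 ≤ μ) (h1 : μ < 1) (h2 : μ ≠ 1 / 2) {z : ℂ}
    (hz : z ∈ Complex.slitPlane) :
    z ^ (μ - 1 / 2 : ℂ) * besselKQuot (1 / 2 - μ) z = macdonaldConst μ * macdonaldU μ z := by
  have hz0 := Complex.slitPlane_ne_zero hz
  have c12 := wronskian_besselE (1 / 2 - μ) hz
  have c13 := wronskian_besselE_macdonaldU h0 h1 hz
  have c23 := wronskian_besselE_neg_macdonaldU h0 h1 hz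
  have hsin : Real.sin (Real.pi * (1 / 2 - μ)) ≠ 0 := by
    have hp := Real.pi_pos
    rw [Ne, Real.sin_eq_zero_iff_of_lt_of_lt (by nlinarith) (by nlinarith)]
    exact mul_ne_zero hp.ne' (sub_ne_zero.2 h2.symm)
  have hpi : √Real.pi ≠ 0 := by positivity
  have hΓ : 0 < Real.Gamma (1 - μ) := Real.Gamma_pos_of_pos (by linarith)
  set S : ℝ := Real.sin (Real.pi * (1 / 2 - μ)) with hS
  -- The reflection formula turns the first Wronskian into a sine.
  have hG : (2 * (Complex.Gamma ((1 / 2 - μ : ℝ) + 1))⁻¹ * (Complex.Gamma (-(1 / 2 - μ : ℝ)))⁻¹ : ℂ)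
      = ((-2 * S / Real.pi : ℝ) : ℂ) := by
    have h := Complex.Gamma_mul_Gamma_one_sub (-((1 / 2 - μ : ℝ) : ℂ))
    rw [sub_neg_eq_add, add_comm (1 : ℂ), mul_neg, Complex.sin_neg, ← Complex.ofReal_mul,
      ← Complex.ofReal_sin, ← hS] at h
    rw [mul_assoc, ← mul_inv, mul_comm (Complex.Gamma (_ + 1)), h]
    push_cast
    rw [inv_div]
    ring
  set t : ℝ := 2 ^ (μ - 1 / 2) with ht
  have ht0 : 0 < t := by positivity
  -- Legendre duplication at `1 - μ` brings the second Wronskian to the same shape as the third.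
  have hD : (-(Complex.Gamma ((1 / 2 - μ : ℝ) + 1))⁻¹ * Real.Gamma (2 - 2 * μ) : ℂ) =
      ((-(Real.Gamma (1 - μ) * (t⁻¹ * t⁻¹) / √Real.pi) : ℝ) : ℂ) := by
    have d := Real.Gamma_mul_Gamma_add_half (1 - μ)
    have e1 : ((1 / 2 - μ : ℝ) : ℂ) + 1 = ((1 - μ + 1 / 2 : ℝ) : ℂ) := by push_cast; ring
    have e2 : (2 : ℝ) ^ (1 - 2 * (1 - μ)) = t * t := by
      rw [ht, ← Real.rpow_add two_pos]; congr 1; ring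
    rw [e1, Complex.Gamma_ofReal, ← Complex.ofReal_inv, ← Complex.ofReal_neg, ← Complex.ofReal_mul]
    congr 1
    have p1 : 0 < Real.Gamma (1 - μ + 1 / 2) := Real.Gamma_pos_of_pos (by linarith)
    rw [e2, mul_sub, mul_one] at d
    generalize Real.Gamma (1 - μ + 1 / 2) = g at d p1 ⊢
    generalize Real.Gamma (2 - 2 * μ) = g' at d ⊢
    field_simp
    linear_combination d
  rw [hG] at c12
  rw [hD] at c13
  set P : ℂ := z ^ (μ - 1 / 2 : ℂ) with hP
  have hP0 : P ≠ 0 := by rw [hP]; simp [hz0]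
  have hzh : z / 2 = ((1 / 2 : ℝ) : ℂ) * z := by push_cast; ring
  have hh1 : (1 / 2 : ℝ) ^ (-(1 / 2 - μ)) = t⁻¹ := by
    rw [ht, one_div, Real.inv_rpow two_pos.le, neg_sub]
  have hh2 : (1 / 2 : ℝ) ^ (1 / 2 - μ) = t := by
    rw [ht, one_div, Real.inv_rpow two_pos.le, ← Real.rpow_neg two_pos.le, neg_sub]
  have hP1 : (z / 2) ^ ((-(1 / 2 - μ) : ℝ) : ℂ) = (t : ℂ)⁻¹ * P := by
    rw [hzh, Complex.ofReal_mul_cpow (by norm_num) hz0, ← Complex.ofReal_cpow (by norm_num), hh1,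
      hP, Complex.ofReal_inv]
    congr 2
    push_cast
    ring
  have hP2 : (z / 2) ^ ((1 / 2 - μ : ℝ) : ℂ) = t * P⁻¹ := by
    rw [hzh, Complex.ofReal_mul_cpow (by norm_num) hz0, ← Complex.ofReal_cpow (by norm_num), hh2,
      hP, ← Complex.cpow_neg]
    congr 2
    push_cast
    ring
  have hP3 : z ^ (-2 * (1 / 2 - μ : ℝ) : ℂ) = P * P := by
    rw [hP, ← Complex.cpow_add _ _ hz0]; congr 1; push_cast; ring
  rw [hP3] at c12 c23
  have hI1 : besselI (-(1 / 2 - μ)) z = (t : ℂ)⁻¹ * P * besselE (-(1 / 2 - μ)) (z ^ 2 / 4) := by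
    rw [← hP1]; rfl
  have hI2 : besselI (1 / 2 - μ) z = t * P⁻¹ * besselE (1 / 2 - μ) (z ^ 2 / 4) := by
    rw [← hP2]; rfl
  have hsin' : Complex.sin (Real.pi * ((1 / 2 - μ : ℝ) : ℂ)) = S := by
    rw [hS]; push_cast; rfl
  unfold besselKQuot macdonaldConst
  rw [hI1, hI2, hsin', ← ht]
  have hSc : (S : ℂ) ≠ 0 := by exact_mod_cast hsin
  have htc : (t : ℂ) ≠ 0 := by exact_mod_cast ht0.ne'
  have hpic : (Real.pi : ℂ) ≠ 0 := by exact_mod_cast Real.pi_ne_zero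
  have hrc : ((√Real.pi : ℝ) : ℂ) ≠ 0 := by exact_mod_cast hpi
  have hΓc : ((Real.Gamma (1 - μ) : ℝ) : ℂ) ≠ 0 := by exact_mod_cast hΓ.ne'
  -- With `W_{ij} = u_i w_j - u_j w_i`, the identity `u₃ W₁₂ = u₂ W₁₃ - u₁ W₂₃` holds for any three
  -- pairs.
  have main : macdonaldU μ z * ((-2 * S / Real.pi : ℝ) : ℂ) =
      P * P * besselE (-(1 / 2 - μ)) (z ^ 2 / 4) *
        ((-(Real.Gamma (1 - μ) * (t⁻¹ * t⁻¹) / √Real.pi) : ℝ) : ℂ) +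
      besselE (1 / 2 - μ) (z ^ 2 / 4) * ((Real.Gamma (1 - μ) / √Real.pi : ℝ) : ℂ) := by
    rw [← c12, ← c13]
    linear_combination (-besselE (1 / 2 - μ) (z ^ 2 / 4)) * c23
  push_cast at main ⊢
  field_simp at main ⊢
  linear_combination main

lemma Real.rpow_le_rpow_add_rpow_of_le {x p q r : ℝ} (hx : 0 < x) (hp : p ≤ q) (hr : q ≤ r) :
    x ^ q ≤ x ^ p + x ^ r := by
  have h1 : 0 < x ^ p := Real.rpow_pos_of_pos hx p
  have h2 : 0 < x ^ r := Real.rpow_pos_of_pos hx r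
  rcases le_total x 1 with h | h
  · linarith [Real.rpow_le_rpow_of_exponent_ge hx h hp]
  · linarith [Real.rpow_le_rpow_of_exponent_le h hr]

/-- For `μ` near `1/2` the exponent `-μ` lies between `-3/4` and `-1/4`, so a power with exponent
`-μ` is at most the sum of the powers with these two exponents. This gives the majorant. -/
lemma tendsto_laplaceU_order {z : ℂ} (hz : z ∈ Complex.slitPlane) :
    Tendsto (fun μ : ℝ => laplaceU (-μ) (-μ) z) (𝓝 (1 / 2))
      (𝓝 (laplaceU (-(1 / 2)) (-(1 / 2)) z)) := by
  have hd : 0 < 2 * slitDist z := mul_pos two_pos (slitDist_pos hz)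
  set c := 2 * slitDist z
  have hev : ∀ᶠ μ : ℝ in 𝓝 (1 / 2), μ ∈ Set.Ioo (1 / 4 : ℝ) (3 / 4) :=
    Ioo_mem_nhds (by norm_num) (by norm_num)
  refine MeasureTheory.tendsto_integral_filter_of_dominated_convergence
    (fun s => (Real.exp (-s) * s ^ (-3 / 4 : ℝ) + Real.exp (-s) * s ^ (-1 / 4 : ℝ)) *
      (c ^ (-3 / 4 : ℝ) + c ^ (-1 / 4 : ℝ))) ?_ ?_ ?_ ?_
  · exact Eventually.of_forall fun μ => aestronglyMeasurable_laplaceU _ _ hz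
  · filter_upwards [hev] with μ hμ
    filter_upwards [MeasureTheory.ae_restrict_mem measurableSet_Ioi] with s hs
    have hs' : (0 : ℝ) < s := hs
    refine (norm_laplaceU_integrand_le hs hd (by linarith [hμ.1])
      (two_mul_slitDist_le z hs'.le)).trans ?_
    rw [← mul_add]
    have h1 := Real.rpow_le_rpow_add_rpow_of_le hs' (show -3 / 4 ≤ -μ by linarith [hμ.2])
      (show -μ ≤ -1 / 4 by linarith [hμ.1])
    have h2 := Real.rpow_le_rpow_add_rpow_of_le hd (show -3 / 4 ≤ -μ by linarith [hμ.2])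
      (show -μ ≤ -1 / 4 by linarith [hμ.1])
    gcongr
  · exact ((integrableOn_exp_neg_mul_rpow (by norm_num)).add
      (integrableOn_exp_neg_mul_rpow (by norm_num))).mul_const _
  · filter_upwards [MeasureTheory.ae_restrict_mem measurableSet_Ioi] with s hs
    have hs' : (0 : ℝ) < s := hs
    have hne : 2 * z + s ≠ 0 := Complex.slitPlane_ne_zero (two_mul_add_mem_slitPlane hz hs'.le)
    have hc : Continuous fun μ : ℝ => ((Real.exp (-s) * s ^ (-μ) : ℝ) : ℂ) *
        (2 * z + s) ^ ((-μ : ℝ) : ℂ) := by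
      refine Continuous.mul ?_ ?_
      · exact Complex.continuous_ofReal.comp (continuous_const.mul
          (Real.continuous_const_rpow hs'.ne' |>.comp continuous_neg))
      · exact Continuous.const_cpow (by fun_prop) (Or.inl hne)
    exact hc.tendsto _

lemma exists_int_eq_half_sub_iff {μ : ℝ} (h0 : 0 ≤ μ) (h1 : μ < 1) :
    (∃ n : ℤ, 1 / 2 - μ = n) ↔ μ = 1 / 2 := by
  constructor
  · rintro ⟨n, hn⟩
    have h2 : (-1 : ℝ) < n := by linarith
    have h3 : (n : ℝ) < 1 := by linarith
    have h4 : n = 0 := by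
      have : -1 < n := by exact_mod_cast h2
      have : n < 1 := by exact_mod_cast h3
      omega
    rw [h4] at hn
    push_cast at hn
    linarith
  · rintro rfl
    exact ⟨0, by norm_num⟩

/-- At order `s ≠ 0` the quotient equals the Laplace form with `μ = 1/2 - s`, which is continuous in
`μ` at `1/2`. The limit defining `K_0` is therefore its value there. -/
lemma besselK_zero_eq {z : ℂ} (hz : z ∈ Complex.slitPlane) :
    besselK 0 z = macdonaldConst (1 / 2) * macdonaldU (1 / 2) z := by
  have hz0 := Complex.slitPlane_ne_zero hz
  unfold besselK
  rw [if_pos ⟨0, by simp⟩]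
  refine Tendsto.limUnder_eq ?_
  have hφ : Tendsto (fun s : ℝ => 1 / 2 - s) (𝓝[≠] 0) (𝓝 (1 / 2)) :=
    ((by fun_prop : Continuous fun s : ℝ => 1 / 2 - s).tendsto' 0 _ (by norm_num)).mono_left
      nhdsWithin_le_nhds
  have hg : Tendsto (fun μ : ℝ => z ^ (1 / 2 - μ : ℂ) * (macdonaldConst μ * macdonaldU μ z))
      (𝓝 (1 / 2)) (𝓝 (z ^ (1 / 2 - (1 / 2 : ℝ) : ℂ) *
        (macdonaldConst (1 / 2) * macdonaldU (1 / 2) z))) := by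
    refine Tendsto.mul ?_ (Tendsto.mul ?_ (Tendsto.mul (Tendsto.mul ?_ tendsto_const_nhds)
      (tendsto_laplaceU_order hz)))
    · exact (Continuous.const_cpow (by fun_prop) (Or.inl hz0)).tendsto _
    · refine (Complex.continuous_ofReal.tendsto _).comp ?_
      have hG : ContinuousAt (fun μ : ℝ => Real.Gamma (1 - μ)) (1 / 2) := by
        have h := (Real.differentiableAt_Gamma (s := 1 - 1 / 2) (fun m => by
          have : (0 : ℝ) ≤ m := m.cast_nonneg
          intro h; linarith)).continuousAt
        exact ContinuousAt.comp (g := Real.Gamma) (f := fun μ : ℝ => 1 - μ) h (by fun_prop)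
      have hne : Real.Gamma (1 - 1 / 2) ≠ 0 := (Real.Gamma_pos_of_pos (by norm_num)).ne'
      have : ContinuousAt macdonaldConst (1 / 2) := by
        refine ContinuousAt.div (continuousAt_const.mul ?_) hG hne
        exact ((Real.continuous_const_rpow two_ne_zero).comp
          (by fun_prop : Continuous fun μ : ℝ => μ - 1 / 2)).continuousAt
      exact this
    · exact (Continuous.const_cpow (by fun_prop) (Or.inl hz0)).tendsto _
  have := hg.comp hφ
  rw [show (1 / 2 - (1 / 2 : ℝ) : ℂ) = 0 by push_cast; ring, Complex.cpow_zero, one_mul] at this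
  refine this.congr' ?_
  have hev : ∀ᶠ s : ℝ in 𝓝[≠] 0, s ∈ Set.Ioo (-1 / 2 : ℝ) (1 / 2) :=
    mem_nhdsWithin_of_mem_nhds (Ioo_mem_nhds (by norm_num) (by norm_num))
  filter_upwards [hev, self_mem_nhdsWithin] with s hs hs0
  have hs0' : s ≠ 0 := hs0
  have h := cpow_mul_besselKQuot (μ := 1 / 2 - s) (by linarith [hs.2]) (by linarith [hs.1])
    (by intro h; apply hs0'; linarith) hz
  rw [sub_sub_cancel] at h
  simp only [Function.comp]
  rw [← h, ← mul_assoc, ← Complex.cpow_add _ _ hz0]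
  push_cast
  ring_nf
  simp

/-- The Laplace representation of the scaled Macdonald function on the slit plane. -/
theorem scaledK_eq {μ : ℝ} (h0 : 0 ≤ μ) (h1 : μ < 1) {z : ℂ} (hz : z ∈ Complex.slitPlane) :
    scaledK μ z = macdonaldConst μ * macdonaldU μ z := by
  unfold scaledK
  by_cases h : μ = 1 / 2
  · subst h
    rw [show (1 / 2 - 1 / 2 : ℝ) = 0 by norm_num, besselK_zero_eq hz]
    push_cast
    simp
  · unfold besselK
    rw [if_neg (by rwa [exists_int_eq_half_sub_iff h0 h1]), cpow_mul_besselKQuot h0 h1 h hz]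

lemma continuousAt_scaledK {μ : ℝ} (h0 : 0 ≤ μ) (h1 : μ < 1) {z : ℂ}
    (hz : z ∈ Complex.slitPlane) : ContinuousAt (scaledK μ) z := by
  have h : ContinuousAt (fun z => macdonaldConst μ * macdonaldU μ z) z :=
    continuousAt_const.mul (isBesselPair_macdonaldU h0 h1 z hz).1.continuousAt
  refine h.congr ?_
  filter_upwards [Complex.isOpen_slitPlane.mem_nhds hz] with w hw
  exact (scaledK_eq h0 h1 hw).symm

/-! ### Conjugation symmetry and positivity. -/

open ComplexConjugate

lemma conj_mem_slitPlane {z : ℂ} (hz : z ∈ Complex.slitPlane) : conj z ∈ Complex.slitPlane := by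
  rw [Complex.mem_slitPlane_iff] at hz ⊢
  simpa using hz

lemma Complex.conj_cpow_of_mem_slitPlane {z : ℂ} (hz : z ∈ Complex.slitPlane) (c : ℂ) :
    conj z ^ c = conj (z ^ conj c) :=
  Complex.conj_cpow _ _ (Complex.mem_slitPlane_iff_arg.1 hz).1

lemma laplaceU_conj (α β : ℝ) {z : ℂ} (hz : z ∈ Complex.slitPlane) :
    laplaceU α β (conj z) = conj (laplaceU α β z) := by
  unfold laplaceU
  rw [← integral_conj]
  refine MeasureTheory.setIntegral_congr_fun measurableSet_Ioi fun s hs => ?_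
  have h := two_mul_add_mem_slitPlane hz (le_of_lt hs)
  have e : 2 * conj z + (s : ℂ) = conj (2 * z + s) := by simp [map_ofNat]
  rw [e, Complex.conj_cpow_of_mem_slitPlane h, map_mul, Complex.conj_ofReal, Complex.conj_ofReal]

lemma macdonaldU_conj (μ : ℝ) {z : ℂ} (hz : z ∈ Complex.slitPlane) :
    macdonaldU μ (conj z) = conj (macdonaldU μ z) := by
  unfold macdonaldU
  rw [laplaceU_conj _ _ hz, Complex.conj_cpow_of_mem_slitPlane hz, ← map_neg, Complex.exp_conj]
  simp [map_ofNat]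

lemma scaledK_conj {μ : ℝ} (h0 : 0 ≤ μ) (h1 : μ < 1) {z : ℂ} (hz : z ∈ Complex.slitPlane) :
    scaledK μ (conj z) = conj (scaledK μ z) := by
  rw [scaledK_eq h0 h1 hz, scaledK_eq h0 h1 (conj_mem_slitPlane hz), macdonaldU_conj μ hz]
  simp

lemma macdonaldConst_pos {μ : ℝ} (h1 : μ < 1) : 0 < macdonaldConst μ := by
  have := Real.Gamma_pos_of_pos (show 0 < 1 - μ by linarith)
  unfold macdonaldConst
  positivity

lemma arg_scaledK_ofReal {μ : ℝ} (h0 : 0 ≤ μ) (h1 : μ < 1) {x : ℝ} (hx : 0 < x) :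
    (scaledK μ x).arg = 0 := by
  have hJ : laplaceU (-μ) (-μ) x = ((∫ s in Set.Ioi (0 : ℝ),
      Real.exp (-s) * s ^ (-μ) * (2 * x + s) ^ (-μ) : ℝ) : ℂ) := by
    rw [← integral_complex_ofReal]
    refine MeasureTheory.setIntegral_congr_fun measurableSet_Ioi fun s hs' => ?_
    have h1 : (0 : ℝ) < s := hs'
    rw [Complex.ofReal_mul (_ * _), Complex.ofReal_cpow (by positivity)]
    push_cast
    rfl
  have hI : 0 ≤ ∫ s in Set.Ioi (0 : ℝ), Real.exp (-s) * s ^ (-μ) * (2 * x + s) ^ (-μ) := by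
    refine MeasureTheory.setIntegral_nonneg measurableSet_Ioi fun s hs => ?_
    have : (0 : ℝ) < s := hs
    positivity
  rw [scaledK_eq h0 h1 (ofReal_mem_slitPlane_of_pos hx), macdonaldU, hJ,
    show (2 * μ - 1 : ℂ) = ((2 * μ - 1 : ℝ) : ℂ) by push_cast; rfl, ← Complex.ofReal_cpow hx.le,
    ← Complex.ofReal_neg, ← Complex.ofReal_exp]
  simp only [← Complex.ofReal_mul]
  have := macdonaldConst_pos h1
  exact Complex.arg_ofReal_of_nonneg (by positivity)

/-! ### Bounds for the terms of `T` and for its sum. -/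

/-- Multiplying by the conjugate of `q` and taking real parts, the left factor `2aq + s` contributes
`2 Re(a) |q|² + s Re(q)`, and the last summand is nonnegative. -/
lemma two_mul_re_mul_norm_le {a q : ℂ} (hq : 0 < q.re) {s : ℝ} (hs : 0 ≤ s) :
    2 * (a.re * ‖q‖) ≤ ‖2 * (a * q) + s‖ := by
  have hq0 : 0 < ‖q‖ := norm_pos_iff.2 (by rintro rfl; simp at hq)
  have h1 : ‖2 * (a * q) + s‖ * ‖q‖ = ‖(2 * (a * q) + s) * conj q‖ := by
    rw [norm_mul, Complex.norm_conj]
  have h2 : ((2 * (a * q) + s) * conj q).re = 2 * a.re * ‖q‖ ^ 2 + s * q.re := by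
    rw [← Complex.normSq_eq_norm_sq, Complex.normSq_apply]
    simp
    ring
  have h3 := Complex.re_le_norm ((2 * (a * q) + s) * conj q)
  rw [h2, ← h1] at h3
  have h4 : 0 ≤ s * q.re := mul_nonneg hs hq.le
  nlinarith

/-- If `aq` were real and nonpositive, then `s = -2aq` would make `2aq + s` vanish, against the
preceding lower bound. -/
lemma mul_mem_slitPlane_of_re_pos {a q : ℂ} (ha : 0 < a.re) (hq : 0 < q.re) :
    a * q ∈ Complex.slitPlane := by
  by_contra h
  rw [Complex.mem_slitPlane_iff, not_or, not_lt, not_not] at h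
  have hq0 : 0 < ‖q‖ := norm_pos_iff.2 (by rintro rfl; simp at hq)
  have h1 := two_mul_re_mul_norm_le (a := a) hq (s := -2 * (a * q).re) (by linarith [h.1])
  have h2 : 2 * (a * q) + ((-2 * (a * q).re : ℝ) : ℂ) = 0 := by
    apply Complex.ext
    · simp
    · have := h.2
      simp at this ⊢
      linarith
  rw [h2, norm_zero] at h1
  have : 0 < a.re * ‖q‖ := mul_pos ha hq0
  linarith

lemma norm_macdonaldU_le {μ : ℝ} (h0 : 0 ≤ μ) (h1 : μ < 1) {a q : ℂ} (ha : 0 < a.re)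
    (hq : 0 < q.re) :
    ‖macdonaldU μ (a * q)‖ ≤ Real.Gamma (1 - μ) * ‖a * q‖ ^ (2 * μ - 1) *
      (a.re * ‖q‖) ^ (-μ) * Real.exp (-(a * q).re) := by
  have hq0 : 0 < ‖q‖ := norm_pos_iff.2 (by rintro rfl; simp at hq)
  have hJ : ‖laplaceU (-μ) (-μ) (a * q)‖ ≤ Real.Gamma (-μ + 1) * (a.re * ‖q‖) ^ (-μ) :=
    norm_laplaceU_le (by linarith) (by linarith) (by positivity) fun s hs =>
      le_trans (by nlinarith [mul_pos ha hq0]) (two_mul_re_mul_norm_le hq hs.le)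
  unfold macdonaldU
  rw [norm_mul, norm_mul, Complex.norm_exp,
    show (2 * μ - 1 : ℂ) = ((2 * μ - 1 : ℝ) : ℂ) by push_cast; rfl, Complex.norm_cpow_real,
    Complex.neg_re]
  rw [neg_add_eq_sub] at hJ
  calc _ ≤ ‖a * q‖ ^ (2 * μ - 1) * Real.exp (-(a * q).re) *
      (Real.Gamma (1 - μ) * (a.re * ‖q‖) ^ (-μ)) := by gcongr
    _ = _ := by ring

/-- `X_k` itself may leave the right half-plane when `a` is far from real, but it is a product of
two factors, the second with positive real part. All estimates use this factorisation. -/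
lemma mathieuX_eq_mul (lam : ℝ) (a : ℂ) (k : ℕ) :
    mathieuX lam a k = a * (((2 * k + 1) * Real.pi : ℝ) + (lam : ℂ) * Complex.I) := by
  unfold mathieuX
  push_cast
  ring

lemma odd_mul_pi_pos (k : ℕ) : 0 < (2 * k + 1) * Real.pi := by positivity

lemma mathieuX_mem_slitPlane (lam : ℝ) {a : ℂ} (ha : 0 < a.re) (k : ℕ) :
    mathieuX lam a k ∈ Complex.slitPlane := by
  rw [mathieuX_eq_mul]
  exact mul_mem_slitPlane_of_re_pos ha (by simpa using odd_mul_pi_pos k)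

lemma mathieuX_re (lam : ℝ) (a : ℂ) (k : ℕ) :
    (mathieuX lam a k).re = (2 * k + 1) * Real.pi * a.re - lam * a.im := by
  rw [mathieuX_eq_mul]
  simp
  ring

lemma pi_mul_norm_le_norm_mathieuX (lam : ℝ) (a : ℂ) (k : ℕ) :
    Real.pi * ‖a‖ ≤ ‖mathieuX lam a k‖ := by
  rw [mathieuX_eq_mul, norm_mul, mul_comm]
  refine mul_le_mul_of_nonneg_left ?_ (norm_nonneg a)
  refine le_trans ?_ (Complex.re_le_norm _)
  simp
  have : (0 : ℝ) ≤ k := k.cast_nonneg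
  nlinarith [Real.pi_pos]

lemma mathieuX_conj (lam : ℝ) (a : ℂ) (k : ℕ) :
    conj (mathieuX lam a k) = mathieuX (-lam) (conj a) k := by
  unfold mathieuX
  simp [map_ofNat]

/-- The factor in the bound for the terms of `mathieuT` that does not depend on `k` and `λ`. -/
noncomputable def mathieuBound (μ : ℝ) (a : ℂ) : ℝ :=
  macdonaldConst μ * Real.Gamma (1 - μ) * (a.re / ‖a‖) ^ (-μ) * (Real.pi * ‖a‖) ^ (μ - 1)

/-- The prefactor `|X|^{2μ-1}` and the bound `|X|^{-μ}` for the Laplace integral combine to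
`|X|^{μ-1}`, which `|X| ≥ π|a|` bounds uniformly in `k` because `μ < 1`. The rest of the
`k`-dependence is `e^{-Re X_k}`, geometric with ratio `e^{-2π Re a}`. -/
lemma norm_scaledK_mathieuX_le {μ : ℝ} (h0 : 0 ≤ μ) (h1 : μ < 1) (lam : ℝ) {a : ℂ}
    (ha : 0 < a.re) (k : ℕ) :
    ‖scaledK μ (mathieuX lam a k)‖ ≤ mathieuBound μ a *
      Real.exp (-(Real.pi * a.re) + lam * a.im) * Real.exp (-(2 * Real.pi * a.re)) ^ k := by
  have ha0 : 0 < ‖a‖ := norm_pos_iff.2 (by rintro rfl; simp at ha)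
  rw [scaledK_eq h0 h1 (mathieuX_mem_slitPlane lam ha k), norm_mul, Complex.norm_real,
    Real.norm_of_nonneg (macdonaldConst_pos h1).le]
  have hX := pi_mul_norm_le_norm_mathieuX lam a k
  have hre := mathieuX_re lam a k
  rw [mathieuX_eq_mul] at hX hre ⊢
  set q : ℂ := ((2 * k + 1) * Real.pi : ℝ) + (lam : ℂ) * Complex.I
  have hq : 0 < q.re := by simpa [q] using odd_mul_pi_pos k
  have hq0 : 0 < ‖q‖ := norm_pos_iff.2 (by rintro h; simp [h] at hq)
  have hX0 : 0 < ‖a * q‖ := by rw [norm_mul]; positivity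
  have hb := norm_macdonaldU_le h0 h1 ha hq
  have e1 : (a.re * ‖q‖) ^ (-μ) = (a.re / ‖a‖) ^ (-μ) * ‖a * q‖ ^ (-μ) := by
    rw [← Real.mul_rpow (by positivity) (by positivity), norm_mul]
    congr 1
    field_simp
  have e2 : ‖a * q‖ ^ (2 * μ - 1) * ‖a * q‖ ^ (-μ) = ‖a * q‖ ^ (μ - 1) := by
    rw [← Real.rpow_add hX0]; congr 1; ring
  have e3 : ‖a * q‖ ^ (μ - 1) ≤ (Real.pi * ‖a‖) ^ (μ - 1) :=
    Real.rpow_le_rpow_of_nonpos (by positivity) hX (by linarith)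
  have e4 : Real.exp (-(a * q).re) = Real.exp (-(Real.pi * a.re) + lam * a.im) *
      Real.exp (-(2 * Real.pi * a.re)) ^ k := by
    rw [← Real.exp_nat_mul, ← Real.exp_add, hre]
    congr 1
    ring
  have hc := macdonaldConst_pos h1
  have hΓ := Real.Gamma_pos_of_pos (show 0 < 1 - μ by linarith)
  calc macdonaldConst μ * ‖macdonaldU μ (a * q)‖
      ≤ macdonaldConst μ * (Real.Gamma (1 - μ) * ‖a * q‖ ^ (2 * μ - 1) *
      (a.re * ‖q‖) ^ (-μ) * Real.exp (-(a * q).re)) := by gcongr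
    _ = macdonaldConst μ * Real.Gamma (1 - μ) * (a.re / ‖a‖) ^ (-μ) * ‖a * q‖ ^ (μ - 1) *
        Real.exp (-(a * q).re) := by rw [e1, ← e2]; ring
    _ ≤ _ := by
      rw [e4, mathieuBound, ← mul_assoc]
      gcongr

lemma exp_neg_two_pi_mul_lt_one {x : ℝ} (hx : 0 < x) : Real.exp (-(2 * Real.pi * x)) < 1 := by
  rw [Real.exp_lt_one_iff]
  have := Real.pi_pos
  have : 0 < 2 * Real.pi * x := by positivity
  linarith

lemma summable_mathieuBound (c : ℝ) {x : ℝ} (hx : 0 < x) :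
    Summable fun k : ℕ => c * Real.exp (-(2 * Real.pi * x)) ^ k :=
  (summable_geometric_of_lt_one (Real.exp_nonneg _) (exp_neg_two_pi_mul_lt_one hx)).mul_left c

lemma summable_scaledK_mathieuX {μ : ℝ} (h0 : 0 ≤ μ) (h1 : μ < 1) (lam : ℝ) {a : ℂ}
    (ha : 0 < a.re) : Summable fun k : ℕ => scaledK μ (mathieuX lam a k) :=
  Summable.of_norm_bounded (summable_mathieuBound _ ha)
    (norm_scaledK_mathieuX_le h0 h1 lam ha)

/-- The summand of `mathieuT`. -/
noncomputable def mathieuTTerm (μ lam : ℝ) (a : ℂ) (k : ℕ) : ℂ :=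
  Complex.I * (Complex.exp (-(Real.pi * Complex.I * μ)) * scaledK μ (mathieuX lam a k) -
    Complex.exp (Real.pi * Complex.I * μ) * scaledK μ (mathieuX (-lam) a k))

lemma mathieuBound_nonneg {μ : ℝ} (h1 : μ < 1) {a : ℂ} (ha : 0 < a.re) :
    0 ≤ mathieuBound μ a := by
  have hc := macdonaldConst_pos h1
  have hΓ := Real.Gamma_pos_of_pos (show 0 < 1 - μ by linarith)
  unfold mathieuBound
  positivity

/-- The bound is uniform in `|λ| ≤ L`, so that it can also serve as a majorant for the limit `λ →
0`. -/
lemma norm_mathieuTTerm_le {μ : ℝ} (h0 : 0 ≤ μ) (h1 : μ < 1) {lam L : ℝ} (hL : |lam| ≤ L) {a : ℂ}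
    (ha : 0 < a.re) (k : ℕ) :
    ‖mathieuTTerm μ lam a k‖ ≤ 2 * mathieuBound μ a *
      Real.exp (-(Real.pi * a.re) + L * |a.im|) * Real.exp (-(2 * Real.pi * a.re)) ^ k := by
  have b1 := norm_scaledK_mathieuX_le h0 h1 lam ha k
  have b2 := norm_scaledK_mathieuX_le h0 h1 (-lam) ha k
  have n1 : ‖Complex.exp (-(Real.pi * Complex.I * μ))‖ = 1 := by
    rw [Complex.norm_exp]; simp
  have n2 : ‖Complex.exp (Real.pi * Complex.I * μ)‖ = 1 := by
    rw [Complex.norm_exp]; simp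
  have hle : ∀ l : ℝ, |l| ≤ L → l * a.im ≤ L * |a.im| := fun l hl => by
    refine (le_abs_self _).trans ?_
    rw [abs_mul]
    gcongr
  have hb := mathieuBound_nonneg h1 ha
  unfold mathieuTTerm
  rw [norm_mul, Complex.norm_I, one_mul]
  refine (norm_sub_le _ _).trans ?_
  rw [norm_mul, norm_mul, n1, n2, one_mul, one_mul]
  have c1 : ‖scaledK μ (mathieuX lam a k)‖ ≤ mathieuBound μ a *
      Real.exp (-(Real.pi * a.re) + L * |a.im|) * Real.exp (-(2 * Real.pi * a.re)) ^ k := by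
    refine b1.trans ?_
    exact mul_le_mul_of_nonneg_right (mul_le_mul_of_nonneg_left (Real.exp_le_exp.2
      (by linarith [hle lam hL])) hb) (by positivity)
  have c2 : ‖scaledK μ (mathieuX (-lam) a k)‖ ≤ mathieuBound μ a *
      Real.exp (-(Real.pi * a.re) + L * |a.im|) * Real.exp (-(2 * Real.pi * a.re)) ^ k := by
    refine b2.trans ?_
    exact mul_le_mul_of_nonneg_right (mul_le_mul_of_nonneg_left (Real.exp_le_exp.2
      (by linarith [hle (-lam) (by rwa [abs_neg])])) hb) (by positivity)
  linarith

lemma mathieuT_eq (μ lam : ℝ) (a : ℂ) :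
    mathieuT μ lam a = ((2 ^ (1 / 2 - μ) * Real.Gamma (1 - μ) / √Real.pi : ℝ) : ℂ) *
      a ^ (1 - 2 * μ : ℂ) * ∑' k : ℕ, mathieuTTerm μ lam a k := rfl

theorem exists_norm_mathieuT_le {μ : ℝ} (h0 : 0 ≤ μ) (h1 : μ < 1) {lam : ℝ} (hlam : 0 < lam)
    {φ : ℝ} (hφ : φ < Real.pi / 2) :
    ∃ C : ℝ, ∀ a : ℂ, 1 ≤ ‖a‖ → |a.arg| ≤ φ → ‖mathieuT μ lam a‖ ≤
      C * ‖a‖ ^ (1 - 2 * μ) * Real.exp (-(Real.pi * a.re) + lam * |a.im|) := by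
  have hΓ := Real.Gamma_pos_of_pos (show 0 < 1 - μ by linarith)
  have hc := macdonaldConst_pos h1
  set c : ℝ := 2 ^ (1 / 2 - μ) * Real.Gamma (1 - μ) / √Real.pi with hcdef
  have hc0 : 0 ≤ c := by positivity
  -- In the sector `δ` bounds `Re a / |a|` from below, and also `Re a` because `|a| ≥ 1`; the
  -- geometric series is thus bounded uniformly.
  set δ := Real.cos φ with hδ
  refine ⟨c * (2 * (macdonaldConst μ * Real.Gamma (1 - μ) * δ ^ (-μ)) *
    (1 - Real.exp (-(2 * Real.pi * δ)))⁻¹), fun a ha harg => ?_⟩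
  have hφ0 : 0 ≤ φ := (abs_nonneg _).trans harg
  have hδ0 : 0 < δ := Real.cos_pos_of_mem_Ioo ⟨by linarith [Real.pi_pos], hφ⟩
  have ha0 : 0 < ‖a‖ := by linarith
  have hcos : δ ≤ Real.cos a.arg := by
    rw [← Real.cos_abs a.arg]
    exact Real.cos_le_cos_of_nonneg_of_le_pi (abs_nonneg _) (by linarith [Real.pi_pos]) harg
  have hre : a.re / ‖a‖ = Real.cos a.arg :=
    (Complex.cos_arg (norm_pos_iff.1 ha0)).symm
  have hδre : δ ≤ a.re := by
    have : a.re = ‖a‖ * Real.cos a.arg := by rw [← hre]; field_simp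
    rw [this]
    nlinarith
  have hre0 : 0 < a.re := by linarith
  have hb := summable_mathieuBound (2 * mathieuBound μ a *
      Real.exp (-(Real.pi * a.re) + lam * |a.im|)) hre0
  have hT := tsum_of_norm_bounded hb.hasSum
    (norm_mathieuTTerm_le h0 h1 (L := lam) (abs_of_pos hlam).le hre0)
  rw [tsum_mul_left, tsum_geometric_of_lt_one (Real.exp_nonneg _)
    (exp_neg_two_pi_mul_lt_one hre0)] at hT
  have hB : mathieuBound μ a ≤ macdonaldConst μ * Real.Gamma (1 - μ) * δ ^ (-μ) := by
    unfold mathieuBound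
    rw [hre]
    have e1 : Real.cos a.arg ^ (-μ) ≤ δ ^ (-μ) :=
      Real.rpow_le_rpow_of_nonpos hδ0 hcos (by linarith)
    have e2 : (Real.pi * ‖a‖) ^ (μ - 1) ≤ 1 :=
      Real.rpow_le_one_of_one_le_of_nonpos (by nlinarith [Real.pi_gt_three]) (by linarith)
    have e3 : 0 ≤ Real.cos a.arg ^ (-μ) := Real.rpow_nonneg (hδ0.le.trans hcos) _
    calc _ ≤ macdonaldConst μ * Real.Gamma (1 - μ) * δ ^ (-μ) * 1 := by gcongr
      _ = _ := mul_one _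
  have hE : (1 - Real.exp (-(2 * Real.pi * a.re)))⁻¹ ≤ (1 - Real.exp (-(2 * Real.pi * δ)))⁻¹ := by
    have := exp_neg_two_pi_mul_lt_one hδ0
    have hpi := Real.pi_pos
    gcongr
  have hE0 : 0 < (1 - Real.exp (-(2 * Real.pi * a.re)))⁻¹ := by
    have := exp_neg_two_pi_mul_lt_one hre0
    rw [inv_pos]; linarith
  have hB0 := mathieuBound_nonneg h1 hre0
  rw [mathieuT_eq, ← hcdef, norm_mul, norm_mul, Complex.norm_real, Real.norm_of_nonneg hc0,
    show (1 - 2 * μ : ℂ) = ((1 - 2 * μ : ℝ) : ℂ) by push_cast; rfl, Complex.norm_cpow_real]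
  calc _ ≤ c * ‖a‖ ^ (1 - 2 * μ) * (2 * mathieuBound μ a *
        Real.exp (-(Real.pi * a.re) + lam * |a.im|) *
        (1 - Real.exp (-(2 * Real.pi * a.re)))⁻¹) := by gcongr
    _ ≤ c * ‖a‖ ^ (1 - 2 * μ) * (2 * (macdonaldConst μ * Real.Gamma (1 - μ) * δ ^ (-μ)) *
        Real.exp (-(Real.pi * a.re) + lam * |a.im|) *
        (1 - Real.exp (-(2 * Real.pi * δ)))⁻¹) := by gcongr
    _ = _ := by ring

theorem mathieuT_isBigO {μ : ℝ} (h0 : 0 ≤ μ) (h1 : μ < 1) {lam : ℝ} (hlam : 0 < lam) :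
    (fun a : ℝ => mathieuT μ lam a) =O[atTop]
      (fun a : ℝ => a ^ (1 - 2 * μ) * Real.exp (-(Real.pi * a))) := by
  obtain ⟨C, hC⟩ := exists_norm_mathieuT_le h0 h1 hlam (φ := 0) (by positivity)
  refine IsBigO.of_bound C ?_
  filter_upwards [eventually_ge_atTop 1] with a ha
  have ha0 : 0 ≤ a := by linarith
  have h := hC a (by rw [Complex.norm_real, Real.norm_of_nonneg ha0]; exact ha)
    (by rw [Complex.arg_ofReal_of_nonneg ha0, abs_zero])
  rw [Complex.norm_real, Real.norm_of_nonneg ha0, Complex.ofReal_im, abs_zero, mul_zero, add_zero,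
    Complex.ofReal_re] at h
  rw [Real.norm_of_nonneg (by positivity), ← mul_assoc]
  exact h

/-! ### The case `λ = 0` of `θ_k` and `H`, and the modulus-phase form for `a > 0`. -/

theorem mathieuTheta_zero {μ : ℝ} (h0 : 0 ≤ μ) (h1 : μ < 1) {a : ℝ} (ha : 0 < a) (k : ℕ) :
    mathieuTheta μ 0 a k = 0 := by
  have e : mathieuX 0 a k = (((2 * k + 1) * Real.pi * a : ℝ) : ℂ) := by
    unfold mathieuX; push_cast; ring
  rw [mathieuTheta, e]
  exact arg_scaledK_ofReal h0 h1 (by positivity)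

theorem mathieuH_zero (μ : ℝ) (a : ℂ) : mathieuH μ 0 a = 0 := by
  simp [mathieuH, mathieuHIntegrand]

/-- For `a > 0` the two terms of the summand are complex conjugates. -/
lemma mathieuTTerm_ofReal {μ : ℝ} (h0 : 0 ≤ μ) (h1 : μ < 1) (lam : ℝ) {a : ℝ} (ha : 0 < a)
    (k : ℕ) : mathieuTTerm μ lam a k =
      ((2 * (Real.sin (Real.pi * μ - mathieuTheta μ lam a k) *
        ‖scaledK μ (mathieuX lam a k)‖) : ℝ) : ℂ) := by
  have ha' : 0 < (a : ℂ).re := by simpa using ha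
  have hconj : scaledK μ (mathieuX (-lam) a k) = conj (scaledK μ (mathieuX lam a k)) := by
    rw [← scaledK_conj h0 h1 (mathieuX_mem_slitPlane lam ha' k), mathieuX_conj, Complex.conj_ofReal]
  unfold mathieuTTerm mathieuTheta
  rw [hconj]
  generalize scaledK μ (mathieuX lam a k) = F
  have hF : F = ‖F‖ * Complex.exp (F.arg * Complex.I) := (Complex.norm_mul_exp_arg_mul_I F).symm
  have hF2 : conj F = ‖F‖ * Complex.exp (-(F.arg * Complex.I)) := by
    conv_lhs => rw [hF]
    rw [map_mul, Complex.conj_ofReal, ← Complex.exp_conj]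
    simp
  rw [hF2]
  generalize ‖F‖ = r at hF ⊢
  generalize F.arg = θ at hF ⊢
  rw [hF]
  push_cast
  rw [Complex.sin]
  have e1 : Complex.exp (-((Real.pi * μ - θ) * Complex.I)) =
      Complex.exp (-(Real.pi * Complex.I * μ)) * Complex.exp (θ * Complex.I) := by
    rw [← Complex.exp_add]; congr 1; ring
  have e2 : Complex.exp ((Real.pi * μ - θ) * Complex.I) =
      Complex.exp (Real.pi * Complex.I * μ) * Complex.exp (-(θ * Complex.I)) := by
    rw [← Complex.exp_add]; congr 1; ring
  rw [← neg_mul] at e1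
  rw [e1, e2]
  ring

theorem summable_sin_mul_norm_scaledK {μ : ℝ} (h0 : 0 ≤ μ) (h1 : μ < 1) (lam : ℝ) {a : ℝ}
    (ha : 0 < a) : Summable fun k : ℕ => Real.sin (Real.pi * μ - mathieuTheta μ lam a k) *
      ‖scaledK μ (mathieuX lam a k)‖ := by
  have ha' : 0 < (a : ℂ).re := by simpa using ha
  refine Summable.of_norm_bounded (summable_scaledK_mathieuX h0 h1 lam ha').norm fun k => ?_
  rw [norm_mul, norm_norm]
  exact mul_le_of_le_one_left (norm_nonneg _) (Real.abs_sin_le_one _)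

theorem mathieuT_ofReal {μ : ℝ} (h0 : 0 ≤ μ) (h1 : μ < 1) (lam : ℝ) {a : ℝ} (ha : 0 < a) :
    mathieuT μ lam a = ((2 ^ (3 / 2 - μ) * √Real.pi / a ^ (2 * μ - 1) *
        (Real.Gamma (1 - μ) / Real.pi) *
        ∑' k : ℕ, Real.sin (Real.pi * μ - mathieuTheta μ lam a k) *
          ‖scaledK μ (mathieuX lam a k)‖ : ℝ) : ℂ) := by
  rw [mathieuT_eq, tsum_congr (mathieuTTerm_ofReal h0 h1 lam ha), ← Complex.ofReal_tsum,
    tsum_mul_left, show (1 - 2 * μ : ℂ) = ((1 - 2 * μ : ℝ) : ℂ) by push_cast; rfl,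
    ← Complex.ofReal_cpow ha.le, ← Complex.ofReal_mul, ← Complex.ofReal_mul]
  congr 1
  have e1 : (2 : ℝ) ^ (3 / 2 - μ) = 2 * 2 ^ (1 / 2 - μ) := by
    rw [show 3 / 2 - μ = 1 + (1 / 2 - μ) by ring, Real.rpow_add two_pos, Real.rpow_one]
  have e2 : a ^ (1 - 2 * μ) = (a ^ (2 * μ - 1))⁻¹ := by
    rw [← Real.rpow_neg ha.le]; congr 1; ring
  have e3 : Real.pi = √Real.pi * √Real.pi := (Real.mul_self_sqrt Real.pi_pos.le).symm
  have h3 : √Real.pi ≠ 0 := by positivity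
  have h4 : a ^ (2 * μ - 1) ≠ 0 := by positivity
  rw [e1, e2]
  generalize (∑' k : ℕ, Real.sin (Real.pi * μ - mathieuTheta μ lam a k) *
          ‖scaledK μ (mathieuX lam a k)‖) = T
  have e4 : √Real.pi / Real.pi = 1 / √Real.pi := by
    rw [div_eq_div_iff Real.pi_ne_zero h3, one_mul]; exact e3.symm
  have : √Real.pi * (Real.Gamma (1 - μ) / Real.pi) = Real.Gamma (1 - μ) * (1 / √Real.pi) := by
    rw [← e4]; ring
  linear_combination (-(2 * 2 ^ (1 / 2 - μ) * (a ^ (2 * μ - 1))⁻¹ * T)) * this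

/-! ### Deformation of contours; rotation of a ray. -/

open MeasureTheory in
/-- Homotopy invariance of integrals over rays: if `∂A/∂τ = ∂B/∂x` is integrable over the strip,
the integrals of `A` over the two ends differ by the integral of `B` over the side `x = 0`. -/
theorem integral_Ioi_sub_eq_of_homotopy {A B D : ℝ → ℝ → ℂ}
    (hA : ∀ x, 0 < x → ContinuousOn (fun τ => A τ x) (Set.Icc 0 1))
    (hAd : ∀ x, 0 < x → ∀ τ ∈ Set.Ioo (0 : ℝ) 1, HasDerivAt (fun τ => A τ x) (D τ x) τ)
    (hB : ∀ τ ∈ Set.Ioo (0 : ℝ) 1, ContinuousWithinAt (B τ) (Set.Ici 0) 0)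
    (hBd : ∀ τ ∈ Set.Ioo (0 : ℝ) 1, ∀ x, 0 < x → HasDerivAt (B τ) (D τ x) x)
    (hBlim : ∀ τ ∈ Set.Ioo (0 : ℝ) 1, Tendsto (B τ) atTop (𝓝 0))
    (hD : Integrable (Function.uncurry D)
      ((volume.restrict (Set.Ioo 0 1)).prod (volume.restrict (Set.Ioi 0))))
    (hA0 : IntegrableOn (A 0) (Set.Ioi 0)) (hA1 : IntegrableOn (A 1) (Set.Ioi 0)) :
    (∫ x in Set.Ioi 0, A 1 x) - ∫ x in Set.Ioi 0, A 0 x = -∫ τ in Set.Ioo 0 1, B τ 0 := by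
  -- Integrating `D` over `x` first gives `-B(τ, 0)`, and over `τ` first gives `A 1 x - A 0 x`.
  have hswap := integral_integral_swap hD
  have h1 : ∫ τ in Set.Ioo (0 : ℝ) 1, ∫ x in Set.Ioi (0 : ℝ), D τ x =
      ∫ τ in Set.Ioo (0 : ℝ) 1, -B τ 0 := by
    refine integral_congr_ae ?_
    filter_upwards [hD.prod_right_ae, ae_restrict_mem measurableSet_Ioo] with τ hτ hτm
    rw [integral_Ioi_of_hasDerivAt_of_tendsto (hB τ hτm) (fun x hx => hBd τ hτm x hx) hτ
      (hBlim τ hτm), zero_sub]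
  have h2 : ∫ x in Set.Ioi (0 : ℝ), ∫ τ in Set.Ioo (0 : ℝ) 1, D τ x =
      ∫ x in Set.Ioi (0 : ℝ), (A 1 x - A 0 x) := by
    refine integral_congr_ae ?_
    filter_upwards [hD.prod_left_ae, ae_restrict_mem measurableSet_Ioi] with x hx hxm
    have hx' : IntegrableOn (fun τ => D τ x) (Set.Ioo 0 1) := hx
    have := intervalIntegral.integral_eq_sub_of_hasDerivAt_of_le zero_le_one (hA x hxm)
      (hAd x hxm) (by rwa [intervalIntegrable_iff_integrableOn_Ioo_of_le zero_le_one])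
    rw [← this, intervalIntegral.integral_of_le zero_le_one, integral_Ioc_eq_integral_Ioo]
  rw [← integral_sub hA1 hA0, ← h2, ← hswap, h1, integral_neg]

/-- The function `e^{-sz} (z+p)^{-μ} (z+q)^{-μ}`. -/
noncomputable def branchKernel (μ : ℝ) (s p q z : ℂ) : ℂ :=
  Complex.exp (-(s * z)) * ((z + p) ^ ((-μ : ℝ) : ℂ) * (z + q) ^ ((-μ : ℝ) : ℂ))

/-- The derivative of `branchKernel`. -/
noncomputable def branchKernelDeriv (μ : ℝ) (s p q z : ℂ) : ℂ :=
  Complex.exp (-(s * z)) * (-s * ((z + p) ^ ((-μ : ℝ) : ℂ) * (z + q) ^ ((-μ : ℝ) : ℂ)) +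
    -μ * ((z + p) ^ ((-μ - 1 : ℝ) : ℂ) * (z + q) ^ ((-μ : ℝ) : ℂ)) +
    -μ * ((z + p) ^ ((-μ : ℝ) : ℂ) * (z + q) ^ ((-μ - 1 : ℝ) : ℂ)))

lemma hasDerivAt_branchKernel (μ : ℝ) (s : ℂ) {p q z : ℂ} (hp : z + p ∈ Complex.slitPlane)
    (hq : z + q ∈ Complex.slitPlane) :
    HasDerivAt (branchKernel μ s p q) (branchKernelDeriv μ s p q z) z := by
  have h1 : HasDerivAt (fun z => Complex.exp (-(s * z))) (Complex.exp (-(s * z)) * -s) z := by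
    have := ((hasDerivAt_id z).const_mul s).neg.cexp
    simpa using this
  have h2 := ((hasDerivAt_id z).add_const p).cpow_const (c := ((-μ : ℝ) : ℂ)) hp
  have h3 := ((hasDerivAt_id z).add_const q).cpow_const (c := ((-μ : ℝ) : ℂ)) hq
  refine (h1.mul (h2.mul h3)).congr_deriv ?_
  unfold branchKernelDeriv
  simp only [id, Pi.mul_apply]
  push_cast
  ring

lemma norm_branchKernel_le {μ : ℝ} (h0 : 0 ≤ μ) (s : ℂ) {p q z : ℂ} {c d E : ℝ} (hc : 0 < c)
    (hd : 0 < d) (hp : c ≤ ‖z + p‖) (hq : d ≤ ‖z + q‖) (hE : -(s * z).re ≤ E) :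
    ‖branchKernel μ s p q z‖ ≤ Real.exp E * (c ^ (-μ) * d ^ (-μ)) := by
  unfold branchKernel
  rw [norm_mul, norm_mul, Complex.norm_exp, Complex.neg_re]
  have h1 := norm_cpow_le_of_le_of_nonpos hc hp (show -μ ≤ 0 by linarith)
  have h2 := norm_cpow_le_of_le_of_nonpos hd hq (show -μ ≤ 0 by linarith)
  gcongr

lemma norm_branchKernelDeriv_le {μ : ℝ} (h0 : 0 ≤ μ) (s : ℂ) {p q z : ℂ} {c d E : ℝ} (hc : 0 < c)
    (hd : 0 < d) (hp : c ≤ ‖z + p‖) (hq : d ≤ ‖z + q‖) (hE : -(s * z).re ≤ E) :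
    ‖branchKernelDeriv μ s p q z‖ ≤ Real.exp E * (‖s‖ * (c ^ (-μ) * d ^ (-μ)) +
      μ * (c ^ (-μ - 1) * d ^ (-μ)) + μ * (c ^ (-μ) * d ^ (-μ - 1))) := by
  unfold branchKernelDeriv
  rw [norm_mul, Complex.norm_exp, Complex.neg_re]
  have h1 := norm_cpow_le_of_le_of_nonpos hc hp (show -μ ≤ 0 by linarith)
  have h2 := norm_cpow_le_of_le_of_nonpos hd hq (show -μ ≤ 0 by linarith)
  have h3 := norm_cpow_le_of_le_of_nonpos hc hp (show -μ - 1 ≤ 0 by linarith)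
  have h4 := norm_cpow_le_of_le_of_nonpos hd hq (show -μ - 1 ≤ 0 by linarith)
  have hμ : ‖(-μ : ℂ)‖ = μ := by rw [norm_neg, Complex.norm_real, Real.norm_of_nonneg h0]
  refine mul_le_mul (Real.exp_le_exp.2 hE) ?_ (norm_nonneg _) (Real.exp_nonneg _)
  refine (norm_add₃_le).trans ?_
  simp only [norm_mul, hμ, norm_neg]
  gcongr

lemma measurable_branchKernel (μ : ℝ) (s p q : ℂ) : Measurable (branchKernel μ s p q) := by
  unfold branchKernel; fun_prop

lemma measurable_branchKernelDeriv (μ : ℝ) (s p q : ℂ) :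
    Measurable (branchKernelDeriv μ s p q) := by
  unfold branchKernelDeriv; fun_prop

lemma integrableOn_exp_neg_mul_mul_rpow {m p : ℝ} (hm : 0 < m) (hp : -1 < p) :
    MeasureTheory.IntegrableOn (fun x : ℝ => Real.exp (-(m * x)) * x ^ p) (Set.Ioi 0) := by
  have := integrableOn_rpow_mul_exp_neg_mul_rpow (s := p) (p := 1) (b := m) hp one_pos hm
  refine this.congr_fun (fun x _ => ?_) measurableSet_Ioi
  simp only [Real.rpow_one, neg_mul]
  ring

lemma tendsto_exp_neg_mul_mul_rpow {m : ℝ} (hm : 0 < m) (p : ℝ) :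
    Tendsto (fun x : ℝ => Real.exp (-(m * x)) * x ^ p) atTop (𝓝 0) := by
  have := tendsto_rpow_mul_exp_neg_mul_atTop_nhds_zero p m hm
  refine this.congr fun x => ?_
  rw [neg_mul, mul_comm]

/-- Rotation of the ray of integration in the Laplace integral. -/
theorem integral_branchKernel_ray {μ : ℝ} (h0 : 0 ≤ μ) (h1 : μ < 1) {s w : ℂ} (hs : 0 < s.re)
    {d : ℝ} (hd : 0 < d)
    (hslit : ∀ τ ∈ Set.Icc (0 : ℝ) 1, ∀ x : ℝ, 0 ≤ x →
      (1 + τ * (s - 1)) * x + w ∈ Complex.slitPlane)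
    (hdist : ∀ τ ∈ Set.Icc (0 : ℝ) 1, ∀ x : ℝ, 0 ≤ x → d ≤ ‖(1 + τ * (s - 1)) * x + w‖) :
    ∫ x in Set.Ioi (0 : ℝ), s * branchKernel μ 1 0 w (s * x) =
      ∫ x in Set.Ioi (0 : ℝ), branchKernel μ 1 0 w x := by
  -- The direction of the ray runs along the segment from `1` to `s`. Its real part stays at least
  -- `min(1, Re s)`, which keeps uniform exponential decay.
  set c : ℝ → ℂ := fun τ => 1 + τ * (s - 1) with hc
  set m : ℝ := min 1 s.re with hm
  have hm0 : 0 < m := lt_min one_pos hs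
  have hcre : ∀ τ ∈ Set.Icc (0 : ℝ) 1, m ≤ (c τ).re := by
    intro τ hτ
    have e : (c τ).re = (1 - τ) * 1 + τ * s.re := by simp [hc]; ring
    rw [e]
    have a1 : m ≤ 1 := min_le_left _ _
    have a2 : m ≤ s.re := min_le_right _ _
    nlinarith [hτ.1, hτ.2]
  set M : ℝ := 1 + ‖s - 1‖ with hM
  have hcM : ∀ τ ∈ Set.Icc (0 : ℝ) 1, ‖c τ‖ ≤ M := by
    intro τ hτ
    refine (norm_add_le _ _).trans ?_
    rw [norm_one, norm_mul, Complex.norm_real, Real.norm_of_nonneg hτ.1, hM]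
    have := mul_le_of_le_one_left (norm_nonneg (s - 1)) hτ.2
    linarith
  have hcslit : ∀ τ ∈ Set.Icc (0 : ℝ) 1, ∀ x : ℝ, 0 < x → c τ * x + 0 ∈ Complex.slitPlane := by
    intro τ hτ x hx
    rw [add_zero, Complex.mem_slitPlane_iff]
    left
    simp only [Complex.re_mul_ofReal]
    exact mul_pos (hm0.trans_le (hcre τ hτ)) hx
  have hlow : ∀ τ ∈ Set.Icc (0 : ℝ) 1, ∀ x : ℝ, 0 < x → m * x ≤ ‖c τ * x + 0‖ := by
    intro τ hτ x hx
    rw [add_zero]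
    refine le_trans ?_ (Complex.re_le_norm _)
    rw [Complex.re_mul_ofReal]
    exact mul_le_mul_of_nonneg_right (hcre τ hτ) hx.le
  have hexp : ∀ τ ∈ Set.Icc (0 : ℝ) 1, ∀ x : ℝ, 0 < x → -(1 * (c τ * x)).re ≤ -(m * x) := by
    intro τ hτ x hx
    rw [one_mul, Complex.re_mul_ofReal]
    exact neg_le_neg (mul_le_mul_of_nonneg_right (hcre τ hτ) hx.le)
  have hder : ∀ τ ∈ Set.Icc (0 : ℝ) 1, ∀ x : ℝ, 0 < x → HasDerivAt (branchKernel μ 1 0 w)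
      (branchKernelDeriv μ 1 0 w (c τ * x)) (c τ * x) := fun τ hτ x hx =>
    hasDerivAt_branchKernel μ 1 (hcslit τ hτ x hx) (hslit τ hτ x hx.le)
  have hK : ∀ τ ∈ Set.Icc (0 : ℝ) 1, ∀ x : ℝ, 0 < x → ‖branchKernel μ 1 0 w (c τ * x)‖ ≤
      Real.exp (-(m * x)) * ((m * x) ^ (-μ) * d ^ (-μ)) := fun τ hτ x hx =>
    norm_branchKernel_le h0 1 (mul_pos hm0 hx) hd (hlow τ hτ x hx) (hdist τ hτ x hx.le)
      (hexp τ hτ x hx)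
  have hK' : ∀ τ ∈ Set.Icc (0 : ℝ) 1, ∀ x : ℝ, 0 < x → ‖branchKernelDeriv μ 1 0 w (c τ * x)‖ ≤ _ :=
    fun τ hτ x hx => norm_branchKernelDeriv_le h0 1 (mul_pos hm0 hx) hd (hlow τ hτ x hx)
      (hdist τ hτ x hx.le) (hexp τ hτ x hx)
  have hcd : ∀ τ : ℝ, HasDerivAt c (s - 1) τ := by
    intro τ
    exact (((Complex.ofRealCLM.hasDerivAt (x := τ)).mul_const (s - 1)).const_add 1).congr_deriv
      (by simp)
  have hcx : ∀ x τ : ℝ, HasDerivAt (fun τ => c τ * (x : ℂ)) ((s - 1) * x) τ := fun x τ =>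
    (hcd τ).mul_const _
  have hcx' : ∀ τ x : ℝ, HasDerivAt (fun x : ℝ => c τ * (x : ℂ)) (c τ) x := fun τ x => by
    simpa using (Complex.ofRealCLM.hasDerivAt (x := x)).const_mul (c τ)
  have hint : MeasureTheory.IntegrableOn (fun x : ℝ =>
      Real.exp (-(m * x)) * ((m * x) ^ (-μ) * d ^ (-μ))) (Set.Ioi 0) := by
    have := (integrableOn_exp_neg_mul_mul_rpow hm0 (show -1 < -μ by linarith)).mul_const
      (m ^ (-μ) * d ^ (-μ))
    refine MeasureTheory.IntegrableOn.congr_fun this (fun x hx => ?_) measurableSet_Ioi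
    rw [Real.mul_rpow hm0.le (le_of_lt hx)]
    ring
  have hmeas := measurable_branchKernel μ 1 0 w
  have hmeas' := measurable_branchKernelDeriv μ 1 0 w
  have h01 : (0 : ℝ) ∈ Set.Icc (0 : ℝ) 1 := ⟨le_rfl, zero_le_one⟩
  have h11 : (1 : ℝ) ∈ Set.Icc (0 : ℝ) 1 := ⟨zero_le_one, le_rfl⟩
  have hIA : ∀ τ ∈ Set.Icc (0 : ℝ) 1, MeasureTheory.IntegrableOn
      (fun x : ℝ => c τ * branchKernel μ 1 0 w (c τ * x)) (Set.Ioi 0) := by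
    intro τ hτ
    refine MeasureTheory.Integrable.const_mul (MeasureTheory.Integrable.mono' hint
      (Measurable.aestronglyMeasurable (hmeas.comp (by fun_prop))) ?_) _
    filter_upwards [MeasureTheory.ae_restrict_mem measurableSet_Ioi] with x hx
    exact hK τ hτ x hx
  -- With `g` the kernel, `c g(cx)` differentiated in `τ` and `(s-1) x g(cx)` differentiated in `x`
  -- both equal `(s-1)(g + c x g')` at `cx`. Because of the factor `x`, the boundary term at `x = 0`
  -- vanishes.
  have key := integral_Ioi_sub_eq_of_homotopy
    (A := fun τ x => c τ * branchKernel μ 1 0 w (c τ * x))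
    (B := fun τ x => (s - 1) * (x * branchKernel μ 1 0 w (c τ * x)))
    (D := fun τ x => (s - 1) * (branchKernel μ 1 0 w (c τ * x) +
      c τ * x * branchKernelDeriv μ 1 0 w (c τ * x))) ?_ ?_ ?_ ?_ ?_ ?_ (hIA 0 h01) (hIA 1 h11)
  · simp only [hc] at key
    simpa [sub_eq_zero] using key
  · intro x hx τ hτ
    have := (hcd τ).mul ((hder τ hτ x hx).comp τ (hcx x τ))
    exact this.continuousAt.continuousWithinAt
  · intro x hx τ hτ
    refine ((hcd τ).mul ((hder τ (Set.Ioo_subset_Icc_self hτ) x hx).comp τ (hcx x τ))).congr_deriv ?_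
    simp only [Function.comp_apply]
    ring
  · intro τ hτ
    have hτ' := Set.Ioo_subset_Icc_self hτ
    -- The kernel is `O(x^{-μ})` at the vertex, so the product is `O(x^{1-μ})`, and `μ < 1`.
    have hlim : Tendsto (fun x : ℝ => (s - 1) * (x * branchKernel μ 1 0 w (c τ * x)))
        (𝓝[≥] 0) (𝓝 0) := by
      have hb : Tendsto (fun x : ℝ => ‖s - 1‖ * ((m ^ (-μ) * d ^ (-μ)) * x ^ (1 - μ)))
          (𝓝[≥] 0) (𝓝 0) := by
        have := (Real.continuousAt_rpow_const 0 (1 - μ) (Or.inr (by linarith))).tendsto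
        rw [Real.zero_rpow (by linarith)] at this
        have h3 := ((this.const_mul (m ^ (-μ) * d ^ (-μ))).const_mul ‖s - 1‖).mono_left
          (nhdsWithin_le_nhds (s := Set.Ici (0 : ℝ)))
        simpa using h3
      refine squeeze_zero_norm' ?_ hb
      filter_upwards [self_mem_nhdsWithin] with x hx
      rcases (Set.mem_Ici.1 hx).eq_or_lt with h | h
      · subst h
        simp
        positivity
      · rw [norm_mul, norm_mul, Complex.norm_real, Real.norm_of_nonneg h.le]
        have h2 := hK τ hτ' x h
        have h3 : Real.exp (-(m * x)) ≤ 1 := Real.exp_le_one_iff.2 (by nlinarith)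
        have h4 : x ^ (1 - μ) = x * x ^ (-μ) := by
          rw [sub_eq_add_neg, Real.rpow_add h, Real.rpow_one]
        calc ‖s - 1‖ * (x * ‖branchKernel μ 1 0 w (c τ * x)‖)
            ≤ ‖s - 1‖ * (x * (1 * ((m * x) ^ (-μ) * d ^ (-μ)))) := by
              gcongr
              refine h2.trans ?_
              gcongr
          _ = _ := by
            rw [h4, Real.mul_rpow hm0.le h.le]; ring
    unfold ContinuousWithinAt
    simpa using hlim
  · intro τ hτ x hx
    have hτ' := Set.Ioo_subset_Icc_self hτ
    have h2 := ((Complex.ofRealCLM.hasDerivAt (x := x)).mul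
      ((hder τ hτ' x hx).comp x (hcx' τ x))).const_mul (s - 1)
    refine h2.congr_deriv ?_
    simp only [Complex.ofRealCLM_apply, Complex.ofReal_one, Function.comp_apply, one_mul]
    ring
  · intro τ hτ
    have hτ' := Set.Ioo_subset_Icc_self hτ
    have hb := ((tendsto_exp_neg_mul_mul_rpow hm0 (1 - μ)).const_mul
      (m ^ (-μ) * d ^ (-μ))).const_mul ‖s - 1‖
    rw [mul_zero, mul_zero] at hb
    refine squeeze_zero_norm' ?_ hb
    filter_upwards [eventually_gt_atTop 0] with x hx
    rw [norm_mul, norm_mul, Complex.norm_real, Real.norm_of_nonneg hx.le]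
    have h4 : x ^ (1 - μ) = x * x ^ (-μ) := by
      rw [sub_eq_add_neg, Real.rpow_add hx, Real.rpow_one]
    calc ‖s - 1‖ * (x * ‖branchKernel μ 1 0 w (c τ * x)‖)
        ≤ ‖s - 1‖ * (x * (Real.exp (-(m * x)) * ((m * x) ^ (-μ) * d ^ (-μ)))) := by
          have h2 := hK τ hτ' x hx
          gcongr
      _ = _ := by
        rw [h4, Real.mul_rpow hm0.le hx.le]; ring
  · set C1 := ‖s - 1‖ * (m ^ (-μ) * (d ^ (-μ) + M * μ * m⁻¹ * d ^ (-μ)))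
    set C2 := ‖s - 1‖ * (m ^ (-μ) * (M * d ^ (-μ) + M * μ * d ^ (-μ - 1)))
    have hb : MeasureTheory.IntegrableOn (fun x : ℝ => C1 * (Real.exp (-(m * x)) * x ^ (-μ)) +
        C2 * (Real.exp (-(m * x)) * x ^ (1 - μ))) (Set.Ioi 0) :=
      ((integrableOn_exp_neg_mul_mul_rpow hm0 (by linarith)).const_mul _).add
        ((integrableOn_exp_neg_mul_mul_rpow hm0 (by linarith)).const_mul _)
    have hone : MeasureTheory.Integrable (fun _ : ℝ => (1 : ℝ))
        (MeasureTheory.volume.restrict (Set.Ioo (0 : ℝ) 1)) := by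
      exact MeasureTheory.integrable_const _
    refine MeasureTheory.Integrable.mono' (hone.mul_prod hb) ?_ ?_
    · refine Measurable.aestronglyMeasurable ?_
      simp only [Function.uncurry_def]
      have e1 : Measurable fun p : ℝ × ℝ => c p.1 * (p.2 : ℂ) := by fun_prop
      exact measurable_const.mul ((hmeas.comp e1).add (e1.mul (hmeas'.comp e1)))
    · rw [MeasureTheory.Measure.prod_restrict]
      filter_upwards [MeasureTheory.ae_restrict_mem
        (measurableSet_Ioo.prod measurableSet_Ioi)] with p hp
      obtain ⟨τ, x⟩ := p
      have hτ' := Set.Ioo_subset_Icc_self hp.1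
      have hx : (0 : ℝ) < x := hp.2
      have k1 := hK τ hτ' x hx
      have k2 := hK' τ hτ' x hx
      have h4 : x ^ (1 - μ) = x * x ^ (-μ) := by
        rw [sub_eq_add_neg, Real.rpow_add hx, Real.rpow_one]
      simp only [Function.uncurry_def, one_mul]
      rw [norm_mul]
      have hM0 : 0 ≤ M := by positivity
      calc ‖s - 1‖ * ‖branchKernel μ 1 0 w (c τ * x) + c τ * x * branchKernelDeriv μ 1 0 w (c τ * x)‖
          ≤ ‖s - 1‖ * (‖branchKernel μ 1 0 w (c τ * x)‖ +
            M * x * ‖branchKernelDeriv μ 1 0 w (c τ * x)‖) := by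
            gcongr
            refine (norm_add_le _ _).trans ?_
            rw [norm_mul, norm_mul, Complex.norm_real, Real.norm_of_nonneg hx.le]
            gcongr
            exact hcM τ hτ'
        _ ≤ ‖s - 1‖ * (Real.exp (-(m * x)) * ((m * x) ^ (-μ) * d ^ (-μ)) +
            M * x * (Real.exp (-(m * x)) * (‖(1 : ℂ)‖ * ((m * x) ^ (-μ) * d ^ (-μ)) +
              μ * ((m * x) ^ (-μ - 1) * d ^ (-μ)) + μ * ((m * x) ^ (-μ) * d ^ (-μ - 1))))) := by
            gcongr
        _ = _ := by
          rw [h4, Real.rpow_sub_one (mul_pos hm0 hx).ne', Real.mul_rpow hm0.le hx.le, norm_one]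
          simp only [C1, C2]
          field_simp
          ring

/-! ### Shifting the ray to the branch point `ia`. -/

lemma Complex.mul_cpow_of_im_neg_of_im_pos {x y : ℂ} (hx : x.im < 0) (hy : 0 < y.im) (c : ℂ) :
    (x * y) ^ c = x ^ c * y ^ c := by
  refine Complex.mul_cpow_of_arg_add_mem (by rintro rfl; simp at hx) (by rintro rfl; simp at hy)
    ?_ c
  have h1 := Complex.arg_neg_iff.2 hx
  have h2 := Complex.arg_nonneg_iff.2 hy.le
  have h3 := Complex.neg_pi_lt_arg x
  have h4 := Complex.arg_le_pi y
  constructor <;> linarith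

/-- The difference of the two sides is exactly `(x - t|w|)²`. This bounds the distance to the branch
point by the geometric mean of `x` and `t`. -/
lemma sq_mul_le_norm_add_mul_sq (w : ℂ) (x t : ℝ) :
    2 * (‖w‖ + w.re) * (x * t) ≤ ‖x + t * w‖ ^ 2 := by
  have h1 : ‖x + t * w‖ ^ 2 = x ^ 2 + 2 * (x * t) * w.re + t ^ 2 * ‖w‖ ^ 2 := by
    rw [← Complex.normSq_eq_norm_sq, ← Complex.normSq_eq_norm_sq, Complex.normSq_apply,
      Complex.normSq_apply]
    simp
    ring
  rw [h1]
  nlinarith [sq_nonneg (x - t * ‖w‖)]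

lemma abs_im_lt_norm_of_re_pos {a : ℂ} (ha : 0 < a.re) : |a.im| < ‖a‖ :=
  Complex.abs_im_lt_norm.2 ha.ne'

lemma integrableOn_one_sub_rpow {p : ℝ} (hp : -1 < p) :
    MeasureTheory.IntegrableOn (fun t : ℝ => (1 - t) ^ p) (Set.Ioo 0 1) := by
  have h := (intervalIntegral.intervalIntegrable_rpow' (a := 0) (b := 1) hp).comp_sub_left 1
  rw [sub_zero, sub_self] at h
  rw [← intervalIntegrable_iff_integrableOn_Ioo_of_le zero_le_one]
  exact h.symm

/-- Shifting the ray `[0, ∞)` to the ray from the branch point `ia`. -/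
theorem integral_branchKernel_shift {μ : ℝ} (h0 : 0 ≤ μ) (h1 : μ < 1) {s a : ℂ} (hs : 0 < s.re)
    (ha : 0 < a.re) :
    MeasureTheory.IntegrableOn
      (fun x : ℝ => branchKernel μ s (-(Complex.I * a)) (Complex.I * a) x) (Set.Ioi 0) ∧
    ∫ x in Set.Ioi (0 : ℝ), branchKernel μ s (-(Complex.I * a)) (Complex.I * a) x =
      (∫ x in Set.Ioi (0 : ℝ),
        branchKernel μ s (-(Complex.I * a)) (Complex.I * a) (Complex.I * a + x)) +
      Complex.I * a * ∫ τ in Set.Ioo (0 : ℝ) 1,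
        branchKernel μ s (-(Complex.I * a)) (Complex.I * a) (Complex.I * a * τ) := by
  set b : ℂ := Complex.I * a with hb
  have hbre : b.re = -a.im := by simp [hb]
  have hbim : b.im = a.re := by simp [hb]
  have hbn : ‖b‖ = ‖a‖ := by simp [hb]
  set σ := s.re
  set M : ℝ := ‖s‖ * ‖b‖ with hM
  -- The distance from `bτ + x` to `b` is at least `κ √(x(1-τ))`, with `κ > 0` because `b = ia` is
  -- not a positive real. The derivative of the kernel is then `O((x(1-τ))^{-(μ+1)/2})` at the
  -- corner `x = 0`, `τ = 1`, which is integrable in each variable precisely because `μ < 1`.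
  set κ : ℝ := √(2 * (‖b‖ - b.re)) with hκ
  have hgap : 0 < 2 * (‖b‖ - b.re) := by
    have := abs_im_lt_norm_of_re_pos ha
    have := (abs_lt.1 this).1
    rw [hbn, hbre]; linarith
  have hκ0 : 0 < κ := Real.sqrt_pos.2 hgap
  set z : ℝ → ℝ → ℂ := fun τ x => b * τ + x with hz
  have hslit : ∀ τ ∈ Set.Icc (0 : ℝ) 1, ∀ x : ℝ, 0 ≤ x → (0 < x ∨ τ < 1) →
      z τ x + -b ∈ Complex.slitPlane := by
    intro τ hτ x hx h
    rw [Complex.mem_slitPlane_iff]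
    by_cases hτ1 : τ = 1
    · left
      subst hτ1
      have hx' : 0 < x := by
        rcases h with h | h
        · exact h
        · exact absurd h (lt_irrefl _)
      simpa [hz] using hx'
    · right
      have hlt : τ < 1 := lt_of_le_of_ne hτ.2 hτ1
      have e : (z τ x + -b).im = -(a.re * (1 - τ)) := by
        simp [hz, hbim]; ring
      rw [e]
      have : 0 < a.re * (1 - τ) := mul_pos ha (by linarith)
      linarith
  have him : ∀ τ ∈ Set.Icc (0 : ℝ) 1, ∀ x : ℝ, (z τ x + b).im = a.re * (1 + τ) := by
    intro τ _ x
    simp [hz, hbim]; ring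
  have hslit2 : ∀ τ ∈ Set.Icc (0 : ℝ) 1, ∀ x : ℝ, z τ x + b ∈ Complex.slitPlane := by
    intro τ hτ x
    rw [Complex.mem_slitPlane_iff]
    right
    rw [him τ hτ x]
    have : 0 < a.re * (1 + τ) := mul_pos ha (by linarith [hτ.1])
    exact this.ne'
  have hlow2 : ∀ τ ∈ Set.Icc (0 : ℝ) 1, ∀ x : ℝ, a.re ≤ ‖z τ x + b‖ := by
    intro τ hτ x
    refine le_trans ?_ ((le_abs_self _).trans (Complex.abs_im_le_norm _))
    rw [him τ hτ x]
    nlinarith [hτ.1]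
  have hlow : ∀ τ ∈ Set.Icc (0 : ℝ) 1, ∀ x : ℝ, 0 ≤ x →
      κ * (x * (1 - τ)) ^ (1 / 2 : ℝ) ≤ ‖z τ x + -b‖ := by
    intro τ hτ x hx
    have h := sq_mul_le_norm_add_mul_sq (-b) x (1 - τ)
    have e : (x : ℂ) + ((1 - τ : ℝ) : ℂ) * -b = z τ x + -b := by
      simp only [hz]; push_cast; ring
    rw [e, norm_neg, Complex.neg_re, ← sub_eq_add_neg] at h
    rw [← Real.sqrt_eq_rpow, hκ, ← Real.sqrt_mul hgap.le]
    exact Real.sqrt_le_iff.2 ⟨norm_nonneg _, h⟩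
  have hexp : ∀ τ ∈ Set.Icc (0 : ℝ) 1, ∀ x : ℝ, -(s * z τ x).re ≤ M + -(σ * x) := by
    intro τ hτ x
    have e : (s * z τ x).re = τ * (s * b).re + σ * x := by
      simp [hz, σ]; ring
    have h2 : |(s * b).re| ≤ M := by
      rw [hM, ← norm_mul]; exact Complex.abs_re_le_norm _
    have h3 : τ * |(s * b).re| ≤ |(s * b).re| := mul_le_of_le_one_left (abs_nonneg _) hτ.2
    have h4 : -(τ * (s * b).re) ≤ τ * |(s * b).re| := by
      have := mul_le_mul_of_nonneg_left (neg_abs_le (s * b).re) hτ.1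
      linarith
    rw [e]
    linarith
  have hder : ∀ τ ∈ Set.Icc (0 : ℝ) 1, ∀ x : ℝ, 0 ≤ x → (0 < x ∨ τ < 1) →
      HasDerivAt (branchKernel μ s (-b) b) (branchKernelDeriv μ s (-b) b (z τ x)) (z τ x) :=
    fun τ hτ x hx h => hasDerivAt_branchKernel μ s (hslit τ hτ x hx h) (hslit2 τ hτ x)
  have hroot : ∀ τ x p : ℝ, 0 < x → τ < 1 → (κ * (x * (1 - τ)) ^ (1 / 2 : ℝ)) ^ p =
      κ ^ p * (x ^ (p / 2) * (1 - τ) ^ (p / 2)) := by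
    intro τ x p hx hτ
    have ht : 0 < 1 - τ := by linarith
    rw [Real.mul_rpow hκ0.le (by positivity), ← Real.rpow_mul (by positivity),
      Real.mul_rpow hx.le ht.le, one_div_mul_eq_div]
  have hK : ∀ τ ∈ Set.Ico (0 : ℝ) 1, ∀ x : ℝ, 0 < x → ‖branchKernel μ s (-b) b (z τ x)‖ ≤
      Real.exp (M + -(σ * x)) *
        (κ ^ (-μ) * (x ^ (-μ / 2) * (1 - τ) ^ (-μ / 2)) * a.re ^ (-μ)) := by
    intro τ hτ x hx
    have hτ' := Set.Ico_subset_Icc_self hτ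
    have ht : 0 < 1 - τ := by linarith [hτ.2]
    rw [← hroot τ x (-μ) hx hτ.2]
    exact norm_branchKernel_le h0 s (by positivity) ha (hlow τ hτ' x hx.le) (hlow2 τ hτ' x)
      (hexp τ hτ' x)
  have hK' : ∀ τ ∈ Set.Ico (0 : ℝ) 1, ∀ x : ℝ, 0 < x → ‖branchKernelDeriv μ s (-b) b (z τ x)‖ ≤ _ :=
    fun τ hτ x hx => norm_branchKernelDeriv_le h0 s
      (mul_pos hκ0 (Real.rpow_pos_of_pos (mul_pos hx (sub_pos.2 hτ.2)) _)) ha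
      (hlow τ (Set.Ico_subset_Icc_self hτ) x hx.le) (hlow2 τ (Set.Ico_subset_Icc_self hτ) x)
      (hexp τ (Set.Ico_subset_Icc_self hτ) x)
  -- The bound through `κ` degenerates at `τ = 1`, but there the distance to the branch point is `x`
  -- itself.
  have hK1 : ∀ x : ℝ, 0 < x → ‖branchKernel μ s (-b) b (z 1 x)‖ ≤
      Real.exp (M + -(σ * x)) * (x ^ (-μ) * a.re ^ (-μ)) := by
    intro x hx
    refine norm_branchKernel_le h0 s hx ha ?_ (hlow2 1 ⟨zero_le_one, le_rfl⟩ x)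
      (hexp 1 ⟨zero_le_one, le_rfl⟩ x)
    simp only [hz, Complex.ofReal_one, mul_one]
    rw [add_neg_cancel_comm, Complex.norm_real]
    exact le_abs_self x
  have hzτ : ∀ x τ : ℝ, HasDerivAt (fun τ => z τ x) b τ := fun x τ =>
    (((Complex.ofRealCLM.hasDerivAt (x := τ)).const_mul b).add_const (x : ℂ)).congr_deriv (by simp)
  have hzx : ∀ τ x : ℝ, HasDerivAt (fun x => z τ x) 1 x := fun τ x =>
    ((Complex.ofRealCLM.hasDerivAt (x := x)).const_add (b * τ)).congr_deriv (by simp)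
  have hmeas := measurable_branchKernel μ s (-b) b
  have hmeas' := measurable_branchKernelDeriv μ s (-b) b
  have hI0 : MeasureTheory.IntegrableOn (fun x : ℝ => branchKernel μ s (-b) b (z 0 x))
      (Set.Ioi 0) := by
    refine MeasureTheory.Integrable.mono'
      ((integrableOn_exp_neg_mul_mul_rpow hs (show -1 < -μ / 2 by linarith)).const_mul
        (Real.exp M * κ ^ (-μ) * a.re ^ (-μ)))
      (Measurable.aestronglyMeasurable (hmeas.comp (by fun_prop))) ?_
    filter_upwards [MeasureTheory.ae_restrict_mem measurableSet_Ioi] with x hx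
    refine (hK 0 ⟨le_rfl, zero_lt_one⟩ x hx).trans_eq ?_
    rw [sub_zero, Real.one_rpow, Real.exp_add]
    ring
  have hI1 : MeasureTheory.IntegrableOn (fun x : ℝ => branchKernel μ s (-b) b (z 1 x))
      (Set.Ioi 0) := by
    refine MeasureTheory.Integrable.mono'
      ((integrableOn_exp_neg_mul_mul_rpow hs (show -1 < -μ by linarith)).const_mul
        (Real.exp M * a.re ^ (-μ)))
      (Measurable.aestronglyMeasurable (hmeas.comp (by fun_prop))) ?_
    filter_upwards [MeasureTheory.ae_restrict_mem measurableSet_Ioi] with x hx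
    refine (hK1 x hx).trans_eq ?_
    rw [Real.exp_add]
    ring
  have key := integral_Ioi_sub_eq_of_homotopy
    (A := fun τ x => branchKernel μ s (-b) b (z τ x))
    (B := fun τ x => b * branchKernel μ s (-b) b (z τ x))
    (D := fun τ x => b * branchKernelDeriv μ s (-b) b (z τ x)) ?_ ?_ ?_ ?_ ?_ ?_ hI0 hI1
  · rw [MeasureTheory.integral_const_mul] at key
    simp only [hz, Complex.ofReal_zero, mul_zero, zero_add, add_zero, Complex.ofReal_one,
      mul_one] at key hI0
    exact ⟨hI0, by linear_combination -key⟩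
  · intro x hx τ hτ
    exact ((hder τ hτ x hx.le (Or.inl hx)).comp τ (hzτ x τ)).continuousAt.continuousWithinAt
  · intro x hx τ hτ
    refine ((hder τ (Set.Ioo_subset_Icc_self hτ) x hx.le (Or.inl hx)).comp τ
      (hzτ x τ)).congr_deriv ?_
    ring
  · intro τ hτ
    exact (((hder τ (Set.Ioo_subset_Icc_self hτ) 0 le_rfl (Or.inr hτ.2)).comp (0 : ℝ)
      (hzx τ 0)).const_mul b).continuousAt.continuousWithinAt
  · intro τ hτ x hx
    refine (((hder τ (Set.Ioo_subset_Icc_self hτ) x hx.le (Or.inl hx)).comp x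
      (hzx τ x)).const_mul b).congr_deriv ?_
    ring
  · intro τ hτ
    have hlim := (tendsto_exp_neg_mul_mul_rpow hs (-μ / 2)).const_mul
      (‖b‖ * (Real.exp M * κ ^ (-μ) * (1 - τ) ^ (-μ / 2) * a.re ^ (-μ)))
    rw [mul_zero] at hlim
    refine squeeze_zero_norm' ?_ hlim
    filter_upwards [eventually_gt_atTop 0] with x hx
    rw [norm_mul, mul_assoc]
    refine mul_le_mul_of_nonneg_left ?_ (norm_nonneg b)
    refine (hK τ (Set.Ioo_subset_Ico_self hτ) x hx).trans_eq ?_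
    rw [Real.exp_add]
    ring
  · set C1 := ‖b‖ * (Real.exp M * (‖s‖ * (κ ^ (-μ) * a.re ^ (-μ)) +
      μ * (κ ^ (-μ) * a.re ^ (-μ - 1))))
    set C2 := ‖b‖ * (Real.exp M * (μ * (κ ^ (-μ - 1) * a.re ^ (-μ))))
    have i1 := (integrableOn_one_sub_rpow (show -1 < -μ / 2 by linarith)).mul_prod
      ((integrableOn_exp_neg_mul_mul_rpow hs (show -1 < -μ / 2 by linarith)).const_mul C1)
    have i2 := (integrableOn_one_sub_rpow (show -1 < (-μ - 1) / 2 by linarith)).mul_prod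
      ((integrableOn_exp_neg_mul_mul_rpow hs (show -1 < (-μ - 1) / 2 by linarith)).const_mul C2)
    refine MeasureTheory.Integrable.mono' (i1.add i2) ?_ ?_
    · refine Measurable.aestronglyMeasurable ?_
      simp only [Function.uncurry_def]
      have e1 : Measurable fun p : ℝ × ℝ => z p.1 p.2 := by
        simp only [hz]; fun_prop
      exact measurable_const.mul (hmeas'.comp e1)
    · rw [MeasureTheory.Measure.prod_restrict]
      filter_upwards [MeasureTheory.ae_restrict_mem
        (measurableSet_Ioo.prod measurableSet_Ioi)] with p hp
      obtain ⟨τ, x⟩ := p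
      have hx : (0 : ℝ) < x := hp.2
      have k2 := hK' τ (Set.Ioo_subset_Ico_self hp.1) x hx
      rw [hroot τ x _ hx hp.1.2, hroot τ x _ hx hp.1.2] at k2
      simp only [Function.uncurry_def, Pi.add_apply]
      rw [norm_mul]
      refine (mul_le_mul_of_nonneg_left k2 (norm_nonneg b)).trans_eq ?_
      rw [Real.exp_add]
      simp only [C1, C2]
      ring

/-! ### The kernel on the pieces of the contour, and the Laplace transform of `(x² + a²)^{-μ}`. -/

lemma mul_sub_mul_add_eq_sq_add_sq (a x : ℂ) :
    (x + -(Complex.I * a)) * (x + Complex.I * a) = x ^ 2 + a ^ 2 := by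
  linear_combination (-a ^ 2) * Complex.I_sq

/-- For real `x` the points `x - ia` and `x + ia` lie in opposite half-planes, so their principal
powers multiply to that of `x² + a²`. -/
lemma branchKernel_ofReal (μ : ℝ) (s : ℂ) {a : ℂ} (ha : 0 < a.re) (x : ℝ) :
    branchKernel μ s (-(Complex.I * a)) (Complex.I * a) x =
      Complex.exp (-(s * x)) * ((x : ℂ) ^ 2 + a ^ 2) ^ ((-μ : ℝ) : ℂ) := by
  unfold branchKernel
  rw [← Complex.mul_cpow_of_im_neg_of_im_pos (by simpa using ha) (by simpa using ha),
    mul_sub_mul_add_eq_sq_add_sq]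

lemma Complex.mul_cpow_of_re_pos {x y : ℂ} (hx : 0 < x.re) (hy : 0 < y.re) (c : ℂ) :
    (x * y) ^ c = x ^ c * y ^ c := by
  refine Complex.mul_cpow_of_arg_add_mem (by rintro rfl; simp at hx) (by rintro rfl; simp at hy)
    ?_ c
  have h1 := abs_lt.1 (Complex.abs_arg_lt_pi_div_two_iff.2 (Or.inl hx))
  have h2 := abs_lt.1 (Complex.abs_arg_lt_pi_div_two_iff.2 (Or.inl hy))
  constructor <;> linarith

lemma sq_cpow_neg {a : ℂ} (ha : 0 < a.re) (μ : ℝ) :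
    (a ^ 2) ^ ((-μ : ℝ) : ℂ) = a ^ (-2 * μ : ℂ) := by
  have ha0 : a ≠ 0 := by rintro rfl; simp at ha
  rw [sq, Complex.mul_cpow_of_re_pos ha ha, ← Complex.cpow_add _ _ ha0]
  congr 1
  push_cast
  ring

/-- On the segment the two factors are the positive multiples `1 - t` of `-ia` and `1 + t` of `ia`,
and the powers of `-ia` and `ia` combine to that of `a²`. -/
lemma branchKernel_I_mul (μ : ℝ) (s : ℂ) {a : ℂ} (ha : 0 < a.re) {t : ℝ}
    (ht : t ∈ Set.Ioo (0 : ℝ) 1) :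
    branchKernel μ s (-(Complex.I * a)) (Complex.I * a) (Complex.I * a * t) =
      a ^ (-2 * μ : ℂ) * (Complex.exp (-(s * (Complex.I * a * t))) *
        (((1 - t ^ 2) ^ (-μ) : ℝ) : ℂ)) := by
  have ha0 : a ≠ 0 := by rintro rfl; simp at ha
  have hIa : Complex.I * a ≠ 0 := mul_ne_zero Complex.I_ne_zero ha0
  have h1 : 0 < 1 - t := by linarith [ht.2]
  have h2 : 0 < 1 + t := by linarith [ht.1]
  unfold branchKernel
  have e1 : Complex.I * a * t + -(Complex.I * a) = ((1 - t : ℝ) : ℂ) * -(Complex.I * a) := by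
    push_cast; ring
  have e2 : Complex.I * a * t + Complex.I * a = ((1 + t : ℝ) : ℂ) * (Complex.I * a) := by
    push_cast; ring
  have e3 : (-(Complex.I * a)) ^ ((-μ : ℝ) : ℂ) * (Complex.I * a) ^ ((-μ : ℝ) : ℂ) =
      a ^ (-2 * μ : ℂ) := by
    rw [← Complex.mul_cpow_of_im_neg_of_im_pos (by simpa using ha) (by simpa using ha),
      ← sq_cpow_neg ha]
    congr 1
    linear_combination (-a ^ 2) * Complex.I_sq
  have e4 : (1 - t ^ 2) ^ (-μ) = (1 - t) ^ (-μ) * (1 + t) ^ (-μ) := by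
    rw [← Real.mul_rpow h1.le h2.le]; congr 1; ring
  rw [e1, e2, Complex.ofReal_mul_cpow h1 (neg_ne_zero.2 hIa), Complex.ofReal_mul_cpow h2 hIa,
    ← Complex.ofReal_cpow h1.le, ← Complex.ofReal_cpow h2.le, e4, ← e3]
  push_cast
  ring

/-- Rescaling by `s` produces the kernel along the ray in direction `s`, ready for rotation. The
powers split because `s` lies in the lower and `x + 2ia` in the upper half-plane. -/
lemma branchKernel_I_add {μ : ℝ} {s a : ℂ} (hs : s.im < 0) (ha : 0 < a.re) {x : ℝ} (hx : 0 < x) :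
    branchKernel μ s (-(Complex.I * a)) (Complex.I * a) (Complex.I * a + x) =
      Complex.exp (-(Complex.I * a * s)) * s ^ (2 * μ - 1 : ℂ) *
        (s * branchKernel μ 1 0 (2 * (Complex.I * a * s)) (s * x)) := by
  have hs0 : s ≠ 0 := by rintro rfl; simp at hs
  unfold branchKernel
  have e1 : Complex.I * a + x + -(Complex.I * a) = x := by ring
  have e2 : Complex.I * a + x + Complex.I * a = x + 2 * (Complex.I * a) := by ring
  have e3 : s * x + 0 = (x : ℂ) * s := by ring
  have e4 : s * x + 2 * (Complex.I * a * s) = s * (x + 2 * (Complex.I * a)) := by ring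
  have e5 : Complex.exp (-(s * (Complex.I * a + x))) =
      Complex.exp (-(Complex.I * a * s)) * Complex.exp (-(1 * (s * x))) := by
    rw [← Complex.exp_add]; congr 1; ring
  have e6 : s ^ (2 * μ - 1 : ℂ) * s * (s ^ ((-μ : ℝ) : ℂ) * s ^ ((-μ : ℝ) : ℂ)) = 1 := by
    nth_rewrite 2 [← Complex.cpow_one s]
    rw [← Complex.cpow_add _ _ hs0, ← Complex.cpow_add _ _ hs0, ← Complex.cpow_add _ _ hs0]
    push_cast
    rw [show (2 * μ - 1 + 1 + (-μ + -μ) : ℂ) = 0 by ring, Complex.cpow_zero]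
  rw [e1, e2, e3, e4, e5, Complex.ofReal_mul_cpow hx hs0,
    Complex.mul_cpow_of_im_neg_of_im_pos hs (by simpa using ha)]
  linear_combination (-(Complex.exp (-(Complex.I * a * s)) * Complex.exp (-(1 * (s * x))) *
    (x : ℂ) ^ ((-μ : ℝ) : ℂ) * (x + 2 * (Complex.I * a)) ^ ((-μ : ℝ) : ℂ))) * e6

/-- The phase of the terms of `T` arises here: the power of `ia·s` splits into those of `i`, `a` and
`s`, and `i^{2μ-1}` is the inverse of `i e^{-πiμ}`. -/
lemma cpow_two_mul_sub_one_eq (μ : ℝ) {s a : ℂ} (hs : s.im < 0) (ha : 0 < a.re) :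
    s ^ (2 * μ - 1 : ℂ) = Complex.I * Complex.exp (-(Real.pi * Complex.I * μ)) *
      a ^ (1 - 2 * μ : ℂ) * (Complex.I * a * s) ^ (2 * μ - 1 : ℂ) := by
  have ha0 : a ≠ 0 := by rintro rfl; simp at ha
  have h1 := abs_lt.1 (Complex.abs_arg_lt_pi_div_two_iff.2 (Or.inl ha))
  have e1 : Complex.I * a * s = s * (Complex.I * a) := mul_comm _ _
  have e2 : (Complex.I * a) ^ (2 * μ - 1 : ℂ) =
      Complex.I ^ (2 * μ - 1 : ℂ) * a ^ (2 * μ - 1 : ℂ) := by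
    refine Complex.mul_cpow_of_arg_add_mem Complex.I_ne_zero ha0 ?_ _
    rw [Complex.arg_I]
    constructor <;> linarith
  have e3 : Complex.I * Complex.exp (-(Real.pi * Complex.I * μ)) *
      Complex.I ^ (2 * μ - 1 : ℂ) = 1 := by
    rw [Complex.cpow_def_of_ne_zero Complex.I_ne_zero, Complex.log_I]
    nth_rewrite 1 [← Complex.exp_pi_div_two_mul_I]
    rw [← Complex.exp_add, ← Complex.exp_add]
    convert Complex.exp_zero using 2
    ring
  have e4 : a ^ (1 - 2 * μ : ℂ) * a ^ (2 * μ - 1 : ℂ) = 1 := by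
    rw [← Complex.cpow_add _ _ ha0, show (1 - 2 * μ + (2 * μ - 1) : ℂ) = 0 by ring,
      Complex.cpow_zero]
  rw [e1, Complex.mul_cpow_of_im_neg_of_im_pos hs (by simpa using ha), e2]
  linear_combination (-s ^ (2 * μ - 1 : ℂ)) * e3 - s ^ (2 * μ - 1 : ℂ) * Complex.I *
    Complex.exp (-(Real.pi * Complex.I * μ)) * Complex.I ^ (2 * μ - 1 : ℂ) * e4

lemma integral_branchKernel_one_eq_laplaceU (μ : ℝ) (z : ℂ) :
    ∫ x in Set.Ioi (0 : ℝ), branchKernel μ 1 0 (2 * z) x = laplaceU (-μ) (-μ) z := by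
  unfold laplaceU branchKernel
  refine MeasureTheory.setIntegral_congr_fun measurableSet_Ioi fun x hx => ?_
  have hx' : (0 : ℝ) < x := hx
  rw [add_zero, ← Complex.ofReal_cpow hx'.le, add_comm (x : ℂ), one_mul]
  push_cast
  ring

/-- The Laplace transform of `(x²+a²)^{-μ}` in the open fourth quadrant, as an integral along the
segment up to the branch point `ia` and a Macdonald function. -/
theorem integral_exp_neg_mul_cpow_eq {μ : ℝ} (h0 : 0 ≤ μ) (h1 : μ < 1) {s a : ℂ}
    (hs : 0 < s.re) (hs' : s.im < 0) (ha : 0 < a.re) :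
    ∫ x in Set.Ioi (0 : ℝ), Complex.exp (-(s * x)) * ((x : ℂ) ^ 2 + a ^ 2) ^ ((-μ : ℝ) : ℂ) =
      a ^ (1 - 2 * μ : ℂ) * (Complex.I * ∫ t in Set.Ioo (0 : ℝ) 1,
        Complex.exp (-(s * (Complex.I * a * t))) * (((1 - t ^ 2) ^ (-μ) : ℝ) : ℂ)) +
      Complex.I * Complex.exp (-(Real.pi * Complex.I * μ)) * a ^ (1 - 2 * μ : ℂ) *
        macdonaldU μ (Complex.I * a * s) := by
  have ha0 : a ≠ 0 := by rintro rfl; simp at ha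
  have hs0 : s ≠ 0 := by rintro rfl; simp at hs'
  have hn : 0 < Complex.normSq s := Complex.normSq_pos.2 hs0
  have hinv : 0 < (s⁻¹).im := by
    rw [Complex.inv_im]; exact div_pos (by linarith) hn
  -- Divided by `s`, the point is `(1-τ)x/s + τx + 2ia`, and `Im(1/s) > 0`. The resulting lower
  -- bound gives the distance from `0`; it also keeps the point off the negative axis, where
  -- `Im(ζ/s) ≤ 0`.
  have himq : ∀ τ ∈ Set.Icc (0 : ℝ) 1, ∀ x : ℝ, 0 ≤ x →
      2 * a.re ≤ (((1 + τ * (s - 1)) * x + 2 * (Complex.I * a * s)) * s⁻¹).im := by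
    intro τ hτ x hx
    have e : ((1 + τ * (s - 1)) * x + 2 * (Complex.I * a * s)) * s⁻¹ =
        ((1 - τ : ℝ) : ℂ) * (x : ℂ) * s⁻¹ + ((τ * x : ℝ) : ℂ) + 2 * (Complex.I * a) := by
      push_cast; field_simp; ring
    rw [e, ← Complex.ofReal_mul, Complex.add_im, Complex.add_im, Complex.im_ofReal_mul,
      Complex.ofReal_im]
    have : (2 * (Complex.I * a)).im = 2 * a.re := by simp
    rw [this]
    have : 0 ≤ (1 - τ) * x * (s⁻¹).im :=
      mul_nonneg (mul_nonneg (by linarith [hτ.2]) hx) hinv.le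
    linarith
  have hray := integral_branchKernel_ray h0 h1 (s := s) (w := 2 * (Complex.I * a * s)) hs
    (d := ‖s‖ * (2 * a.re)) (by positivity) ?_ ?_
  · rw [MeasureTheory.integral_const_mul] at hray
    obtain ⟨-, hshift⟩ := integral_branchKernel_shift h0 h1 hs ha
    rw [MeasureTheory.setIntegral_congr_fun measurableSet_Ioi
        (fun x _ => branchKernel_ofReal μ s ha x),
      MeasureTheory.setIntegral_congr_fun measurableSet_Ioi
        (fun x hx => branchKernel_I_add (μ := μ) hs' ha hx),
      MeasureTheory.setIntegral_congr_fun measurableSet_Ioo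
        (fun t ht => branchKernel_I_mul μ s ha ht), MeasureTheory.integral_const_mul,
      MeasureTheory.integral_const_mul, MeasureTheory.integral_const_mul, hray, integral_branchKernel_one_eq_laplaceU] at hshift
    rw [hshift, cpow_two_mul_sub_one_eq μ hs' ha, macdonaldU]
    have e : a ^ (1 - 2 * μ : ℂ) = a * a ^ (-2 * μ : ℂ) := by
      rw [show (1 - 2 * μ : ℂ) = 1 + -2 * μ by ring, Complex.cpow_add _ _ ha0, Complex.cpow_one]
    rw [e]
    ring
  · intro τ hτ x hx
    by_contra hcon
    rw [Complex.mem_slitPlane_iff, not_or, not_lt, not_not] at hcon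
    have h := himq τ hτ x hx
    set ζ := (1 + τ * (s - 1)) * x + 2 * (Complex.I * a * s)
    rw [Complex.mul_im, hcon.2, zero_mul, add_zero] at h
    have := mul_nonpos_of_nonpos_of_nonneg hcon.1 hinv.le
    linarith
  · intro τ hτ x hx
    have h := (himq τ hτ x hx).trans ((le_abs_self _).trans (Complex.abs_im_le_norm _))
    rw [norm_mul, norm_inv, ← div_eq_mul_inv, le_div_iff₀ (norm_pos_iff.2 hs0)] at h
    linarith

/-! ### The Laplace transform at `λ ∓ (2k+1)πi`. -/

open MeasureTheory in
/-- The Laplace transform of `(x²+a²)^{-μ}`. -/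
noncomputable def laplaceCpow (μ : ℝ) (a s : ℂ) : ℂ :=
  ∫ x in Set.Ioi (0 : ℝ), Complex.exp (-(s * x)) * ((x : ℂ) ^ 2 + a ^ 2) ^ ((-μ : ℝ) : ℂ)

lemma sq_add_sq_mem_slitPlane {a : ℂ} (ha : 0 < a.re) (x : ℝ) :
    (x : ℂ) ^ 2 + a ^ 2 ∈ Complex.slitPlane := by
  rw [Complex.mem_slitPlane_iff]
  have e1 : ((x : ℂ) ^ 2 + a ^ 2).re = x ^ 2 + a.re ^ 2 - a.im ^ 2 := by
    simp [sq]; ring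
  have e2 : ((x : ℂ) ^ 2 + a ^ 2).im = 2 * (a.re * a.im) := by
    simp [sq]; ring
  by_cases h : a.im = 0
  · left; rw [e1, h]; nlinarith [sq_nonneg x, sq_pos_of_pos ha]
  · right; rw [e2]; exact mul_ne_zero two_ne_zero (mul_ne_zero ha.ne' h)

lemma laplaceCpow_conj (μ : ℝ) {a : ℂ} (ha : 0 < a.re) (s : ℂ) :
    laplaceCpow μ (conj a) (conj s) = conj (laplaceCpow μ a s) := by
  unfold laplaceCpow
  rw [← integral_conj]
  refine MeasureTheory.setIntegral_congr_fun measurableSet_Ioi fun x _ => ?_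
  have e : (x : ℂ) ^ 2 + conj a ^ 2 = conj ((x : ℂ) ^ 2 + a ^ 2) := by simp
  rw [e, Complex.conj_cpow_of_mem_slitPlane (sq_add_sq_mem_slitPlane ha x), map_mul,
    Complex.conj_ofReal, ← Complex.exp_conj]
  simp

lemma integrableOn_one_sub_sq_rpow {μ : ℝ} (h0 : 0 ≤ μ) (h1 : μ < 1) :
    MeasureTheory.IntegrableOn (fun t : ℝ => (1 - t ^ 2) ^ (-μ)) (Set.Ioo 0 1) := by
  refine MeasureTheory.Integrable.mono' (integrableOn_one_sub_rpow (show -1 < -μ by linarith))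
    (Measurable.aestronglyMeasurable (by fun_prop)) ?_
  filter_upwards [MeasureTheory.ae_restrict_mem measurableSet_Ioo] with t ht
  have e1 : 0 < 1 - t := by linarith [ht.2]
  have e2 : 1 - t ≤ 1 - t ^ 2 := by nlinarith [ht.1, ht.2]
  rw [Real.norm_of_nonneg (Real.rpow_nonneg (by linarith) _)]
  exact Real.rpow_le_rpow_of_nonpos e1 e2 (by linarith)

lemma integrableOn_continuous_mul_one_sub_sq_rpow {μ : ℝ} (h0 : 0 ≤ μ) (h1 : μ < 1) {g : ℝ → ℂ}
    (hg : Continuous g) :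
    MeasureTheory.IntegrableOn (fun t : ℝ => g t * (((1 - t ^ 2) ^ (-μ) : ℝ) : ℂ))
      (Set.Ioo 0 1) := by
  have h := (integrableOn_one_sub_sq_rpow h0 h1).ofReal (𝕜 := ℂ)
  have h2 : MeasureTheory.IntegrableOn (fun t : ℝ => (((1 - t ^ 2) ^ (-μ) : ℝ) : ℂ))
      (Set.Icc 0 1) := by
    rw [integrableOn_Icc_iff_integrableOn_Ioo]
    exact h
  exact (MeasureTheory.IntegrableOn.continuousOn_mul hg.continuousOn h2 isCompact_Icc).mono_set
    Set.Ioo_subset_Icc_self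

/-- The `k`-th term of the expansion of the integrand of `H` in powers of `e^{-2πat}`. -/
noncomputable def mathieuHTerm (μ lam : ℝ) (a : ℂ) (k : ℕ) (t : ℝ) : ℂ :=
  2 * Complex.sin (lam * a * t) * Complex.exp (-((2 * k + 1) * (Real.pi * a * t))) *
    (((1 - t ^ 2) ^ (-μ) : ℝ) : ℂ)

/-- For this `s`, which lies in the fourth quadrant, `ias` is exactly `X_k`. -/
lemma laplaceCpow_sub_I {μ : ℝ} (h0 : 0 ≤ μ) (h1 : μ < 1) {lam : ℝ} (hlam : 0 < lam) {a : ℂ}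
    (ha : 0 < a.re) (k : ℕ) :
    laplaceCpow μ a (lam - ((2 * k + 1) * Real.pi : ℝ) * Complex.I) =
      a ^ (1 - 2 * μ : ℂ) * (Complex.I * ∫ t in Set.Ioo (0 : ℝ) 1,
        Complex.exp (-(Complex.I * (lam * a * t))) *
        Complex.exp (-((2 * k + 1) * (Real.pi * a * t))) * (((1 - t ^ 2) ^ (-μ) : ℝ) : ℂ)) +
      Complex.I * Complex.exp (-(Real.pi * Complex.I * μ)) * a ^ (1 - 2 * μ : ℂ) *
        macdonaldU μ (mathieuX lam a k) := by
  have hk := odd_mul_pi_pos k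
  have e : Complex.I * a * (lam - ((2 * k + 1) * Real.pi : ℝ) * Complex.I) =
      mathieuX lam a k := by
    rw [mathieuX_eq_mul]
    linear_combination (-a * ((2 * k + 1) * Real.pi : ℝ)) * Complex.I_sq
  unfold laplaceCpow
  rw [integral_exp_neg_mul_cpow_eq h0 h1 (by simpa using hlam) (by simpa using hk) ha, e]
  congr 3
  refine MeasureTheory.setIntegral_congr_fun measurableSet_Ioo fun t _ => ?_
  rw [← Complex.exp_add]
  congr 2
  push_cast
  linear_combination (a * t * ((2 * k + 1) * Real.pi)) * Complex.I_sq

/-- The first quadrant needs no second contour: this is the conjugate of the fourth-quadrant formula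
taken at the conjugate of `a`. -/
lemma laplaceCpow_add_I {μ : ℝ} (h0 : 0 ≤ μ) (h1 : μ < 1) {lam : ℝ} (hlam : 0 < lam) {a : ℂ}
    (ha : 0 < a.re) (k : ℕ) :
    laplaceCpow μ a (lam + ((2 * k + 1) * Real.pi : ℝ) * Complex.I) =
      a ^ (1 - 2 * μ : ℂ) * (-Complex.I * ∫ t in Set.Ioo (0 : ℝ) 1,
        Complex.exp (Complex.I * (lam * a * t)) *
        Complex.exp (-((2 * k + 1) * (Real.pi * a * t))) * (((1 - t ^ 2) ^ (-μ) : ℝ) : ℂ)) -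
      Complex.I * Complex.exp (Real.pi * Complex.I * μ) * a ^ (1 - 2 * μ : ℂ) *
        macdonaldU μ (mathieuX (-lam) a k) := by
  have ha' : 0 < (conj a).re := by simpa using ha
  have hsl : a ∈ Complex.slitPlane := Or.inl ha
  have h := congrArg conj (laplaceCpow_sub_I h0 h1 hlam ha' k)
  rw [← laplaceCpow_conj μ ha'] at h
  have e1 : conj ((lam : ℂ) - ((2 * k + 1) * Real.pi : ℝ) * Complex.I) =
      lam + ((2 * k + 1) * Real.pi : ℝ) * Complex.I := by
    rw [map_sub, map_mul, Complex.conj_ofReal, Complex.conj_ofReal, Complex.conj_I]; ring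
  have e2 : conj (conj a ^ (1 - 2 * μ : ℂ)) = a ^ (1 - 2 * μ : ℂ) := by
    rw [Complex.conj_cpow_of_mem_slitPlane hsl]
    simp [map_ofNat]
  rw [e1, Complex.conj_conj, map_add, map_mul, map_mul, map_mul, map_mul, map_mul, e2,
    ← macdonaldU_conj μ (mathieuX_mem_slitPlane lam ha' k), mathieuX_conj, Complex.conj_conj,
    Complex.conj_I, ← Complex.exp_conj, ← integral_conj] at h
  rw [h]
  have e3 : conj (-((Real.pi : ℂ) * Complex.I * μ)) = Real.pi * Complex.I * μ := by simp
  rw [e3]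
  have e4 : ∫ t in Set.Ioo (0 : ℝ) 1, conj (Complex.exp (-(Complex.I * (lam * conj a * t))) *
        Complex.exp (-((2 * k + 1) * (Real.pi * conj a * t))) *
        (((1 - t ^ 2) ^ (-μ) : ℝ) : ℂ)) = ∫ t in Set.Ioo (0 : ℝ) 1,
        Complex.exp (Complex.I * (lam * a * t)) *
        Complex.exp (-((2 * k + 1) * (Real.pi * a * t))) * (((1 - t ^ 2) ^ (-μ) : ℝ) : ℂ) := by
    refine MeasureTheory.setIntegral_congr_fun measurableSet_Ioo fun t _ => ?_
    rw [map_mul, map_mul, Complex.conj_ofReal, ← Complex.exp_conj, ← Complex.exp_conj]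
    simp [map_ofNat]
  rw [e4]
  ring

lemma inv_macdonaldConst {μ : ℝ} (h1 : μ < 1) :
    (macdonaldConst μ)⁻¹ = 2 ^ (1 / 2 - μ) * Real.Gamma (1 - μ) / √Real.pi := by
  unfold macdonaldConst
  have e : (2 : ℝ) ^ (1 / 2 - μ) = (2 ^ (μ - 1 / 2))⁻¹ := by
    rw [← Real.rpow_neg two_pos.le, neg_sub]
  have hΓ := Real.Gamma_pos_of_pos (show 0 < 1 - μ by linarith)
  rw [e]
  field_simp

/-- The two segments combine by `i(e^{-iy} - e^{iy}) = 2 sin y`, and the two rays form the summand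
of `T`, whose prefactor is the inverse of `macdonaldConst`. -/
lemma laplaceCpow_add {μ : ℝ} (h0 : 0 ≤ μ) (h1 : μ < 1) {lam : ℝ} (hlam : 0 < lam) {a : ℂ}
    (ha : 0 < a.re) (k : ℕ) :
    laplaceCpow μ a (lam - ((2 * k + 1) * Real.pi : ℝ) * Complex.I) +
      laplaceCpow μ a (lam + ((2 * k + 1) * Real.pi : ℝ) * Complex.I) =
    a ^ (1 - 2 * μ : ℂ) * (∫ t in Set.Ioo (0 : ℝ) 1, mathieuHTerm μ lam a k t) +
      ((2 ^ (1 / 2 - μ) * Real.Gamma (1 - μ) / √Real.pi : ℝ) : ℂ) * a ^ (1 - 2 * μ : ℂ) *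
        mathieuTTerm μ lam a k := by
  have i1 := integrableOn_continuous_mul_one_sub_sq_rpow h0 h1
    (g := fun t : ℝ => Complex.exp (-(Complex.I * (lam * a * t))) *
        Complex.exp (-((2 * k + 1) * (Real.pi * a * t)))) (by fun_prop)
  have i2 := integrableOn_continuous_mul_one_sub_sq_rpow h0 h1
    (g := fun t : ℝ => Complex.exp (Complex.I * (lam * a * t)) *
        Complex.exp (-((2 * k + 1) * (Real.pi * a * t)))) (by fun_prop)
  have hH : ∫ t in Set.Ioo (0 : ℝ) 1, mathieuHTerm μ lam a k t =
      (Complex.I * ∫ t in Set.Ioo (0 : ℝ) 1,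
        Complex.exp (-(Complex.I * (lam * a * t))) *
        Complex.exp (-((2 * k + 1) * (Real.pi * a * t))) * (((1 - t ^ 2) ^ (-μ) : ℝ) : ℂ)) +
      (-Complex.I * ∫ t in Set.Ioo (0 : ℝ) 1,
        Complex.exp (Complex.I * (lam * a * t)) *
        Complex.exp (-((2 * k + 1) * (Real.pi * a * t))) * (((1 - t ^ 2) ^ (-μ) : ℝ) : ℂ)) := by
    rw [← MeasureTheory.integral_const_mul, ← MeasureTheory.integral_const_mul,
      ← MeasureTheory.integral_add (i1.const_mul _) (i2.const_mul _)]
    refine MeasureTheory.setIntegral_congr_fun measurableSet_Ioo fun t _ => ?_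
    unfold mathieuHTerm
    rw [Complex.sin, neg_mul (lam * a * t : ℂ), mul_comm (lam * a * t : ℂ) Complex.I]
    ring
  have hc : (macdonaldConst μ : ℂ) ≠ 0 := by exact_mod_cast (macdonaldConst_pos h1).ne'
  rw [laplaceCpow_sub_I h0 h1 hlam ha, laplaceCpow_add_I h0 h1 hlam ha, hH,
    ← inv_macdonaldConst h1, mathieuTTerm, scaledK_eq h0 h1 (mathieuX_mem_slitPlane lam ha k),
    scaledK_eq h0 h1 (mathieuX_mem_slitPlane (-lam) ha k)]
  generalize (∫ t in Set.Ioo (0 : ℝ) 1, Complex.exp (-(Complex.I * (lam * a * t))) *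
        Complex.exp (-((2 * k + 1) * (Real.pi * a * t))) * (((1 - t ^ 2) ^ (-μ) : ℝ) : ℂ)) = A
  generalize (∫ t in Set.Ioo (0 : ℝ) 1, Complex.exp (Complex.I * (lam * a * t)) *
        Complex.exp (-((2 * k + 1) * (Real.pi * a * t))) * (((1 - t ^ 2) ^ (-μ) : ℝ) : ℂ)) = B
  push_cast
  field_simp
  ring

/-! ### Summing the segments to `H`. -/

lemma hasSum_exp_neg_odd_mul {w : ℂ} (hw : 0 < w.re) :
    HasSum (fun k : ℕ => Complex.exp (-((2 * k + 1) * w))) (1 / (2 * Complex.sinh w)) := by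
  have hn : ‖Complex.exp (-(2 * w))‖ < 1 := by
    rw [Complex.norm_exp, Real.exp_lt_one_iff]
    simpa using hw
  have h := (hasSum_geometric_of_norm_lt_one hn).mul_left (Complex.exp (-w))
  have hne : 1 - Complex.exp (-(2 * w)) ≠ 0 := by
    intro h0
    rw [← sub_eq_zero.1 h0] at hn
    simp at hn
  have e1 : ∀ k : ℕ, Complex.exp (-w) * Complex.exp (-(2 * w)) ^ k =
      Complex.exp (-((2 * k + 1) * w)) := by
    intro k
    rw [← Complex.exp_nat_mul, ← Complex.exp_add]
    congr 1
    ring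
  simp only [e1] at h
  have e2 : 2 * Complex.sinh w = (1 - Complex.exp (-(2 * w))) * (Complex.exp (-w))⁻¹ := by
    rw [Complex.sinh, Complex.exp_neg w, inv_inv, sub_mul, one_mul,
      show Complex.exp (-(2 * w)) = Complex.exp (-w) * Complex.exp (-w) by
        rw [← Complex.exp_add]; congr 1; ring, mul_assoc, Complex.exp_neg w,
      inv_mul_cancel₀ (Complex.exp_ne_zero w), mul_one]
    ring
  rwa [e2, one_div, mul_inv, inv_inv, mul_comm]

lemma hasSum_real_exp_neg_odd_mul {y : ℝ} (hy : 0 < y) :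
    HasSum (fun k : ℕ => Real.exp (-((2 * k + 1) * y))) (1 / (2 * Real.sinh y)) := by
  have h := hasSum_exp_neg_odd_mul (w := y) (by simpa using hy)
  rw [← Complex.hasSum_ofReal]
  push_cast
  exact h

lemma Complex.norm_sin_le_norm_mul_exp (z : ℂ) : ‖Complex.sin z‖ ≤ ‖z‖ * Real.exp ‖z‖ := by
  have h1 := Complex.norm_exp_sub_sum_le_norm_mul_exp (-z * Complex.I) 1
  have h2 := Complex.norm_exp_sub_sum_le_norm_mul_exp (z * Complex.I) 1
  simp only [Finset.range_one, Finset.sum_singleton, pow_zero, Nat.factorial_zero, Nat.cast_one,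
    div_one, pow_one, norm_mul, norm_neg, Complex.norm_I, mul_one] at h1 h2
  have e : Complex.sin z = ((Complex.exp (-z * Complex.I) - 1) -
      (Complex.exp (z * Complex.I) - 1)) * Complex.I / 2 := by
    rw [Complex.sin]; ring
  rw [e, norm_div, norm_mul, Complex.norm_I, mul_one, Complex.norm_ofNat]
  have := norm_sub_le (Complex.exp (-z * Complex.I) - 1) (Complex.exp (z * Complex.I) - 1)
  linarith

lemma Complex.sinh_re_le_norm_sinh (w : ℂ) : Real.sinh w.re ≤ ‖Complex.sinh w‖ := by
  rw [Complex.sinh, norm_div, Complex.norm_ofNat, Real.sinh_eq]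
  have h := norm_sub_norm_le (Complex.exp w) (Complex.exp (-w))
  rw [Complex.norm_exp, Complex.norm_exp, Complex.neg_re] at h
  linarith

/-- The factor in the bound for the integrand of `H`. -/
lemma norm_sin_div_sinh_le (lam : ℝ) {a : ℂ} (ha : 0 < a.re) {t : ℝ} (ht : t ∈ Set.Ioo (0 : ℝ) 1) :
    ‖Complex.sin (lam * a * t)‖ * (1 / Real.sinh (Real.pi * a.re * t)) ≤
      |lam| * (‖a‖ * Real.exp (|lam| * ‖a‖) / (Real.pi * a.re)) := by
  have hpi := Real.pi_pos
  have h1 := Complex.norm_sin_le_norm_mul_exp (lam * a * t)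
  have h2 : ‖(lam * a * t : ℂ)‖ = |lam| * ‖a‖ * t := by
    rw [norm_mul, norm_mul, Complex.norm_real, Complex.norm_real, Real.norm_eq_abs,
      Real.norm_of_nonneg ht.1.le]
  rw [h2] at h1
  have h3 : Real.pi * a.re * t ≤ Real.sinh (Real.pi * a.re * t) :=
    Real.self_le_sinh_iff.2 (by have := ht.1; positivity)
  have h4 : 0 < Real.pi * a.re * t := mul_pos (mul_pos hpi ha) ht.1
  have h5 : |lam| * ‖a‖ * t ≤ |lam| * ‖a‖ := mul_le_of_le_one_right (by positivity) ht.2.le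
  have ht0 := ht.1
  -- Sine and hyperbolic sine both vanish to first order at `t = 0`, so `t` cancels. The factor
  -- `|λ|` is kept outside because it makes `H` tend to `0` with `λ`.
  calc _ ≤ (|lam| * ‖a‖ * t * Real.exp (|lam| * ‖a‖)) * (1 / (Real.pi * a.re * t)) := by
        gcongr
        refine h1.trans ?_
        gcongr
    _ = _ := by field_simp

lemma sinh_pi_mul_pos {x t : ℝ} (hx : 0 < x) (ht : 0 < t) : 0 < Real.sinh (Real.pi * x * t) :=
  Real.sinh_pos_iff.2 (by have := Real.pi_pos; positivity)

lemma norm_mathieuHIntegrand_le (μ lam : ℝ) {a : ℂ} (ha : 0 < a.re) {t : ℝ}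
    (ht : t ∈ Set.Ioo (0 : ℝ) 1) :
    ‖mathieuHIntegrand μ lam a t‖ ≤
      |lam| * (‖a‖ * Real.exp (|lam| * ‖a‖) / (Real.pi * a.re)) * (1 - t ^ 2) ^ (-μ) := by
  have hs := sinh_pi_mul_pos ha ht.1
  have h := Complex.sinh_re_le_norm_sinh (Real.pi * a * t)
  have e : ((Real.pi : ℂ) * a * t).re = Real.pi * a.re * t := by simp
  rw [e] at h
  have h1 : 0 ≤ 1 - t ^ 2 := by nlinarith [ht.1, ht.2]
  unfold mathieuHIntegrand
  rw [norm_mul, norm_div, Complex.norm_real, Real.norm_of_nonneg (Real.rpow_nonneg h1 _)]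
  refine mul_le_mul_of_nonneg_right ?_ (Real.rpow_nonneg h1 _)
  refine le_trans ?_ (norm_sin_div_sinh_le lam ha ht)
  rw [mul_one_div]
  gcongr

lemma measurable_mathieuHIntegrand (μ lam : ℝ) (a : ℂ) : Measurable (mathieuHIntegrand μ lam a) := by
  unfold mathieuHIntegrand
  fun_prop

theorem intervalIntegrable_mathieuHIntegrand {μ : ℝ} (h0 : 0 ≤ μ) (h1 : μ < 1) (lam : ℝ) {a : ℂ}
    (ha : 0 < a.re) :
    IntervalIntegrable (mathieuHIntegrand μ lam a) MeasureTheory.volume 0 1 := by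
  rw [intervalIntegrable_iff_integrableOn_Ioo_of_le zero_le_one]
  refine MeasureTheory.Integrable.mono' ((integrableOn_one_sub_sq_rpow h0 h1).const_mul
      (|lam| * (‖a‖ * Real.exp (|lam| * ‖a‖) / (Real.pi * a.re))))
    (measurable_mathieuHIntegrand μ lam a).aestronglyMeasurable ?_
  filter_upwards [MeasureTheory.ae_restrict_mem measurableSet_Ioo] with t ht
  exact norm_mathieuHIntegrand_le μ lam ha ht

/-- Summing the integrals along the segments up to the branch points. -/
theorem hasSum_integral_mathieuHTerm {μ : ℝ} (h0 : 0 ≤ μ) (h1 : μ < 1) (lam : ℝ) {a : ℂ}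
    (ha : 0 < a.re) :
    HasSum (fun k : ℕ => ∫ t in Set.Ioo (0 : ℝ) 1, mathieuHTerm μ lam a k t)
      (∫ t in (0 : ℝ)..1, mathieuHIntegrand μ lam a t) := by
  rw [intervalIntegral.integral_of_le zero_le_one, MeasureTheory.integral_Ioc_eq_integral_Ioo]
  have hpi := Real.pi_pos
  -- The norms of the terms form the same geometric series with `Re a` in the exponent, so dominated
  -- convergence for series only needs its closed sum to be integrable.
  have hsum : ∀ t ∈ Set.Ioo (0 : ℝ) 1, HasSum (fun k : ℕ => 2 * ‖Complex.sin (lam * a * t)‖ *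
      Real.exp (-((2 * k + 1) * (Real.pi * a.re * t))) * (1 - t ^ 2) ^ (-μ))
      (‖Complex.sin (lam * a * t)‖ * (1 / Real.sinh (Real.pi * a.re * t)) *
        (1 - t ^ 2) ^ (-μ)) := by
    intro t ht
    have hs := sinh_pi_mul_pos ha ht.1
    have h := ((hasSum_real_exp_neg_odd_mul (y := Real.pi * a.re * t)
      (mul_pos (mul_pos hpi ha) ht.1)).mul_left (2 * ‖Complex.sin (lam * a * t)‖)).mul_right
      ((1 - t ^ 2) ^ (-μ))
    have e : 2 * ‖Complex.sin (lam * a * t)‖ * (1 / (2 * Real.sinh (Real.pi * a.re * t))) =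
        ‖Complex.sin (lam * a * t)‖ * (1 / Real.sinh (Real.pi * a.re * t)) := by
      field_simp
    rwa [e] at h
  refine MeasureTheory.hasSum_integral_of_dominated_convergence
    (fun k t => 2 * ‖Complex.sin (lam * a * t)‖ *
      Real.exp (-((2 * k + 1) * (Real.pi * a.re * t))) * (1 - t ^ 2) ^ (-μ)) ?_ ?_ ?_ ?_ ?_
  · intro k
    refine Measurable.aestronglyMeasurable ?_
    unfold mathieuHTerm
    fun_prop
  · intro k
    filter_upwards [MeasureTheory.ae_restrict_mem measurableSet_Ioo] with t ht
    have h2 : 0 ≤ 1 - t ^ 2 := by nlinarith [ht.1, ht.2]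
    unfold mathieuHTerm
    rw [norm_mul, norm_mul, norm_mul, Complex.norm_ofNat, Complex.norm_exp, Complex.norm_real,
      Real.norm_of_nonneg (Real.rpow_nonneg h2 _)]
    refine le_of_eq ?_
    congr 3
    have : (2 * (k : ℂ) + 1) * (Real.pi * a * t) = (((2 * k + 1) * (Real.pi * t) : ℝ) : ℂ) * a := by
      push_cast; ring
    rw [Complex.neg_re, this, Complex.re_ofReal_mul]
    ring
  · filter_upwards [MeasureTheory.ae_restrict_mem measurableSet_Ioo] with t ht
    exact (hsum t ht).summable
  · refine MeasureTheory.Integrable.congr (f := fun t : ℝ => ‖Complex.sin (lam * a * t)‖ *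
      (1 / Real.sinh (Real.pi * a.re * t)) * (1 - t ^ 2) ^ (-μ)) ?_ ?_
    · refine MeasureTheory.Integrable.mono' ((integrableOn_one_sub_sq_rpow h0 h1).const_mul
        (|lam| * (‖a‖ * Real.exp (|lam| * ‖a‖) / (Real.pi * a.re))))
        (Measurable.aestronglyMeasurable (by fun_prop)) ?_
      filter_upwards [MeasureTheory.ae_restrict_mem measurableSet_Ioo] with t ht
      have hs := sinh_pi_mul_pos ha ht.1
      have h2 : 0 ≤ 1 - t ^ 2 := by nlinarith [ht.1, ht.2]
      have h3 := Real.rpow_nonneg h2 (-μ)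
      rw [Real.norm_of_nonneg (by positivity)]
      exact mul_le_mul_of_nonneg_right (norm_sin_div_sinh_le lam ha ht) h3
    · filter_upwards [MeasureTheory.ae_restrict_mem measurableSet_Ioo] with t ht
      exact (hsum t ht).tsum_eq.symm
  · filter_upwards [MeasureTheory.ae_restrict_mem measurableSet_Ioo] with t ht
    have hre : 0 < ((Real.pi : ℂ) * a * t).re := by
      have : ((Real.pi : ℂ) * a * t).re = Real.pi * a.re * t := by simp
      rw [this]
      exact mul_pos (mul_pos hpi ha) ht.1
    have h := ((hasSum_exp_neg_odd_mul hre).mul_left (2 * Complex.sin (lam * a * t))).mul_right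
      ((((1 - t ^ 2) ^ (-μ) : ℝ) : ℂ))
    rw [mul_one_div, mul_div_mul_left _ _ two_ne_zero] at h
    exact h

/-! ### Poisson summation. -/

lemma norm_sq_add_sq_cpow_le {μ : ℝ} (h0 : 0 ≤ μ) {a : ℂ} (ha : 0 < a.re) (x : ℝ) :
    ‖((x : ℂ) ^ 2 + a ^ 2) ^ ((-μ : ℝ) : ℂ)‖ ≤ (a.re ^ 2) ^ (-μ) := by
  rw [Complex.norm_cpow_real]
  refine Real.rpow_le_rpow_of_nonpos (by positivity) ?_ (by linarith)
  have e : (x : ℂ) ^ 2 + a ^ 2 = (x + Complex.I * a) * (x - Complex.I * a) := by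
    linear_combination a ^ 2 * Complex.I_sq
  have h1 : a.re ≤ ‖(x : ℂ) + Complex.I * a‖ := by
    have := (le_abs_self _).trans (Complex.abs_im_le_norm ((x : ℂ) + Complex.I * a))
    simpa using this
  have h2 : a.re ≤ ‖(x : ℂ) - Complex.I * a‖ := by
    have := (neg_le_abs _).trans (Complex.abs_im_le_norm ((x : ℂ) - Complex.I * a))
    simpa using this
  rw [e, norm_mul, sq]
  exact mul_le_mul h1 h2 ha.le (ha.le.trans h1)

/-- The even function whose values at the integers are the terms of the alternating series. -/
noncomputable def mathieuFun (μ lam : ℝ) (a : ℂ) (x : ℝ) : ℂ :=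
  Complex.exp (-(Real.pi * Complex.I * x)) * (Complex.exp (-(lam * |x| : ℝ)) *
    ((x : ℂ) ^ 2 + a ^ 2) ^ ((-μ : ℝ) : ℂ))

lemma continuous_mathieuFun (μ lam : ℝ) {a : ℂ} (ha : 0 < a.re) :
    Continuous (mathieuFun μ lam a) := by
  have h : Continuous fun x : ℝ => ((x : ℂ) ^ 2 + a ^ 2) ^ ((-μ : ℝ) : ℂ) := by
    refine continuous_iff_continuousAt.2 fun x => ?_
    exact ContinuousAt.cpow (by fun_prop) continuousAt_const (sq_add_sq_mem_slitPlane ha x)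
  unfold mathieuFun
  fun_prop

lemma norm_mathieuFun_le {μ : ℝ} (h0 : 0 ≤ μ) (lam : ℝ) {a : ℂ} (ha : 0 < a.re) (x : ℝ) :
    ‖mathieuFun μ lam a x‖ ≤ (a.re ^ 2) ^ (-μ) * Real.exp (-lam * |x|) := by
  have h := norm_sq_add_sq_cpow_le h0 ha x
  unfold mathieuFun
  rw [norm_mul, norm_mul, Complex.norm_exp, Complex.norm_exp]
  have e1 : (-((Real.pi : ℂ) * Complex.I * x)).re = 0 := by simp
  have e2 : (-((lam * |x| : ℝ) : ℂ)).re = -lam * |x| := by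
    rw [Complex.neg_re, Complex.ofReal_re]; ring
  rw [e1, e2, Real.exp_zero, one_mul, mul_comm]
  gcongr

lemma mathieuFun_isBigO {μ : ℝ} (h0 : 0 ≤ μ) {lam : ℝ} (hlam : 0 < lam) {a : ℂ} (ha : 0 < a.re)
    (b : ℝ) : mathieuFun μ lam a =O[cocompact ℝ] fun x => |x| ^ b := by
  have h := ((isLittleO_exp_neg_mul_rpow_atTop hlam b).isBigO.comp_tendsto
    (tendsto_norm_cocompact_atTop (E := ℝ)))
  refine IsBigO.trans (g := fun x : ℝ => Real.exp (-lam * |x|)) ?_ h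
  refine IsBigO.of_bound ((a.re ^ 2) ^ (-μ)) (Eventually.of_forall fun x => ?_)
  rw [Real.norm_of_nonneg (Real.exp_pos _).le]
  exact norm_mathieuFun_le h0 lam ha x

lemma integrableOn_exp_neg_mul_mul_cpow {μ : ℝ} (h0 : 0 ≤ μ) (h1 : μ < 1) {s a : ℂ}
    (hs : 0 < s.re) (ha : 0 < a.re) :
    MeasureTheory.IntegrableOn
      (fun x : ℝ => Complex.exp (-(s * x)) * ((x : ℂ) ^ 2 + a ^ 2) ^ ((-μ : ℝ) : ℂ))
      (Set.Ioi 0) :=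
  (integral_branchKernel_shift h0 h1 hs ha).1.congr_fun
    (fun x _ => branchKernel_ofReal μ s ha x) measurableSet_Ioi

/-- The sign factor `e^{-πiv}` shifts the frequency `2πw` to `(2w+1)π`, and each half-line
contributes one Laplace transform. -/
lemma fourier_mathieuFun {μ : ℝ} (h0 : 0 ≤ μ) (h1 : μ < 1) {lam : ℝ} (hlam : 0 < lam) {a : ℂ}
    (ha : 0 < a.re) (w : ℝ) :
    FourierTransform.fourier (mathieuFun μ lam a) w =
      laplaceCpow μ a (lam - ((2 * w + 1) * Real.pi : ℝ) * Complex.I) +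
        laplaceCpow μ a (lam + ((2 * w + 1) * Real.pi : ℝ) * Complex.I) := by
  rw [Real.fourier_real_eq_integral_exp_smul]
  set G : ℝ → ℂ := fun v => Complex.exp (↑(-2 * Real.pi * v * w) * Complex.I) • mathieuFun μ lam a v
  have i1 := integrableOn_exp_neg_mul_mul_cpow h0 h1
    (s := lam + ((2 * w + 1) * Real.pi : ℝ) * Complex.I) (by simpa using hlam) ha
  have i2 := integrableOn_exp_neg_mul_mul_cpow h0 h1
    (s := lam - ((2 * w + 1) * Real.pi : ℝ) * Complex.I) (by simpa using hlam) ha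
  have e1 : ∀ x ∈ Set.Ioi (0 : ℝ), Complex.exp (-((lam + ((2 * w + 1) * Real.pi : ℝ) *
      Complex.I) * x)) * ((x : ℂ) ^ 2 + a ^ 2) ^ ((-μ : ℝ) : ℂ) = G x := by
    intro x hx
    simp only [G, mathieuFun, smul_eq_mul]
    rw [abs_of_pos hx, ← mul_assoc, ← mul_assoc, ← Complex.exp_add, ← Complex.exp_add]
    congr 2
    push_cast
    ring
  have e2 : ∀ x ∈ Set.Ioi (0 : ℝ), Complex.exp (-((lam - ((2 * w + 1) * Real.pi : ℝ) *
      Complex.I) * x)) * ((x : ℂ) ^ 2 + a ^ 2) ^ ((-μ : ℝ) : ℂ) = G (-x) := by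
    intro x hx
    simp only [G, mathieuFun, smul_eq_mul]
    rw [abs_neg, abs_of_pos hx, ← mul_assoc, ← mul_assoc, ← Complex.exp_add, ← Complex.exp_add]
    congr 2
    · push_cast
      ring
    · push_cast
      ring
  have j1 := i1.congr_fun e1 measurableSet_Ioi
  have j2 := i2.congr_fun e2 measurableSet_Ioi
  have j3 : MeasureTheory.IntegrableOn G (Set.Iic 0) := by
    have := MeasureTheory.IntegrableOn.comp_neg_Iic (c := (0 : ℝ)) (f := fun x => G (-x))
      (μ := MeasureTheory.volume)
      (by rw [neg_zero]; rwa [integrableOn_Ici_iff_integrableOn_Ioi])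
    simpa using this
  rw [← intervalIntegral.integral_Iic_add_Ioi j3 j1]
  have e3 := integral_comp_neg_Ioi 0 G
  rw [neg_zero] at e3
  rw [← e3, ← MeasureTheory.setIntegral_congr_fun measurableSet_Ioi e1,
    ← MeasureTheory.setIntegral_congr_fun measurableSet_Ioi e2]
  rfl

lemma summable_mathieuTTerm {μ : ℝ} (h0 : 0 ≤ μ) (h1 : μ < 1) (lam : ℝ) {a : ℂ}
    (ha : 0 < a.re) : Summable (mathieuTTerm μ lam a) :=
  (((summable_scaledK_mathieuX h0 h1 lam ha).mul_left _).sub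
    ((summable_scaledK_mathieuX h0 h1 (-lam) ha).mul_left _)).mul_left _

/-- Since `2(-k-1) + 1 = -(2k+1)`, the frequency `-k-1` exchanges the two transforms belonging to
`k`; hence the factor `2`. -/
lemma hasSum_fourier_mathieuFun {μ : ℝ} (h0 : 0 ≤ μ) (h1 : μ < 1) {lam : ℝ} (hlam : 0 < lam)
    {a : ℂ} (ha : 0 < a.re) :
    HasSum (fun n : ℤ => FourierTransform.fourier (mathieuFun μ lam a) (n : ℝ))
      (2 * (mathieuH μ lam a + mathieuT μ lam a)) := by
  have hk : HasSum (fun k : ℕ =>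
      laplaceCpow μ a (lam - ((2 * k + 1) * Real.pi : ℝ) * Complex.I) +
        laplaceCpow μ a (lam + ((2 * k + 1) * Real.pi : ℝ) * Complex.I))
      (mathieuH μ lam a + mathieuT μ lam a) := by
    simp only [laplaceCpow_add h0 h1 hlam ha, mathieuT_eq]
    exact ((hasSum_integral_mathieuHTerm h0 h1 lam ha).mul_left _).add
      ((summable_mathieuTTerm h0 h1 lam ha).hasSum.mul_left _)
  rw [two_mul]
  refine HasSum.of_nat_of_neg_add_one ?_ ?_
  · refine hk.congr_fun ?_
    intro k
    rw [fourier_mathieuFun h0 h1 hlam ha]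
    simp
  · refine hk.congr_fun ?_
    intro k
    rw [fourier_mathieuFun h0 h1 hlam ha, add_comm]
    have e : ((2 * ((-((k : ℤ) + 1) : ℤ) : ℝ) + 1) * Real.pi : ℝ) = -((2 * k + 1) * Real.pi) := by
      push_cast; ring
    rw [e, Complex.ofReal_neg, neg_mul, sub_neg_eq_add, ← sub_eq_add_neg]

lemma mathieuTerm_eq_mathieuFun (μ lam : ℝ) (a : ℂ) (n : ℕ) :
    mathieuTerm μ lam a n = mathieuFun μ lam a n := by
  unfold mathieuTerm mathieuFun
  have e : Complex.exp (-(Real.pi * Complex.I * ((n : ℝ) : ℂ))) = (-1) ^ n := by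
    rw [show -(Real.pi * Complex.I * ((n : ℝ) : ℂ)) = n * (-(Real.pi * Complex.I)) by
      push_cast; ring, Complex.exp_nat_mul, Complex.exp_neg, Complex.exp_pi_mul_I]
    norm_num
  rw [e, Nat.abs_cast, div_eq_mul_inv, ← Complex.cpow_neg]
  push_cast
  ring

/-- The factor `e^{-πix}` is not even in `x`, but at integers it is `±1` and symmetric. -/
lemma mathieuFun_neg_natCast (μ lam : ℝ) (a : ℂ) (n : ℕ) :
    mathieuFun μ lam a (-n) = mathieuFun μ lam a n := by
  unfold mathieuFun
  have e : Complex.exp (-(Real.pi * Complex.I * ((-n : ℝ) : ℂ))) =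
      Complex.exp (-(Real.pi * Complex.I * ((n : ℝ) : ℂ))) := by
    rw [show -(Real.pi * Complex.I * ((-n : ℝ) : ℂ)) = n * (Real.pi * Complex.I) by
      push_cast; ring, show -(Real.pi * Complex.I * ((n : ℝ) : ℂ)) = n * (-(Real.pi * Complex.I)) by
      push_cast; ring, Complex.exp_nat_mul, Complex.exp_nat_mul, Complex.exp_neg,
      Complex.exp_pi_mul_I]
    norm_num
  rw [e, abs_neg]
  simp

lemma summable_mathieuTerm {μ : ℝ} (h0 : 0 ≤ μ) {lam : ℝ} (hlam : 0 < lam) {a : ℂ}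
    (ha : 0 < a.re) : Summable (mathieuTerm μ lam a) := by
  have hg : Summable fun n : ℕ => (a.re ^ 2) ^ (-μ) * Real.exp (-lam) ^ n :=
    (summable_geometric_of_lt_one (Real.exp_pos _).le (by rw [Real.exp_lt_one_iff]; linarith)).mul_left _
  refine Summable.of_norm_bounded hg fun n => ?_
  rw [mathieuTerm_eq_mathieuFun]
  refine (norm_mathieuFun_le h0 lam ha n).trans_eq ?_
  rw [← Real.exp_nat_mul, Nat.abs_cast, mul_comm (n : ℝ)]

/-- The representation of the alternating Mathieu series in the right half-plane. -/
theorem mathieuS_eq {μ : ℝ} (h0 : 0 ≤ μ) (h1 : μ < 1) {lam : ℝ} (hlam : 0 < lam) {a : ℂ}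
    (ha : 0 < a.re) :
    mathieuS μ lam a = 1 / (2 * a ^ (2 * μ : ℂ)) + mathieuH μ lam a + mathieuT μ lam a := by
  have hF := hasSum_fourier_mathieuFun h0 h1 hlam ha
  -- The kink of `e^{-λ|x|}` at `0` does no harm: this form of Poisson summation asks for
  -- continuity, decay and summable Fourier values, and the last come from the explicit sum.
  have hP := Real.tsum_eq_tsum_fourier_of_rpow_decay_of_summable
    (continuous_mathieuFun μ lam ha) one_lt_two (mathieuFun_isBigO h0 hlam ha (-2)) hF.summable 0
  have e0 : mathieuFun μ lam a 0 = 1 / a ^ (2 * μ : ℂ) := by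
    have e := sq_cpow_neg ha μ
    unfold mathieuFun
    rw [one_div, ← Complex.cpow_neg, ← neg_mul]
    simpa using e
  have hS : HasSum (fun n : ℕ => mathieuFun μ lam a n) (mathieuS μ lam a) := by
    simp only [← mathieuTerm_eq_mathieuFun]
    exact (summable_mathieuTerm h0 hlam ha).hasSum
  have hZ : HasSum (fun n : ℤ => mathieuFun μ lam a n)
      (mathieuS μ lam a + mathieuS μ lam a - mathieuFun μ lam a 0) := by
    have := HasSum.of_nat_of_neg (f := fun n : ℤ => mathieuFun μ lam a n) (by simpa using hS)
      (by simpa [mathieuFun_neg_natCast] using hS)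
    simpa using this
  simp only [zero_add, QuotientAddGroup.mk_zero, fourier_eval_zero, mul_one] at hP
  rw [hZ.tsum_eq, hF.tsum_eq, e0] at hP
  have e : 1 / (2 * a ^ (2 * μ : ℂ)) = 1 / a ^ (2 * μ : ℂ) / 2 := by
    rw [div_div, mul_comm]
  rw [e]
  linear_combination hP / 2

/-! ### Olver's case `λ = 0`. -/

lemma besselK_div_cpow (μ : ℝ) (z : ℂ) :
    besselK (1 / 2 - μ) z / z ^ (1 / 2 - μ : ℂ) = scaledK μ z := by
  unfold scaledK
  rw [div_eq_mul_inv, ← Complex.cpow_neg, neg_sub, mul_comm]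

lemma mathieuX_zero_left (a : ℂ) (k : ℕ) : mathieuX 0 a k = (2 * k + 1) * Real.pi * a := by
  simp [mathieuX]

/-- At `λ = 0` the two arguments coincide, the phases combine to `2 sin πμ`, and the reflection
formula trades `Γ(1-μ) sin πμ` for `π/Γ(μ)`. -/
theorem mathieuT_zero {μ : ℝ} (hμ : 0 < μ) (h1 : μ < 1) (a : ℂ) :
    mathieuT μ 0 a = olverSeries μ a := by
  have hΓ := Real.Gamma_pos_of_pos hμ
  have hsin : 0 < Real.sin (Real.pi * μ) :=
    Real.sin_pos_of_pos_of_lt_pi (mul_pos Real.pi_pos hμ)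
      (by nlinarith [Real.pi_pos])
  have hrefl := Real.Gamma_mul_Gamma_one_sub μ
  have hpi : √Real.pi * √Real.pi = Real.pi := Real.mul_self_sqrt Real.pi_pos.le
  have hspi : 0 < √Real.pi := Real.sqrt_pos.2 Real.pi_pos
  have hterm : ∀ k : ℕ, mathieuTTerm μ 0 a k = ((2 * Real.sin (Real.pi * μ) : ℝ) : ℂ) *
      (besselK (1 / 2 - μ) ((2 * k + 1) * Real.pi * a) /
        ((2 * k + 1) * Real.pi * a) ^ (1 / 2 - μ : ℂ)) := by
    intro k
    rw [besselK_div_cpow, ← mathieuX_zero_left, mathieuTTerm, neg_zero]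
    push_cast
    rw [Complex.sin, mul_right_comm (Real.pi : ℂ), neg_mul]
    ring
  have hconst : 2 ^ (1 / 2 - μ) * Real.Gamma (1 - μ) / √Real.pi * (2 * Real.sin (Real.pi * μ)) =
      2 ^ (3 / 2 - μ) * √Real.pi / Real.Gamma μ := by
    have e2 : (2 : ℝ) ^ (3 / 2 - μ) = 2 ^ (1 / 2 - μ) * 2 := by
      rw [show (3 / 2 - μ : ℝ) = (1 / 2 - μ) + 1 by ring, Real.rpow_add two_pos, Real.rpow_one]
    rw [eq_div_iff hsin.ne'] at hrefl
    rw [e2]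
    field_simp
    rw [sq, hpi, mul_comm μ]
    linear_combination hrefl
  have hconst' := congrArg (fun x : ℝ => (x : ℂ)) hconst
  simp only [Complex.ofReal_mul _ (2 * _), Complex.ofReal_div _ (Real.Gamma μ)] at hconst'
  rw [mathieuT_eq, olverSeries]
  simp only [hterm]
  rw [tsum_mul_left, ← mul_assoc, mul_right_comm _ (a ^ (1 - 2 * μ : ℂ)), hconst', mul_comm (a ^ (2 * μ - 1 : ℂ)),
    ← div_div, show (1 - 2 * μ : ℂ) = -(2 * μ - 1) by ring, Complex.cpow_neg, ← div_eq_mul_inv]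

/-- Averaging the alternating sum with its shift replaces the coefficients by their differences. For
complex coefficients this stands in for Leibniz's criterion. -/
lemma sum_range_neg_one_pow_mul (c : ℕ → ℂ) (N : ℕ) :
    ∑ n ∈ Finset.range N, (-1) ^ n * c n = c 0 / 2 +
      (∑ n ∈ Finset.range N, (-1) ^ n * (c n - c (n + 1))) / 2 - (-1) ^ N * c N / 2 := by
  induction N with
  | zero => simp
  | succ N ih =>
    rw [Finset.sum_range_succ, Finset.sum_range_succ, ih, pow_succ]
    ring

/-- Alternating sums with coefficients of bounded variation tending to zero converge. -/
lemma exists_tendsto_sum_range_neg_one_pow_mul {c : ℕ → ℂ} (h0 : Tendsto c atTop (𝓝 0))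
    (hs : Summable fun n => ‖c n - c (n + 1)‖) :
    ∃ l, Tendsto (fun N => ∑ n ∈ Finset.range N, (-1) ^ n * c n) atTop (𝓝 l) := by
  have hs' : Summable fun n : ℕ => (-1 : ℂ) ^ n * (c n - c (n + 1)) := by
    refine Summable.of_norm ?_
    simpa using hs
  have ht : Tendsto (fun N : ℕ => (-1 : ℂ) ^ N * c N) atTop (𝓝 0) := by
    rw [tendsto_zero_iff_norm_tendsto_zero] at h0 ⊢
    simpa using h0
  refine ⟨_, Tendsto.congr (fun N => (sum_range_neg_one_pow_mul c N).symm)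
    ((tendsto_const_nhds.add (hs'.hasSum.tendsto_sum_nat.div_const 2)).sub (ht.div_const 2))⟩

lemma half_sq_le_norm_sq_add_sq {a : ℂ} {x : ℝ} (hx : 2 * ‖a‖ ≤ x) :
    x ^ 2 / 2 ≤ ‖(x : ℂ) ^ 2 + a ^ 2‖ := by
  have h := norm_sub_le_norm_add ((x : ℂ) ^ 2) (a ^ 2)
  rw [norm_pow, norm_pow, Complex.norm_real, Real.norm_eq_abs, sq_abs] at h
  nlinarith [norm_nonneg a]

lemma norm_sq_add_sq_cpow_le_of_two_mul_norm_le {r : ℝ} (hr : 0 ≤ r) {a : ℂ} {x : ℝ} (h0 : 0 < x)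
    (hx : 2 * ‖a‖ ≤ x) :
    ‖((x : ℂ) ^ 2 + a ^ 2) ^ ((-r : ℝ) : ℂ)‖ ≤ 2 ^ r * x ^ (-(2 * r)) := by
  rw [Complex.norm_cpow_real]
  refine (Real.rpow_le_rpow_of_nonpos (by positivity) (half_sq_le_norm_sq_add_sq hx)
    (by linarith)).trans_eq ?_
  rw [Real.div_rpow (by positivity) two_pos.le, Real.rpow_neg two_pos.le, div_inv_eq_mul,
    ← Real.rpow_natCast, ← Real.rpow_mul h0.le, mul_comm]
  congr 2
  push_cast
  ring

lemma hasDerivAt_sq_add_sq_cpow {a : ℂ} (ha : 0 < a.re) (r : ℝ) (x : ℝ) :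
    HasDerivAt (fun x : ℝ => ((x : ℂ) ^ 2 + a ^ 2) ^ ((-r : ℝ) : ℂ))
      ((-r : ℝ) * ((x : ℂ) ^ 2 + a ^ 2) ^ ((-(r + 1) : ℝ) : ℂ) * (2 * x)) x := by
  have h1 : HasDerivAt (fun z : ℂ => z ^ 2 + a ^ 2) (2 * x) x :=
    ((hasDerivAt_pow 2 (x : ℂ)).add_const (a ^ 2)).congr_deriv (by simp)
  refine (h1.cpow_const (sq_add_sq_mem_slitPlane ha x)).comp_ofReal.congr_deriv ?_
  congr 3
  push_cast
  ring

/-- The mean value inequality on `[n, n+1]` gains a power: the differences are `O(n^{-2μ-1})`,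
summable for every `μ > 0`, although the terms are only `O(n^{-2μ})`. -/
lemma summable_norm_sub_sq_add_sq_cpow {μ : ℝ} (hμ : 0 < μ) {a : ℂ} (ha : 0 < a.re) :
    Summable fun n : ℕ => ‖((n : ℂ) ^ 2 + a ^ 2) ^ ((-μ : ℝ) : ℂ) -
      (((n + 1 : ℕ) : ℂ) ^ 2 + a ^ 2) ^ ((-μ : ℝ) : ℂ)‖ := by
  have hg : Summable fun n : ℕ => 2 * μ * 2 ^ (μ + 1) * (n : ℝ) ^ (-(2 * μ + 1)) :=
    (Real.summable_nat_rpow.2 (by linarith)).mul_left _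
  refine Summable.of_norm_bounded_eventually_nat hg ?_
  filter_upwards [eventually_ge_atTop (⌈2 * ‖a‖⌉₊ + 1)] with n hn
  have hn1 : 2 * ‖a‖ ≤ n := (Nat.le_ceil _).trans (by exact_mod_cast (by omega))
  have hn0 : (0 : ℝ) < n := by exact_mod_cast (by omega)
  rw [norm_norm, norm_sub_rev]
  have h := (convex_Icc (n : ℝ) (n + 1)).norm_image_sub_le_of_norm_hasDerivWithin_le
    (f := fun x : ℝ => ((x : ℂ) ^ 2 + a ^ 2) ^ ((-μ : ℝ) : ℂ))
    (C := 2 * μ * 2 ^ (μ + 1) * (n : ℝ) ^ (-(2 * μ + 1)))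
    (fun x _ => (hasDerivAt_sq_add_sq_cpow ha μ x).hasDerivWithinAt) ?_
    (Set.left_mem_Icc.2 (by linarith)) (Set.right_mem_Icc.2 (by linarith))
  · simpa using h
  · intro x hx
    have hx0 : 0 < x := hn0.trans_le hx.1
    have h2 := norm_sq_add_sq_cpow_le_of_two_mul_norm_le (r := μ + 1) (by linarith) hx0
      (hn1.trans hx.1)
    rw [norm_mul, norm_mul, norm_mul, Complex.norm_real, Complex.norm_real, Complex.norm_ofNat,
      Real.norm_of_nonneg hx0.le, norm_neg, Real.norm_of_nonneg hμ.le]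
    calc _ ≤ μ * (2 ^ (μ + 1) * x ^ (-(2 * (μ + 1)))) * (2 * x) := by gcongr
      _ = 2 * μ * 2 ^ (μ + 1) * (x ^ (-(2 * (μ + 1))) * x ^ (1 : ℝ)) := by rw [Real.rpow_one]; ring
      _ = 2 * μ * 2 ^ (μ + 1) * x ^ (-(2 * μ + 1)) := by
        rw [← Real.rpow_add hx0]; congr 2; ring
      _ ≤ _ := by
        have := Real.rpow_le_rpow_of_nonpos hn0 hx.1 (show -(2 * μ + 1) ≤ 0 by linarith)
        gcongr

lemma tendsto_sq_add_sq_cpow {μ : ℝ} (hμ : 0 < μ) (a : ℂ) :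
    Tendsto (fun n : ℕ => ((n : ℂ) ^ 2 + a ^ 2) ^ ((-μ : ℝ) : ℂ)) atTop (𝓝 0) := by
  rw [tendsto_zero_iff_norm_tendsto_zero]
  have h := ((tendsto_rpow_neg_atTop (show 0 < 2 * μ by linarith)).comp
    (tendsto_natCast_atTop_atTop (R := ℝ))).const_mul (2 ^ μ)
  rw [mul_zero] at h
  refine squeeze_zero' (Eventually.of_forall fun n => norm_nonneg _) ?_ h
  filter_upwards [eventually_ge_atTop (⌈2 * ‖a‖⌉₊ + 1)] with n hn
  have hn1 : 2 * ‖a‖ ≤ n := (Nat.le_ceil _).trans (by exact_mod_cast (by omega))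
  have hn0 : (0 : ℝ) < n := by exact_mod_cast (by omega)
  simpa using norm_sq_add_sq_cpow_le_of_two_mul_norm_le hμ.le hn0 hn1

lemma tendsto_mathieuH_zero {μ : ℝ} (h0 : 0 ≤ μ) (h1 : μ < 1) {a : ℂ} (ha : 0 < a.re) :
    Tendsto (fun lam : ℝ => mathieuH μ lam a) (𝓝[>] 0) (𝓝 0) := by
  have hI : Tendsto (fun lam : ℝ => ∫ t in (0 : ℝ)..1, mathieuHIntegrand μ lam a t) (𝓝[>] 0)
      (𝓝 0) := by
    have hb : Tendsto (fun lam : ℝ => |lam| * (‖a‖ * Real.exp (|lam| * ‖a‖) / (Real.pi * a.re)) *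
        ∫ t in Set.Ioo (0 : ℝ) 1, (1 - t ^ 2) ^ (-μ)) (𝓝[>] 0) (𝓝 0) := by
      have hc : Continuous fun lam : ℝ => |lam| * (‖a‖ * Real.exp (|lam| * ‖a‖) /
        (Real.pi * a.re)) * ∫ t in Set.Ioo (0 : ℝ) 1, (1 - t ^ 2) ^ (-μ) := by fun_prop
      have := (hc.tendsto 0).mono_left (nhdsWithin_le_nhds (s := Set.Ioi 0))
      simpa using this
    refine squeeze_zero_norm (fun lam => ?_) hb
    rw [intervalIntegral.integral_of_le zero_le_one, MeasureTheory.integral_Ioc_eq_integral_Ioo,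
      ← MeasureTheory.integral_const_mul]
    refine MeasureTheory.norm_integral_le_of_norm_le
      ((integrableOn_one_sub_sq_rpow h0 h1).const_mul _) ?_
    filter_upwards [MeasureTheory.ae_restrict_mem measurableSet_Ioo] with t ht
    exact norm_mathieuHIntegrand_le μ lam ha ht
  simpa [mathieuH] using hI.const_mul (a ^ (1 - 2 * μ : ℂ))

lemma continuous_mathieuX (a : ℂ) (k : ℕ) : Continuous fun lam : ℝ => mathieuX lam a k := by
  unfold mathieuX
  fun_prop

lemma continuous_mathieuTTerm {μ : ℝ} (h0 : 0 ≤ μ) (h1 : μ < 1) {a : ℂ} (ha : 0 < a.re) (k : ℕ) :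
    Continuous fun lam : ℝ => mathieuTTerm μ lam a k := by
  have h : Continuous fun lam : ℝ => scaledK μ (mathieuX lam a k) :=
    continuous_iff_continuousAt.2 fun lam => ContinuousAt.comp (f := fun lam : ℝ => mathieuX lam a k)
      (continuousAt_scaledK h0 h1 (mathieuX_mem_slitPlane lam ha k))
      (continuous_mathieuX a k).continuousAt
  have h' := h.comp continuous_neg
  unfold mathieuTTerm
  exact ((h.const_mul _).sub (h'.const_mul _)).const_mul _

/-- Dominated convergence for the series, with the bound that is uniform in `|λ| ≤ 1`. -/
lemma tendsto_mathieuT_zero {μ : ℝ} (h0 : 0 ≤ μ) (h1 : μ < 1) {a : ℂ} (ha : 0 < a.re) :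
    Tendsto (fun lam : ℝ => mathieuT μ lam a) (𝓝[>] 0) (𝓝 (mathieuT μ 0 a)) := by
  have hq := exp_neg_two_pi_mul_lt_one ha
  have h : Tendsto (fun lam : ℝ => ∑' k : ℕ, mathieuTTerm μ lam a k) (𝓝[>] 0)
      (𝓝 (∑' k : ℕ, mathieuTTerm μ 0 a k)) := by
    refine tendsto_tsum_of_dominated_convergence
      (bound := fun k : ℕ => 2 * mathieuBound μ a * Real.exp (-(Real.pi * a.re) + 1 * |a.im|) *
        Real.exp (-(2 * Real.pi * a.re)) ^ k) ?_ ?_ ?_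
    · exact (summable_geometric_of_lt_one (Real.exp_pos _).le hq).mul_left _
    · exact fun k => ((continuous_mathieuTTerm h0 h1 ha k).tendsto 0).mono_left nhdsWithin_le_nhds
    · filter_upwards [Ioo_mem_nhdsGT (zero_lt_one' ℝ)] with lam hl k
      exact norm_mathieuTTerm_le h0 h1 (by rw [abs_of_pos hl.1]; exact hl.2.le) ha k
  simp only [mathieuT_eq]
  exact h.const_mul _

lemma tendsto_exp_neg_nhdsLT_one :
    Tendsto (fun lam : ℝ => Real.exp (-lam)) (𝓝[>] 0) (𝓝[<] 1) := by
  refine tendsto_nhdsWithin_iff.2 ⟨?_, ?_⟩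
  · have h : Continuous fun lam : ℝ => Real.exp (-lam) := by fun_prop
    have := (h.tendsto 0).mono_left (nhdsWithin_le_nhds (s := Set.Ioi 0))
    simpa using this
  · filter_upwards [self_mem_nhdsWithin] with lam hl
    exact Real.exp_lt_one_iff.2 (by simpa using hl)

/-- The expansion at `lam = 0`, for the Abel-convergent alternating series. -/
theorem tendsto_sum_range_sq_add_sq {μ : ℝ} (hμ : 0 < μ) (h1 : μ < 1) {a : ℂ} (ha : 0 < a.re) :
    Tendsto (fun N : ℕ => ∑ n ∈ Finset.range N, (-1) ^ n / ((n : ℂ) ^ 2 + a ^ 2) ^ (μ : ℂ))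
      atTop (𝓝 (1 / (2 * a ^ (2 * μ : ℂ)) + mathieuT μ 0 a)) := by
  have hc : ∀ n : ℕ, (-1) ^ n / ((n : ℂ) ^ 2 + a ^ 2) ^ (μ : ℂ) =
      (-1) ^ n * ((n : ℂ) ^ 2 + a ^ 2) ^ ((-μ : ℝ) : ℂ) := by
    intro n
    rw [div_eq_mul_inv, ← Complex.cpow_neg, Complex.ofReal_neg]
  obtain ⟨l, hl⟩ := exists_tendsto_sum_range_neg_one_pow_mul (tendsto_sq_add_sq_cpow hμ a)
    (summable_norm_sub_sq_add_sq_cpow hμ ha)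
  simp only [← hc] at hl
  -- Abel's limit theorem, with `e^{-λ}` as the variable of the power series: its limit `l` is then
  -- compared with the limit of the exact formula.
  have hAbel := (tendsto_map'_iff.1 (Complex.tendsto_tsum_powerSeries_nhdsWithin_lt hl)).comp
    tendsto_exp_neg_nhdsLT_one
  have hS : Tendsto (fun lam : ℝ => mathieuS μ lam a) (𝓝[>] 0) (𝓝 l) := by
    refine hAbel.congr fun lam => tsum_congr fun n => ?_
    unfold mathieuTerm
    dsimp only
    rw [Complex.ofReal_exp, ← Complex.exp_nat_mul, mul_div_right_comm]
    push_cast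
    rw [mul_neg, mul_comm (n : ℂ)]
  have hR : Tendsto (fun lam : ℝ => mathieuS μ lam a) (𝓝[>] 0)
      (𝓝 (1 / (2 * a ^ (2 * μ : ℂ)) + 0 + mathieuT μ 0 a)) := by
    refine Tendsto.congr' ?_ ((tendsto_const_nhds.add (tendsto_mathieuH_zero hμ.le h1 ha)).add
      (tendsto_mathieuT_zero hμ.le h1 ha))
    filter_upwards [self_mem_nhdsWithin] with lam hlam
    exact (mathieuS_eq hμ.le h1 hlam ha).symm
  rw [add_zero] at hR
  rwa [tendsto_nhds_unique hR hS]

/-- The modulus-phase form with `1/Γ(μ)` and `1/sin πμ`. -/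
theorem mathieuT_ofReal_eq_div_sin {μ : ℝ} (hμ : 0 < μ) (h1 : μ < 1) (lam : ℝ) {a : ℝ}
    (ha : 0 < a) :
    mathieuT μ lam a = ((2 ^ (3 / 2 - μ) * √Real.pi / (a ^ (2 * μ - 1) * Real.Gamma μ) *
      ∑' k : ℕ, Real.sin (Real.pi * μ - mathieuTheta μ lam a k) / Real.sin (Real.pi * μ) *
        ‖besselK (1 / 2 - μ) (mathieuX lam a k) / mathieuX lam a k ^ (1 / 2 - μ : ℂ)‖ : ℝ) : ℂ) := by
  have hΓ := Real.Gamma_pos_of_pos hμ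
  have hsin : 0 < Real.sin (Real.pi * μ) :=
    Real.sin_pos_of_pos_of_lt_pi (mul_pos Real.pi_pos hμ) (by nlinarith [Real.pi_pos])
  have hrefl := Real.Gamma_mul_Gamma_one_sub μ
  rw [mathieuT_ofReal hμ.le h1 lam ha]
  congr 1
  simp only [besselK_div_cpow, div_mul_eq_mul_div, tsum_div_const]
  have e : Real.Gamma (1 - μ) = Real.pi / Real.sin (Real.pi * μ) / Real.Gamma μ := by
    rw [← hrefl]; field_simp
  have hpi := Real.pi_pos
  rw [e]
  generalize ∑' k : ℕ, Real.sin (Real.pi * μ - mathieuTheta μ lam a k) *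
    ‖scaledK μ (mathieuX lam a k)‖ = A
  field_simp

/-! ### Assembly. -/

theorem mainTheorem1 (μ : ℝ) (hμ0 : 0 ≤ μ) (hμ1 : μ < 1) :
    -- the exact representation, for complex `a` in the open sector
    (∀ lam : ℝ, 0 < lam → ∀ a : ℂ, a ≠ 0 → |a.arg| < Real.pi / 2 →
      Summable (mathieuTerm μ lam a) ∧
      IntervalIntegrable (mathieuHIntegrand μ lam a) MeasureTheory.volume 0 1 ∧
      Summable (fun k : ℕ => scaledK μ (mathieuX lam a k)) ∧
      Summable (fun k : ℕ => scaledK μ (mathieuX (-lam) a k)) ∧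
      mathieuS μ lam a = 1 / (2 * a ^ (2 * μ : ℂ)) + mathieuH μ lam a + mathieuT μ lam a) ∧
    -- the modulus-phase form, for `a > 0`, with `Γ(1-μ)/π` in place of `1/(Γ(μ) sin πμ)`
    (∀ lam : ℝ, 0 < lam → ∀ a : ℝ, 0 < a →
      Summable (fun k : ℕ => Real.sin (Real.pi * μ - mathieuTheta μ lam a k) *
        ‖scaledK μ (mathieuX lam a k)‖) ∧
      mathieuT μ lam a = ((2 ^ (3 / 2 - μ) * √Real.pi / a ^ (2 * μ - 1) *
        (Real.Gamma (1 - μ) / Real.pi) *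
        ∑' k : ℕ, Real.sin (Real.pi * μ - mathieuTheta μ lam a k) *
          ‖scaledK μ (mathieuX lam a k)‖ : ℝ) : ℂ)) ∧
    -- the same with `1/Γ(μ)` and `1/sin πμ` written out, for `0 < μ`
    (0 < μ → ∀ lam : ℝ, 0 < lam → ∀ a : ℝ, 0 < a →
      mathieuS μ lam a = 1 / (2 * (a : ℂ) ^ (2 * μ : ℂ)) + mathieuH μ lam a +
        ((2 ^ (3 / 2 - μ) * √Real.pi / (a ^ (2 * μ - 1) * Real.Gamma μ) *
          ∑' k : ℕ, Real.sin (Real.pi * μ - mathieuTheta μ lam a k) / Real.sin (Real.pi * μ) *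
            ‖besselK (1 / 2 - μ) (mathieuX lam a k) /
              mathieuX lam a k ^ (1 / 2 - μ : ℂ)‖ : ℝ) : ℂ)) ∧
    -- exponential smallness for `a → +∞`
    (∀ lam : ℝ, 0 < lam →
      (fun a : ℝ => mathieuT μ lam a) =O[atTop]
        (fun a : ℝ => a ^ (1 - 2 * μ) * Real.exp (-(Real.pi * a)))) ∧
    -- the corresponding bound for complex `a`, uniform in closed subsectors
    (∀ lam : ℝ, 0 < lam → ∀ φ : ℝ, φ < Real.pi / 2 → ∃ C : ℝ, ∀ a : ℂ, 1 ≤ ‖a‖ → |a.arg| ≤ φ →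
      ‖mathieuT μ lam a‖ ≤
        C * ‖a‖ ^ (1 - 2 * μ) * Real.exp (-(Real.pi * a.re) + lam * |a.im|)) ∧
    -- reduction to Olver's expansion when `λ = 0`
    (∀ a : ℂ, a ≠ 0 → |a.arg| < Real.pi / 2 → mathieuH μ 0 a = 0) ∧
    (∀ a : ℝ, 0 < a → ∀ k : ℕ, mathieuTheta μ 0 a k = 0) ∧
    (0 < μ → ∀ a : ℂ, a ≠ 0 → |a.arg| < Real.pi / 2 →
      Summable (fun k : ℕ => besselK (1 / 2 - μ) ((2 * k + 1) * Real.pi * a) /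
        ((2 * k + 1) * Real.pi * a) ^ (1 / 2 - μ : ℂ)) ∧
      mathieuT μ 0 a = olverSeries μ a ∧
      Tendsto (fun N : ℕ => ∑ n ∈ Finset.range N, (-1) ^ n / ((n : ℂ) ^ 2 + a ^ 2) ^ (μ : ℂ))
        atTop (𝓝 (1 / (2 * a ^ (2 * μ : ℂ)) + olverSeries μ a))) := by
  have hre : ∀ a : ℂ, a ≠ 0 → |a.arg| < Real.pi / 2 → 0 < a.re := fun a ha h =>
    (Complex.abs_arg_lt_pi_div_two_iff.1 h).resolve_right ha
  refine ⟨?_, ?_, ?_, ?_, ?_, ?_, ?_, ?_⟩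
  · intro lam hlam a ha harg
    have ha' := hre a ha harg
    exact ⟨summable_mathieuTerm hμ0 hlam ha',
      intervalIntegrable_mathieuHIntegrand hμ0 hμ1 lam ha',
      summable_scaledK_mathieuX hμ0 hμ1 lam ha', summable_scaledK_mathieuX hμ0 hμ1 (-lam) ha',
      mathieuS_eq hμ0 hμ1 hlam ha'⟩
  · exact fun lam _ a ha => ⟨summable_sin_mul_norm_scaledK hμ0 hμ1 lam ha,
      mathieuT_ofReal hμ0 hμ1 lam ha⟩
  · intro hμ lam hlam a ha
    have ha' : 0 < (a : ℂ).re := by simpa using ha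
    rw [mathieuS_eq hμ0 hμ1 hlam ha', mathieuT_ofReal_eq_div_sin hμ hμ1 lam ha]
  · exact fun lam hlam => mathieuT_isBigO hμ0 hμ1 hlam
  · exact fun lam hlam φ hφ => exists_norm_mathieuT_le hμ0 hμ1 hlam hφ
  · exact fun a _ _ => mathieuH_zero μ a
  · exact fun a ha k => mathieuTheta_zero hμ0 hμ1 ha k
  · intro hμ a ha harg
    have ha' := hre a ha harg
    rw [← mathieuT_zero hμ hμ1 a]
    refine ⟨?_, rfl, tendsto_sum_range_sq_add_sq hμ hμ1 ha'⟩
    simp only [besselK_div_cpow, ← mathieuX_zero_left]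
    exact summable_scaledK_mathieuX hμ0 hμ1 0 ha'
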